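/- Let $V$ be an arbitrary model of $\mathrm{ZF}$. Let $\mathcal A=(A,B,\prec,\bot\!\!\!\bot)$ be a realizability algebra in $V$: $A$ and $B\neq\emptyset$ are sets of $V$; $\Lambda$ is the set (in $V$) of closed $\lambda_c$-terms built from variables, application, abstraction, $\mathsf{cc}$, continuation constants $\mathsf k_\pi$ ($\pi$ a stack) and special instructions $\xi_\alpha$ ($\alpha\in A$); $\Pi$ is the set of stacks built from bottoms $\omega_\beta$ ($\beta\in B$) by $t\cdot\pi$ ($t\in\Lambda$, $\pi\in\Pi$); $\prec\,\in V$ is a preorder on $\Lambda\times\Pi$ satisfying $$ts\star\pi\succ t\star s\cdot\pi,\qquad \lambda u.t\star s\cdot\pi\succ t[u:=s]\star\pi,\qquad \mathsf{cc}\star t\cdot\pi\succ t\star \mathsf k_\pi\cdot\pi,\qquad \mathsf k_\sigma\star t\cdot\pi\succ t\star\sigma;$$ and $\bot\!\!\!\bot\in V$ is a subset of $\Lambda\times\Pi$ such that $p\succ q\in\bot\!\!\!\bot$ implies $p\in\bot\!\!\!\bot$. Realizers are the closed $\lambda_c$-terms without continuation constants. The class $N$ of names is $\bigcup_\alpha N_\alpha$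 with $N_\alpha=\bigcup_{\beta<\alpha}\mathcal P(N_\beta\times\Pi)$, and $\mathrm{dom}(a)=\{b\mid\exists\pi\in\Pi\ (b,\pi)\in a\}$. For closed formulas with parameters in $N$ put $|\varphi|=\{t\in\Lambda\mid\forall\pi\in\|\varphi\|,\ t\star\pi\in\bot\!\!\!\bot\}$, where $\|\top\|=\emptyset$, $\|\bot\|=\Pi$, $\|a\not\mathrel{\varepsilon}b\|=\{\pi\mid(a,\pi)\in b\}$, $\|a\neq b\|$ is $\Pi$ if $a=b$ and $\emptyset$ otherwise, and, recursively, $$\|a\notin b\|=\{t\cdot t'\cdot\pi\mid \exists c\ (c,\pi)\in b,\ t\in|a\subseteq c|,\ t'\in|c\subseteq a|\},\qquad \|a\subseteq b\|=\{t\cdot\pi\mid\exists c\ (c,\pi)\in a,\ t\in|c\notin b|\},$$ $$\|\psi\to\theta\|=\{t\cdot\pi\mid t\in|\psi|,\ \pi\in\|\theta\|\},\qquad \|\forall x\,\varphi(x)\|=\bigcup_{a\in N}\|\varphi(a)\|;$$ $a\in b$ abbreviates $a\notin b\to\bot$, $a\simeq b$ abbreviates $a\subseteq b\wedge b\subseteq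 a$, and $\neg,\wedge,\exists$ are encoded through $\to,\bot,\forall$ ($\varphi\wedge\psi$ is $(\varphi\to(\psi\to\bot))\to\bot$, $\exists x\,\varphi$ is $(\forall x(\varphi\to\bot))\to\bot$). Write $\mathcal N\Vdash\varphi$ if $|\varphi|$ contains a realizer. Let $\underline 0=\lambda u.\lambda v.v$ and $\underline{n+1}=\lambda u.\lambda v.(\underline n\,u)(u\,v)$ be the Church numerals, for $n\in\omega^V$, let $\hat n=\{(\hat m,\underline m\cdot\pi)\mid m\in n,\ \pi\in\Pi\}$ and $\hat\omega=\{(\hat m,\underline m\cdot\pi)\mid m\in\omega,\ \pi\in\Pi\}$. For a set $C$ of names let $\gimel(C)=C\times\Pi$. For a name $a$, let "$a\simeq\boldsymbol\omega$" be the formula $\exists w\,(\Omega(w)\wedge a\simeq w)$, where $\Omega(w)$ says, in terms of $\in$, that $w$ is the first infinite ordinal: $w$ is a transitive set of transitive sets, is nonempty and has no greatest element, and no element of $w$ is both nonempty and without greatest element. Then $\hat\omega$ and $\gimel(\mathrm{dom}(\hat\omega))$ are well-defined names, and $$\mathcal N\Vdash\hat\omega\simeq\boldsymbol\omega\qquad\text{and}\qquad\mathcal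 N\Vdash\gimel(\mathrm{dom}(\hat\omega))\simeq\boldsymbol\omega ,$$ each being witnessed by a realizer that contains no special instruction. -/

import Mathlib

open FirstOrder

namespace Realizability

universe u

/-! ### Models of ZF -/

/-- The relation symbols of the language of set theory: one binary symbol. -/
inductive SetRel : ℕ → Type
  | mem : SetRel 2

/-- The first-order language of set theory. -/
def setLang : Language := ⟨fun _ => Empty, SetRel⟩

/-- The structure for the language of set theory given by a binary relation. -/
@[reducible] def memStructure {V : Type u} (E : V → V → Prop) : setLang.Structure V where
  funMap := fun f => Empty.elim f
  RelMap := fun r v => match r, v with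
    | .mem, v => E (v 0) (v 1)

/-- `C` is a class of `(V, E)`: first-order definable with parameters. -/
def DefinableClass {V : Type u} (E : V → V → Prop) (C : V → Prop) : Prop :=
  letI := memStructure E
  (Set.univ : Set V).Definable₁ setLang {x | C x}

/-- `R` is a binary class relation of `(V, E)`: first-order definable with parameters. -/
def DefinableRel {V : Type u} (E : V → V → Prop) (R : V → V → Prop) : Prop :=
  letI := memStructure E
  (Set.univ : Set V).Definable₂ setLang {p | R p.1 p.2}

/-- `V`, with the membership relation `E`, is a (set- or class-sized, not necessarily well-founded)
model of Zermelo-Fraenkel set theory, without choice. -/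
class ZFModel (V : Type u) where
  /-- `E x y` means that `x` is an element of `y`. -/
  E : V → V → Prop
  extensionality : ∀ x y, (∀ z, E z x ↔ E z y) → x = y
  pairing : ∀ x y, ∃ s, ∀ z, E z s ↔ z = x ∨ z = y
  union : ∀ x, ∃ s, ∀ z, E z s ↔ ∃ y, E y x ∧ E z y
  powerset : ∀ x, ∃ s, ∀ z, E z s ↔ ∀ y, E y z → E y x
  infinity : ∃ w, (∃ e, E e w ∧ ∀ z, ¬ E z e) ∧
    ∀ x, E x w → ∃ y, E y w ∧ ∀ z, E z y ↔ E z x ∨ z = x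
  foundation : ∀ x, (∃ y, E y x) → ∃ y, E y x ∧ ∀ z, E z x → ¬ E z y
  separation : ∀ C : V → Prop, DefinableClass E C → ∀ a, ∃ s, ∀ z, E z s ↔ E z a ∧ C z
  replacement : ∀ R : V → V → Prop, DefinableRel E R → ∀ a,
    (∀ x, E x a → ∀ y z, R x y → R x z → y = z) → ∃ s, ∀ y, E y s ↔ ∃ x, E x a ∧ R x y

infix:50 " ∈ᵥ " => ZFModel.E

section Basic

variable {V : Type u} [ZFModel V]

theorem exists_emp : ∃ e : V, ∀ z, ¬ z ∈ᵥ e := by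
  obtain ⟨w, ⟨e, _, he⟩, _⟩ := ZFModel.infinity (V := V)
  exact ⟨e, he⟩

theorem exists_succ (x : V) : ∃ y : V, ∀ z, z ∈ᵥ y ↔ z ∈ᵥ x ∨ z = x := by
  obtain ⟨s, hs⟩ := ZFModel.pairing x x
  obtain ⟨p, hp⟩ := ZFModel.pairing x s
  obtain ⟨y, hy⟩ := ZFModel.union p
  refine ⟨y, fun z => ?_⟩
  rw [hy]
  constructor
  · rintro ⟨q, hq, hz⟩
    rcases (hp q).1 hq with rfl | rfl
    · exact Or.inl hz
    · exact Or.inr (by simpa using (hs z).1 hz)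
  · rintro (h | rfl)
    · exact ⟨x, (hp x).2 (Or.inl rfl), h⟩
    · exact ⟨s, (hp s).2 (Or.inr rfl), (hs z).2 (Or.inl rfl)⟩

/-- The empty set of `V`. -/
noncomputable def emp : V := Classical.choose (exists_emp (V := V))

/-- `x ∪ {x}`. -/
noncomputable def succ (x : V) : V := Classical.choose (exists_succ x)

/-- The unordered pair `{x, y}` of `V`. -/
noncomputable def upair (x y : V) : V := Classical.choose (ZFModel.pairing x y)

/-- The Kuratowski ordered pair of `V`. -/
noncomputable def opair (x y : V) : V := upair (upair x x) (upair x y)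

/-- The numeral `k` of `V`, used for tags. -/
noncomputable def num : ℕ → V
  | 0 => emp
  | k + 1 => succ (num k)

/-- `n` is an element of the set `ω` of `V`, the least inductive set. -/
def IsNat (n : V) : Prop :=
  ∀ w : V, emp ∈ᵥ w → (∀ x, x ∈ᵥ w → succ x ∈ᵥ w) → n ∈ᵥ w

/-! ### `λ_c`-terms and stacks, as elements of `V`

Terms modulo `α`-equivalence are represented with de Bruijn indices, the indices being the elements
of the set `ω` of `V`. -/

/-- The variable with de Bruijn index `i`. -/
noncomputable def tVar (i : V) : V := opair (num 0) i
/-- Application. -/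
noncomputable def tApp (t s : V) : V := opair (num 1) (opair t s)
/-- Abstraction. -/
noncomputable def tLam (t : V) : V := opair (num 2) t
/-- Call-with-current-continuation. -/
noncomputable def tCC : V := opair (num 3) emp
/-- The continuation constant of the stack `π`. -/
noncomputable def tKont (π : V) : V := opair (num 4) π
/-- The special instruction with index `α`. -/
noncomputable def tInstr (α : V) : V := opair (num 5) α
/-- The stack bottom with index `β`. -/
noncomputable def sBot (β : V) : V := opair (num 0) β
/-- The stack with first element `t` and remaining stack `π`. -/
noncomputable def sCons (t π : V) : V := opair (num 1) (opair t π)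

/-- The set `T` of pairs `(n, t)` (read: the free variables of the term `t` have index `< n`) is
closed under the formation rules of terms, without that for continuation constants. -/
structure PureClosed (A T : V) : Prop where
  var : ∀ n i, IsNat n → i ∈ᵥ n → opair n (tVar i) ∈ᵥ T
  app : ∀ n t s, opair n t ∈ᵥ T → opair n s ∈ᵥ T → opair n (tApp t s) ∈ᵥ T
  lam : ∀ n t, opair (succ n) t ∈ᵥ T → opair n (tLam t) ∈ᵥ T
  cc : ∀ n, IsNat n → opair n tCC ∈ᵥ T
  instr : ∀ n α, IsNat n → α ∈ᵥ A → opair n (tInstr α) ∈ᵥ T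

/-- The pair of the set `T` of pairs `(n, t)` and the set `P` is closed under the formation rules
of terms and stacks with special instructions indexed by `A` and stack bottoms indexed by `B`. -/
structure GrammarClosed (A B T P : V) : Prop extends PureClosed A T where
  kont : ∀ n π, IsNat n → π ∈ᵥ P → opair n (tKont π) ∈ᵥ T
  bot : ∀ β, β ∈ᵥ B → sBot β ∈ᵥ P
  cons : ∀ t π, opair emp t ∈ᵥ T → π ∈ᵥ P → sCons t π ∈ᵥ P

/-- `t` is a `λ_c`-term all of whose free variables have index `< n`. -/
def IsTermAt (A B n t : V) : Prop := ∀ T P : V, GrammarClosed A B T P → opair n t ∈ᵥ T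

/-- `t` is a closed `λ_c`-term, that is, an element of `Λ_{A,B}`. -/
def IsTerm (A B t : V) : Prop := IsTermAt A B emp t

/-- `π` is a stack, that is, an element of `Π_{A,B}`. -/
def IsStack (A B π : V) : Prop := ∀ T P : V, GrammarClosed A B T P → π ∈ᵥ P

/-- `t` is a closed `λ_c`-term without continuation constants, whose special instructions have
indices in `A`; in particular, `IsRealizerOver emp t` says that `t` contains moreover no special
instruction. -/
def IsRealizerOver (A t : V) : Prop := ∀ T : V, PureClosed A T → opair emp t ∈ᵥ T

/-- The set `S` of triples `(k, t, r)` (read: `r` is the result of substituting the closed term `s`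
for the variable with index `k` in the term `t`, whose free variables have index `≤ k`) is closed
under the rules of substitution. Continuation constants contain no free variables. -/
structure SubstClosed (A B s S : V) : Prop where
  hit : ∀ k, IsNat k → opair k (opair (tVar k) s) ∈ᵥ S
  miss : ∀ k i, IsNat k → i ∈ᵥ k → opair k (opair (tVar i) (tVar i)) ∈ᵥ S
  app : ∀ k t t' r r', opair k (opair t r) ∈ᵥ S → opair k (opair t' r') ∈ᵥ S →
    opair k (opair (tApp t t') (tApp r r')) ∈ᵥ S
  lam : ∀ k t r, opair (succ k) (opair t r) ∈ᵥ S → opair k (opair (tLam t) (tLam r)) ∈ᵥ S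
  cc : ∀ k, IsNat k → opair k (opair tCC tCC) ∈ᵥ S
  kont : ∀ k π, IsNat k → IsStack A B π → opair k (opair (tKont π) (tKont π)) ∈ᵥ S
  instr : ∀ k α, IsNat k → α ∈ᵥ A → opair k (opair (tInstr α) (tInstr α)) ∈ᵥ S

/-- `r` is `t[u := s]`, where the variable `u` has index `k` in `t`, and `s` is closed. -/
def IsSubst (A B s k t r : V) : Prop :=
  ∀ S : V, SubstClosed A B s S → opair k (opair t r) ∈ᵥ S

/-- `p` is a process, that is, an element of `Λ_{A,B} × Π_{A,B}`. -/
def IsProcess (A B p : V) : Prop := ∃ t π, IsTerm A B t ∧ IsStack A B π ∧ p = opair t π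

end Basic

/-! ### Realizability algebras -/

/-- A realizability algebra in `V`: sets `A`, `B` of `V` with `B` nonempty, a set `ev` of `V` that
is a preorder on processes extending the evaluation preorder (`opair p q ∈ᵥ ev` means `p ≻ q`), and
a pole: a set of processes that is upwards closed for this preorder. -/
structure RealizabilityAlgebra (V : Type u) [ZFModel V] where
  A : V
  B : V
  ev : V
  pole : V
  B_nonempty : ∃ β, β ∈ᵥ B
  ev_subset : ∀ x, x ∈ᵥ ev → ∃ p q, IsProcess A B p ∧ IsProcess A B q ∧ x = opair p q
  ev_refl : ∀ p, IsProcess A B p → opair p p ∈ᵥ ev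
  ev_trans : ∀ p q r, opair p q ∈ᵥ ev → opair q r ∈ᵥ ev → opair p r ∈ᵥ ev
  push : ∀ t s π, IsTerm A B t → IsTerm A B s → IsStack A B π →
    opair (opair (tApp t s) π) (opair t (sCons s π)) ∈ᵥ ev
  grab : ∀ t s r π, IsTermAt A B (num 1) t → IsTerm A B s → IsStack A B π →
    IsSubst A B s emp t r → opair (opair (tLam t) (sCons s π)) (opair r π) ∈ᵥ ev
  save : ∀ t π, IsTerm A B t → IsStack A B π →
    opair (opair tCC (sCons t π)) (opair t (sCons (tKont π) π)) ∈ᵥ ev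
  restore : ∀ t σ π, IsTerm A B t → IsStack A B σ → IsStack A B π →
    opair (opair (tKont σ) (sCons t π)) (opair t σ) ∈ᵥ ev
  pole_subset : ∀ p, p ∈ᵥ pole → IsProcess A B p
  pole_up : ∀ p q, opair p q ∈ᵥ ev → q ∈ᵥ pole → p ∈ᵥ pole

namespace RealizabilityAlgebra

variable {V : Type u} [ZFModel V] (𝒜 : RealizabilityAlgebra V)

/-- The elements of `Λ`. -/
def Term (t : V) : Prop := IsTerm 𝒜.A 𝒜.B t

/-- The elements of `Π`. -/
def Stack (π : V) : Prop := IsStack 𝒜.A 𝒜.B π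

/-- The elements of `ℛ`. -/
def Realizer (t : V) : Prop := IsRealizerOver 𝒜.A t

/-! ### Names -/

/-- `X` is a set of `V` all of whose elements are subsets of `X × Π`. -/
def NameSet (X : V) : Prop :=
  ∀ x, x ∈ᵥ X → ∀ p, p ∈ᵥ x → ∃ b π, b ∈ᵥ X ∧ 𝒜.Stack π ∧ p = opair b π

/-- The class of names: `a` is hereditarily a set of pairs of a name and a stack. By the axiom of
foundation this is the union over the ordinals of the cumulative hierarchy
`N_α = ⋃_{β < α} 𝒫(N_β × Π)`. -/
def IsName (a : V) : Prop := ∃ X, 𝒜.NameSet X ∧ a ∈ᵥ X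

/-- The names, as a type. -/
def Name : Type u := {a : V // 𝒜.IsName a}

/-- `b` is in the domain of the name `a`. -/
def InDom (a b : V) : Prop := ∃ π, 𝒜.Stack π ∧ opair b π ∈ᵥ a

/-! ### Falsity values of the atomic formulas -/

/-- The truth value associated with a falsity value. -/
def orth (F : Set V) : Set V := {t | 𝒜.Term t ∧ ∀ π ∈ F, opair t π ∈ᵥ 𝒜.pole}

/-- `Fs` and `Fn` are sets of `V` consisting of triples `(a, b, π)` that encode on `X` the functions
`(a, b) ↦ ‖a ⊆ b‖` and `(a, b) ↦ ‖a ∉ b‖`, in the sense that they satisfy on `X` the equations of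
the recursive definition of these functions. -/
structure FalsityOn (X Fs Fn : V) : Prop where
  nameSet : 𝒜.NameSet X
  sub_iff : ∀ a b π, a ∈ᵥ X → b ∈ᵥ X → (opair (opair a b) π ∈ᵥ Fs ↔
    ∃ c t σ, opair c σ ∈ᵥ a ∧ t ∈ 𝒜.orth {ρ | opair (opair c b) ρ ∈ᵥ Fn} ∧ π = sCons t σ)
  notMem_iff : ∀ a b π, a ∈ᵥ X → b ∈ᵥ X → (opair (opair a b) π ∈ᵥ Fn ↔
    ∃ c t t' σ, opair c σ ∈ᵥ b ∧ t ∈ 𝒜.orth {ρ | opair (opair a c) ρ ∈ᵥ Fs} ∧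
      t' ∈ 𝒜.orth {ρ | opair (opair c a) ρ ∈ᵥ Fs} ∧ π = sCons t (sCons t' σ))

/-- `‖a ⊆ b‖`, defined by recursion in `V`. -/
def falsSub (a b : V) : Set V :=
  {π | ∃ X Fs Fn, 𝒜.FalsityOn X Fs Fn ∧ a ∈ᵥ X ∧ b ∈ᵥ X ∧ opair (opair a b) π ∈ᵥ Fs}

/-- `‖a ∉ b‖`, defined by recursion in `V`. -/
def falsNotMem (a b : V) : Set V :=
  {π | ∃ X Fs Fn, 𝒜.FalsityOn X Fs Fn ∧ a ∈ᵥ X ∧ b ∈ᵥ X ∧ opair (opair a b) π ∈ᵥ Fn}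

end RealizabilityAlgebra

/-! ### Formulas with parameters -/

/-- Variables and parameters. -/
inductive Trm (N : Type u) : Type u
  | var (i : ℕ)
  | param (a : N)

/-- First-order formulas over the primitives `∉ε`, `≠`, `∉`, `⊆`, `⊤`, `⊥`, `→`, `∀`, with named
variables indexed by natural numbers and with parameters in `N`. -/
inductive Fml (N : Type u) : Type u
  | top
  | bot
  | notEps (a b : Trm N)
  | ne (a b : Trm N)
  | notMem (a b : Trm N)
  | sub (a b : Trm N)
  | imp (φ ψ : Fml N)
  | all (i : ℕ) (φ : Fml N)

/-- The value of a variable or a parameter. -/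
def Trm.val {N : Type u} (v : ℕ → N) : Trm N → N
  | .var i => v i
  | .param a => a

namespace Fml

variable {N : Type u}

/-- `¬ φ`. -/
def neg (φ : Fml N) : Fml N := imp φ bot
/-- `φ ∧ ψ`. -/
def and (φ ψ : Fml N) : Fml N := imp (imp φ (imp ψ bot)) bot
/-- `∃ x_i, φ`. -/
def ex (i : ℕ) (φ : Fml N) : Fml N := imp (all i (imp φ bot)) bot
/-- `a ∈ b`. -/
def mem (a b : Trm N) : Fml N := imp (notMem a b) bot
/-- `a ≃ b`, extensional equality. -/
def simeq (a b : Trm N) : Fml N := and (sub a b) (sub b a)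
/-- `∀ x_i ∈ a, φ`. -/
def allMem (i : ℕ) (a : Trm N) (φ : Fml N) : Fml N := all i (imp (mem (.var i) a) φ)
/-- `∃ x_i ∈ a, φ`. -/
def exMem (i : ℕ) (a : Trm N) (φ : Fml N) : Fml N := ex i (and (mem (.var i) a) φ)

/-- `x_i` is `∈`-transitive (with bound variables `x_3` and `x_4`, for `i ≠ 3, 4`). -/
def trans (i : ℕ) : Fml N := allMem 3 (.var i) (allMem 4 (.var 3) (mem (.var 4) (.var i)))

/-- `x_0` is an `∈`-ordinal: a transitive set of transitive sets. -/
def isOrd : Fml N := and (trans 0) (allMem 1 (.var 0) (trans 1))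

/-- `x_i` is nonempty and has no greatest element
(with bound variables `x_3` and `x_4`, for `i ≠ 3, 4`). -/
def noMax (i : ℕ) : Fml N :=
  and (ex 3 (mem (.var 3) (.var i)))
    (allMem 3 (.var i) (exMem 4 (.var i) (mem (.var 3) (.var 4))))

/-- `x_0` is the first infinite ordinal: a nonzero limit ordinal none of whose elements is a nonzero
limit ordinal. -/
def isOmega : Fml N := and isOrd (and (noMax 0) (allMem 1 (.var 0) (neg (noMax 1))))

/-- The closed formula `a ≃ ω`, that is, `a` is extensionally equal to the first infinite
ordinal. -/
def simeqOmega (a : N) : Fml N := ex 0 (and isOmega (simeq (.param a) (.var 0)))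

end Fml

namespace RealizabilityAlgebra

variable {V : Type u} [ZFModel V] (𝒜 : RealizabilityAlgebra V)

/-- The falsity value of a formula with parameters in the names, under an assignment of names to
its free variables. -/
def falsity : Fml 𝒜.Name → (ℕ → 𝒜.Name) → Set V
  | .top, _ => ∅
  | .bot, _ => {π | 𝒜.Stack π}
  | .notEps a b, v => {π | 𝒜.Stack π ∧ opair (a.val v).1 π ∈ᵥ (b.val v).1}
  | .ne a b, v => {π | 𝒜.Stack π ∧ a.val v = b.val v}
  | .notMem a b, v => 𝒜.falsNotMem (a.val v).1 (b.val v).1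
  | .sub a b, v => 𝒜.falsSub (a.val v).1 (b.val v).1
  | .imp φ ψ, v => {ρ | ∃ t ∈ 𝒜.orth (falsity φ v), ∃ π ∈ falsity ψ v, ρ = sCons t π}
  | .all i φ, v => ⋃ a : 𝒜.Name, falsity φ (Function.update v i a)

/-- The closed term `t` realizes the closed formula `φ` (whose falsity value does not depend on the
assignment). -/
def Realizes (t : V) (φ : Fml 𝒜.Name) : Prop := ∀ v, t ∈ 𝒜.orth (𝒜.falsity φ v)

/-- `φ` belongs to the realizability theory (`𝒩 ⊩ φ`): some realizer realizes `φ`. -/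
def Forces (φ : Fml 𝒜.Name) : Prop := ∃ t, 𝒜.Realizer t ∧ 𝒜.Realizes t φ

/-- `φ` belongs to the realizability theory, and this is witnessed by a realizer that contains no
special instruction. -/
def ForcesWithoutInstructions (φ : Fml 𝒜.Name) : Prop :=
  ∃ t, 𝒜.Realizer t ∧ IsRealizerOver emp t ∧ 𝒜.Realizes t φ

theorem ForcesWithoutInstructions.forces {𝒜 : RealizabilityAlgebra V} {φ : Fml 𝒜.Name}
    (h : 𝒜.ForcesWithoutInstructions φ) : 𝒜.Forces φ :=
  let ⟨t, ht, _, hr⟩ := h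
  ⟨t, ht, hr⟩

end RealizabilityAlgebra

/-! ### The hat name of `ω` -/

section Hat

variable {V : Type u} [ZFModel V]

/-- The numeral zero: `λ u. λ v. v`. -/
noncomputable def churchZero : V := tLam (tLam (tVar (num 0)))

/-- From `n` to the numeral of the successor: `λ u. λ v. (n u) (u v)`. -/
noncomputable def churchSucc (n : V) : V :=
  tLam (tLam (tApp (tApp n (tVar (num 1))) (tApp (tVar (num 1)) (tVar (num 0)))))

/-- `t` is the Church numeral of `n ∈ ω`; this is the function defined by recursion on the `ω` of
`V` from `churchZero` and `churchSucc`. -/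
def IsChurch (n t : V) : Prop :=
  ∀ S : V, opair emp churchZero ∈ᵥ S →
    (∀ m s, IsNat m → opair m s ∈ᵥ S → opair (succ m) (churchSucc s) ∈ᵥ S) → opair n t ∈ᵥ S

variable (𝒜 : RealizabilityAlgebra V)

/-- `p` is a pair `(g(m), ν_m · π)` for a stack `π`, where `ν_m` is the Church numeral of `m`. -/
def RealizabilityAlgebra.IsHatElement (g m p : V) : Prop :=
  ∃ h t π, opair m h ∈ᵥ g ∧ IsChurch m t ∧ 𝒜.Stack π ∧ p = opair h (sCons t π)

/-- The set `g` of `V` is the function `n ↦ n̂ = {(m̂, ν_m · π) | m ∈ n, π ∈ Π}` on `ω`. -/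
structure RealizabilityAlgebra.IsHatFunction (g : V) : Prop where
  isPair : ∀ x, x ∈ᵥ g → ∃ n h, IsNat n ∧ x = opair n h
  existsUnique : ∀ n, IsNat n → ∃! h, opair n h ∈ᵥ g
  mem_iff : ∀ n h, opair n h ∈ᵥ g → ∀ p, p ∈ᵥ h ↔ ∃ m, m ∈ᵥ n ∧ 𝒜.IsHatElement g m p

/-- `W` is `ω̂ = {(m̂, ν_m · π) | m ∈ ω, π ∈ Π}`, with the Church numerals for `ν_m`. -/
def RealizabilityAlgebra.IsOmegaHat (W : V) : Prop :=
  ∃ g, 𝒜.IsHatFunction g ∧ ∀ p, p ∈ᵥ W ↔ ∃ m, IsNat m ∧ 𝒜.IsHatElement g m p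

/-- `G` is the gimel name of the class `C` of names, that is, `G = C × Π`. -/
def RealizabilityAlgebra.IsGimel (C : V → Prop) (G : V) : Prop :=
  ∀ p, p ∈ᵥ G ↔ ∃ b π, C b ∧ 𝒜.Stack π ∧ p = opair b π

end Hat

end Realizability

open Realizability

namespace Realizability

universe u

/-! ### First-order definability -/

section Definability

variable {V : Type u} [ZFModel V] {n : ℕ}

/-! The realizers are pure closed λ-terms written in the metatheory (`Tm`) and typed semantically by
`Judge`: contexts and types are truth values, and each evaluation rule of the algebra yields a
typing rule. A proof of a formula in this calculus is therefore a term without special instructions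
that realizes it. Recursive arguments use Turing's combinator (`Judge.fix`). Since `V` may be
ill-founded and its `ω` nonstandard from outside, every induction takes place inside `V` on a
definable predicate. `Dfn` and `DfnFun` let instance search find the definability proofs.

The names behave well because an element m̂ of ω̂ or of n̂ carries the numeral of m. One term,
`incl`, realizes all inclusions m̂ ⊆ n̂ (m ≤ n) and n̂ ⊆ ω̂. Adding one to the numeral shows that ω̂
has no greatest element. Case analysis on it (`Judge.caseOf`) shows that an element of ω̂ is empty
or has a greatest element, with `judge_irrefl` excluding m̂ ∈ m̂. Together with reflexivity and
transitivity of ⊆ (`judge_refl`, `judge_trans`), this makes ω̂ its own witness for the first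
infinite ordinal.

For ℷ(dom ω̂), the inclusion of ω̂ just forgets the numeral. Conversely the numeral of m has to be
found, given only a realizer of m̂ ∉ ω̂ and the task of reaching ⊥. `judge_searchFrom` feeds that
realizer the candidates k = 0, 1, 2, … ≤ m. Then k̂ ⊆ m̂ holds, while m̂ ⊆ k̂ is only claimed: when
the claim is challenged with some j < m, `less` compares j with k. If j < k the challenge is
answered. Otherwise k < m, and the search restarts at k + 1. Downward induction on k, inside `V`,
shows that this is sound. -/

/-- The structure of `V` for the language of set theory. -/
instance setStructure : setLang.Structure V := memStructure ZFModel.E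

/-- The relation `P` is first-order definable in `V` with parameters. -/
class Dfn (P : (Fin n → V) → Prop) : Prop where
  out : (Set.univ : Set V).Definable setLang {v | P v}

/-- The function `f` is first-order definable in `V` with parameters. -/
class DfnFun (f : (Fin n → V) → V) : Prop where
  out : (Set.univ : Set V).DefinableFun setLang f

theorem Dfn.congr {P Q : (Fin n → V) → Prop} (h : Dfn Q) (e : ∀ v, P v ↔ Q v) : Dfn P := by
  rwa [show P = Q from funext fun v => propext (e v)]

instance DfnFun.proj (i : Fin n) : DfnFun (fun v : Fin n → V => v i) :=
  ⟨Set.DefinableFun.proj setLang⟩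

instance DfnFun.const (c : V) : DfnFun (fun _ : Fin n → V => c) :=
  ⟨setLang.definableFun_const _ (Set.mem_univ c)⟩

/-- No formula for `p` is needed: in the metatheory it is either true or false, so the set is
everything or empty. -/
instance Dfn.const (p : Prop) : Dfn (fun _ : Fin n → V => p) := by
  by_cases h : p
  · exact ⟨by simp [h]⟩
  · exact ⟨by simp [h]⟩

instance Dfn.not {P : (Fin n → V) → Prop} [h : Dfn P] : Dfn (fun v => ¬ P v) := ⟨h.out.compl⟩

instance Dfn.and {P Q : (Fin n → V) → Prop} [h : Dfn P] [h' : Dfn Q] :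
    Dfn (fun v => P v ∧ Q v) := ⟨h.out.inter h'.out⟩

instance Dfn.or {P Q : (Fin n → V) → Prop} [h : Dfn P] [h' : Dfn Q] :
    Dfn (fun v => P v ∨ Q v) := ⟨h.out.union h'.out⟩

instance Dfn.imp {P Q : (Fin n → V) → Prop} [h : Dfn P] [h' : Dfn Q] :
    Dfn (fun v => P v → Q v) :=
  Dfn.congr (Q := fun v => ¬ P v ∨ Q v) inferInstance fun _ => imp_iff_not_or

instance Dfn.iff {P Q : (Fin n → V) → Prop} [h : Dfn P] [h' : Dfn Q] :
    Dfn (fun v => P v ↔ Q v) :=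
  Dfn.congr (Q := fun v => (P v → Q v) ∧ (Q v → P v)) inferInstance fun _ => iff_def

/-- The bound variable becomes coordinate 0 and the others are shifted, so instance search can
descend under quantifiers. -/
instance Dfn.ex {P : (Fin n → V) → V → Prop}
    [h : Dfn (fun w : Fin (n + 1) → V => P (fun i => w i.succ) (w 0))] :
    Dfn (fun v => ∃ x, P v x) := by
  refine ⟨?_⟩
  have h1 := (h.out.preimage_comp (fun i : Fin (n + 1) =>
    (Fin.cases (Sum.inr ()) Sum.inl i : Fin n ⊕ Unit))).exists_of_finite
  convert! h1 using 1
  ext v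
  constructor
  · rintro ⟨x, hx⟩
    exact ⟨fun _ => x, hx⟩
  · rintro ⟨x, hx⟩
    exact ⟨x (), hx⟩

instance Dfn.all {P : (Fin n → V) → V → Prop}
    [h : Dfn (fun w : Fin (n + 1) → V => P (fun i => w i.succ) (w 0))] :
    Dfn (fun v => ∀ x, P v x) :=
  Dfn.congr (Q := fun v => ¬ ∃ x, ¬ P v x) inferInstance fun _ => by simp

theorem Dfn.subst {k : ℕ} {P : (Fin k → V) → Prop} (h : Dfn P) (f : Fin k → (Fin n → V) → V)
    (hf : ∀ i, DfnFun (f i)) : Dfn (fun v => P (fun i => f i v)) :=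
  ⟨Set.Definable.preimage_map (F := fun v i => f i v) (fun i => (hf i).out) h.out⟩

/-- With these variants for each arity, the definability of a relation is checked once, on the
coordinate functions, and then holds for all definable arguments. -/
theorem Dfn.of1 {R : V → Prop} (h : Dfn (fun v : Fin 1 → V => R (v 0)))
    {f : (Fin n → V) → V} [hf : DfnFun f] : Dfn (fun v => R (f v)) :=
  h.subst ![f] (by intro i; fin_cases i; exact hf)

theorem Dfn.of2 {R : V → V → Prop} (h : Dfn (fun v : Fin 2 → V => R (v 0) (v 1)))
    {f g : (Fin n → V) → V} [hf : DfnFun f] [hg : DfnFun g] : Dfn (fun v => R (f v) (g v)) :=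
  h.subst ![f, g] (by intro i; fin_cases i; exacts [hf, hg])

theorem Dfn.of3 {R : V → V → V → Prop} (h : Dfn (fun v : Fin 3 → V => R (v 0) (v 1) (v 2)))
    {f g k : (Fin n → V) → V} [hf : DfnFun f] [hg : DfnFun g] [hk : DfnFun k] :
    Dfn (fun v => R (f v) (g v) (k v)) :=
  h.subst ![f, g, k] (by intro i; fin_cases i; exacts [hf, hg, hk])

theorem Dfn.of4 {R : V → V → V → V → Prop}
    (h : Dfn (fun v : Fin 4 → V => R (v 0) (v 1) (v 2) (v 3)))
    {f g k l : (Fin n → V) → V} [hf : DfnFun f] [hg : DfnFun g] [hk : DfnFun k] [hl : DfnFun l] :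
    Dfn (fun v => R (f v) (g v) (k v) (l v)) :=
  h.subst ![f, g, k, l] (by intro i; fin_cases i; exacts [hf, hg, hk, hl])

theorem Dfn.of6 {R : V → V → V → V → V → V → Prop}
    (h : Dfn (fun v : Fin 6 → V => R (v 0) (v 1) (v 2) (v 3) (v 4) (v 5)))
    {f g k l p q : (Fin n → V) → V} [hf : DfnFun f] [hg : DfnFun g] [hk : DfnFun k]
    [hl : DfnFun l] [hp : DfnFun p] [hq : DfnFun q] :
    Dfn (fun v => R (f v) (g v) (k v) (l v) (p v) (q v)) :=
  h.subst ![f, g, k, l, p, q] (by intro i; fin_cases i; exacts [hf, hg, hk, hl, hp, hq])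

theorem DfnFun.of_graph {f : (Fin n → V) → V}
    (h : Dfn (fun w : Fin (n + 1) → V => w 0 = f (fun i => w i.succ))) : DfnFun f := by
  refine ⟨?_⟩
  have h1 := h.out.preimage_comp (fun i : Fin (n + 1) =>
    (Fin.cases none some i : Option (Fin n)))
  have e : Function.tupleGraph f = (fun g : Option (Fin n) → V => g ∘ fun i : Fin (n + 1) =>
      (Fin.cases none some i : Option (Fin n))) ⁻¹' {v | v 0 = f fun i => v i.succ} := by
    ext w
    exact eq_comm
  rw [Set.DefinableFun, e]
  exact h1

theorem DfnFun.subst {k : ℕ} {F : (Fin k → V) → V} (h : DfnFun F) (f : Fin k → (Fin n → V) → V)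
    (hf : ∀ i, DfnFun (f i)) : DfnFun (fun v => F (fun i => f i v)) :=
  ⟨Set.DefinableFun.comp (g := fun v i => f i v) (fun i => (hf i).out) h.out⟩

theorem DfnFun.of1 {F : V → V} (h : Dfn (fun v : Fin 2 → V => v 0 = F (v 1)))
    {f : (Fin n → V) → V} [hf : DfnFun f] : DfnFun (fun v => F (f v)) :=
  (DfnFun.of_graph (f := fun v : Fin 1 → V => F (v 0)) h).subst ![f]
    (by intro i; fin_cases i; exact hf)

theorem DfnFun.of2 {F : V → V → V} (h : Dfn (fun v : Fin 3 → V => v 0 = F (v 1) (v 2)))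
    {f g : (Fin n → V) → V} [hf : DfnFun f] [hg : DfnFun g] : DfnFun (fun v => F (f v) (g v)) :=
  (DfnFun.of_graph (f := fun v : Fin 2 → V => F (v 0) (v 1)) h).subst ![f, g]
    (by intro i; fin_cases i; exacts [hf, hg])

instance Dfn.eq {f g : (Fin n → V) → V} [hf : DfnFun f] [hg : DfnFun g] :
    Dfn (fun v => f v = g v) := ⟨hf.out.ofPred_eq hg.out⟩

instance Dfn.mem {f g : (Fin n → V) → V} [hf : DfnFun f] [hg : DfnFun g] :
    Dfn (fun v => f v ∈ᵥ g v) :=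
  Dfn.of2 (R := ZFModel.E) (by
    refine ⟨Set.Definable.mono (A := ∅) ?_ (Set.empty_subset _)⟩
    rw [Set.empty_definable_iff]
    refine ⟨Language.Relations.formula₂ (L := setLang) (SetRel.mem : setLang.Relations 2)
      (Language.Term.var 0) (Language.Term.var 1), ?_⟩
    ext v
    simp
    rfl)

/-! ### Set-theoretic operations -/

theorem exists_sep (P : V → Prop) [h : Dfn (fun v : Fin 1 → V => P (v 0))] (a : V) :
    ∃ s : V, ∀ z, z ∈ᵥ s ↔ z ∈ᵥ a ∧ P z :=
  ZFModel.separation P h.out a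

theorem ext_iff {x y : V} : x = y ↔ ∀ z, z ∈ᵥ x ↔ z ∈ᵥ y :=
  ⟨fun h _ => h ▸ Iff.rfl, ZFModel.extensionality x y⟩

@[simp] theorem not_mem_emp (z : V) : ¬ z ∈ᵥ emp := Classical.choose_spec (exists_emp (V := V)) z

@[simp] theorem mem_succ {x z : V} : z ∈ᵥ succ x ↔ z ∈ᵥ x ∨ z = x :=
  Classical.choose_spec (exists_succ x) z

@[simp] theorem mem_upair {x y z : V} : z ∈ᵥ upair x y ↔ z = x ∨ z = y :=
  Classical.choose_spec (ZFModel.pairing x y) z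

/-- The union of a set of sets. -/
noncomputable def sUnion (x : V) : V := Classical.choose (ZFModel.union x)

@[simp] theorem mem_sUnion {x z : V} : z ∈ᵥ sUnion x ↔ ∃ y, y ∈ᵥ x ∧ z ∈ᵥ y :=
  Classical.choose_spec (ZFModel.union x) z

/-- The power set. -/
noncomputable def pow (x : V) : V := Classical.choose (ZFModel.powerset x)

@[simp] theorem mem_pow {x z : V} : z ∈ᵥ pow x ↔ ∀ y, y ∈ᵥ z → y ∈ᵥ x :=
  Classical.choose_spec (ZFModel.powerset x) z

/-- The union of two sets. -/
noncomputable def cup (x y : V) : V := sUnion (upair x y)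

@[simp] theorem mem_cup {x y z : V} : z ∈ᵥ cup x y ↔ z ∈ᵥ x ∨ z ∈ᵥ y := by
  simp [cup]

theorem upair_self_inj {a b : V} (h : upair a a = upair b b) : a = b := by
  simpa using (ext_iff.1 h a)

theorem opair_inj {a b c d : V} : opair a b = opair c d ↔ a = c ∧ b = d := by
  refine ⟨fun h => ?_, by rintro ⟨rfl, rfl⟩; rfl⟩
  have key : ∀ z, (z = upair a a ∨ z = upair a b) ↔ (z = upair c c ∨ z = upair c d) := by
    intro z; simpa [opair] using (ext_iff.1 h z)
  have hac : a = c := by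
    rcases (key (upair a a)).1 (Or.inl rfl) with h1 | h1
    · exact upair_self_inj h1
    · have h2 := (ext_iff.1 h1 c).2 (by simp); simpa [eq_comm] using h2
  subst hac
  refine ⟨rfl, ?_⟩
  have e1 : b = a ∨ b = d := by
    rcases (key (upair a b)).1 (Or.inr rfl) with h1 | h1
    · exact Or.inl (by simpa using (ext_iff.1 h1 b))
    · simpa using (ext_iff.1 h1 b)
  have e2 : d = a ∨ d = b := by
    rcases (key (upair a d)).2 (Or.inr rfl) with h1 | h1
    · exact Or.inl (by simpa using (ext_iff.1 h1 d))
    · simpa using (ext_iff.1 h1 d)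
  rcases e1 with e1 | e1
  · rcases e2 with e2 | e2
    · rw [e1, e2]
    · exact e2.symm
  · exact e1

attribute [simp] opair_inj

instance DfnFun.succ {f : (Fin n → V) → V} [DfnFun f] : DfnFun (fun v => succ (f v)) :=
  DfnFun.of1 (Dfn.congr (Q := fun v => ∀ z, z ∈ᵥ v 0 ↔ (z ∈ᵥ v 1 ∨ z = v 1)) inferInstance
    fun v => by simp [ext_iff])

instance DfnFun.upair {f g : (Fin n → V) → V} [DfnFun f] [DfnFun g] :
    DfnFun (fun v => upair (f v) (g v)) :=
  DfnFun.of2 (Dfn.congr (Q := fun v => ∀ z, z ∈ᵥ v 0 ↔ (z = v 1 ∨ z = v 2)) inferInstance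
    fun v => by simp [ext_iff])

instance DfnFun.opair {f g : (Fin n → V) → V} [DfnFun f] [DfnFun g] :
    DfnFun (fun v => opair (f v) (g v)) := by unfold Realizability.opair; infer_instance

instance DfnFun.pow {f : (Fin n → V) → V} [DfnFun f] : DfnFun (fun v => pow (f v)) :=
  DfnFun.of1 (Dfn.congr (Q := fun v => ∀ z, z ∈ᵥ v 0 ↔ ∀ y, y ∈ᵥ z → y ∈ᵥ v 1) inferInstance
    fun v => by simp [ext_iff])

instance DfnFun.cup {f g : (Fin n → V) → V} [DfnFun f] [DfnFun g] :
    DfnFun (fun v => cup (f v) (g v)) :=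
  DfnFun.of2 (Dfn.congr (Q := fun v => ∀ z, z ∈ᵥ v 0 ↔ (z ∈ᵥ v 1 ∨ z ∈ᵥ v 2)) inferInstance
    fun v => by simp [ext_iff])

instance DfnFun.tVar {f : (Fin n → V) → V} [DfnFun f] : DfnFun (fun v => tVar (f v)) := by
  unfold Realizability.tVar; infer_instance

instance DfnFun.tApp {f g : (Fin n → V) → V} [DfnFun f] [DfnFun g] :
    DfnFun (fun v => tApp (f v) (g v)) := by unfold Realizability.tApp; infer_instance

instance DfnFun.tLam {f : (Fin n → V) → V} [DfnFun f] : DfnFun (fun v => tLam (f v)) := by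
  unfold Realizability.tLam; infer_instance

instance DfnFun.tKont {f : (Fin n → V) → V} [DfnFun f] : DfnFun (fun v => tKont (f v)) := by
  unfold Realizability.tKont; infer_instance

instance DfnFun.tInstr {f : (Fin n → V) → V} [DfnFun f] : DfnFun (fun v => tInstr (f v)) := by
  unfold Realizability.tInstr; infer_instance

instance DfnFun.sBot {f : (Fin n → V) → V} [DfnFun f] : DfnFun (fun v => sBot (f v)) := by
  unfold Realizability.sBot; infer_instance

instance DfnFun.sCons {f g : (Fin n → V) → V} [DfnFun f] [DfnFun g] :
    DfnFun (fun v => sCons (f v) (g v)) := by unfold Realizability.sCons; infer_instance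

instance DfnFun.churchSucc {f : (Fin n → V) → V} [DfnFun f] :
    DfnFun (fun v => churchSucc (f v)) := by unfold Realizability.churchSucc; infer_instance

instance Dfn.isNat {f : (Fin n → V) → V} [DfnFun f] : Dfn (fun v => IsNat (f v)) :=
  Dfn.of1 (by unfold IsNat; infer_instance)

/-- Unfolds the structure into a conjunction of first-order clauses that instance search can treat.
-/
theorem pureClosed_iff (A T : V) : PureClosed A T ↔
    (∀ n i, IsNat n → i ∈ᵥ n → opair n (tVar i) ∈ᵥ T) ∧
    (∀ n t s, opair n t ∈ᵥ T → opair n s ∈ᵥ T → opair n (tApp t s) ∈ᵥ T) ∧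
    (∀ n t, opair (succ n) t ∈ᵥ T → opair n (tLam t) ∈ᵥ T) ∧
    (∀ n, IsNat n → opair n tCC ∈ᵥ T) ∧
    (∀ n α, IsNat n → α ∈ᵥ A → opair n (tInstr α) ∈ᵥ T) :=
  ⟨fun ⟨a, b, c, d, e⟩ => ⟨a, b, c, d, e⟩, fun ⟨a, b, c, d, e⟩ => ⟨a, b, c, d, e⟩⟩

theorem grammarClosed_iff (A B T P : V) : GrammarClosed A B T P ↔
    PureClosed A T ∧ (∀ n π, IsNat n → π ∈ᵥ P → opair n (tKont π) ∈ᵥ T) ∧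
    (∀ β, β ∈ᵥ B → sBot β ∈ᵥ P) ∧
    (∀ t π, opair emp t ∈ᵥ T → π ∈ᵥ P → sCons t π ∈ᵥ P) :=
  ⟨fun ⟨a, b, c, d⟩ => ⟨a, b, c, d⟩, fun ⟨a, b, c, d⟩ => ⟨a, b, c, d⟩⟩

theorem substClosed_iff (A B s S : V) : SubstClosed A B s S ↔
    (∀ k, IsNat k → opair k (opair (tVar k) s) ∈ᵥ S) ∧
    (∀ k i, IsNat k → i ∈ᵥ k → opair k (opair (tVar i) (tVar i)) ∈ᵥ S) ∧
    (∀ k t t' r r', opair k (opair t r) ∈ᵥ S → opair k (opair t' r') ∈ᵥ S →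
      opair k (opair (tApp t t') (tApp r r')) ∈ᵥ S) ∧
    (∀ k t r, opair (succ k) (opair t r) ∈ᵥ S → opair k (opair (tLam t) (tLam r)) ∈ᵥ S) ∧
    (∀ k, IsNat k → opair k (opair tCC tCC) ∈ᵥ S) ∧
    (∀ k π, IsNat k → IsStack A B π → opair k (opair (tKont π) (tKont π)) ∈ᵥ S) ∧
    (∀ k α, IsNat k → α ∈ᵥ A → opair k (opair (tInstr α) (tInstr α)) ∈ᵥ S) :=
  ⟨fun ⟨a, b, c, d, e, f, g⟩ => ⟨a, b, c, d, e, f, g⟩,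
    fun ⟨a, b, c, d, e, f, g⟩ => ⟨a, b, c, d, e, f, g⟩⟩

instance Dfn.pureClosed {f g : (Fin n → V) → V} [DfnFun f] [DfnFun g] :
    Dfn (fun v => PureClosed (f v) (g v)) :=
  Dfn.of2 (by simp only [pureClosed_iff]; infer_instance)

instance Dfn.grammarClosed {f g k l : (Fin n → V) → V} [DfnFun f] [DfnFun g] [DfnFun k]
    [DfnFun l] : Dfn (fun v => GrammarClosed (f v) (g v) (k v) (l v)) :=
  Dfn.of4 (by simp only [grammarClosed_iff]; infer_instance)

instance Dfn.isTermAt {f g k l : (Fin n → V) → V} [DfnFun f] [DfnFun g] [DfnFun k]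
    [DfnFun l] : Dfn (fun v => IsTermAt (f v) (g v) (k v) (l v)) :=
  Dfn.of4 (by unfold IsTermAt; infer_instance)

instance Dfn.isTerm {f g k : (Fin n → V) → V} [DfnFun f] [DfnFun g] [DfnFun k] :
    Dfn (fun v => IsTerm (f v) (g v) (k v)) :=
  Dfn.of3 (by unfold IsTerm; infer_instance)

instance Dfn.isStack {f g k : (Fin n → V) → V} [DfnFun f] [DfnFun g] [DfnFun k] :
    Dfn (fun v => IsStack (f v) (g v) (k v)) :=
  Dfn.of3 (by unfold IsStack; infer_instance)

set_option synthInstance.maxSize 4096 in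
set_option synthInstance.maxHeartbeats 400000 in
instance Dfn.substClosed {f g k l : (Fin n → V) → V} [DfnFun f] [DfnFun g] [DfnFun k]
    [DfnFun l] : Dfn (fun v => SubstClosed (f v) (g v) (k v) (l v)) :=
  Dfn.of4 (by simp only [substClosed_iff]; infer_instance)

instance Dfn.isSubst {f g k l p q : (Fin n → V) → V} [DfnFun f] [DfnFun g] [DfnFun k]
    [DfnFun l] [DfnFun p] [DfnFun q] :
    Dfn (fun v => IsSubst (f v) (g v) (k v) (l v) (p v) (q v)) :=
  Dfn.of6 (by unfold IsSubst; infer_instance)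

instance Dfn.isChurch {f g : (Fin n → V) → V} [DfnFun f] [DfnFun g] :
    Dfn (fun v => IsChurch (f v) (g v)) :=
  Dfn.of2 (by unfold IsChurch; infer_instance)

end Definability

section Naturals

variable {V : Type u} [ZFModel V]

/-! ### Natural numbers of `V` -/

theorem not_mem_self (x : V) : ¬ x ∈ᵥ x := by
  intro h
  obtain ⟨y, hy, hy'⟩ := ZFModel.foundation (upair x x) ⟨x, by simp⟩
  obtain rfl : y = x := by simpa using hy
  exact hy' y hy h

theorem not_mem_of_mem {x y : V} (h : x ∈ᵥ y) : ¬ y ∈ᵥ x := by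
  intro h'
  obtain ⟨z, hz, hz'⟩ := ZFModel.foundation (upair x y) ⟨x, by simp⟩
  rcases mem_upair.1 hz with rfl | rfl
  · exact hz' y (by simp) h'
  · exact hz' x (by simp) h

theorem IsNat.zero : IsNat (emp : V) := fun _ h _ => h

theorem IsNat.succ {n : V} (h : IsNat n) : IsNat (succ n) := fun w h0 hs => hs _ (h w h0 hs)

theorem isNat_num (k : ℕ) : IsNat (num k : V) := by
  induction k with
  | zero => exact IsNat.zero
  | succ k ih => exact ih.succ

theorem exists_omega : ∃ w : V, ∀ n, n ∈ᵥ w ↔ IsNat n := by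
  obtain ⟨w, ⟨e, he, he'⟩, hw⟩ := ZFModel.infinity (V := V)
  obtain ⟨s, hs⟩ := exists_sep (fun n : V => IsNat n) w
  refine ⟨s, fun n => ⟨fun h => ((hs n).1 h).2, fun h => (hs n).2 ⟨h w ?_ ?_, h⟩⟩⟩
  · rwa [show (emp : V) = e from ext_iff.2 fun z => by simp [he' z] ]
  · intro x hx
    obtain ⟨y, hy, hy'⟩ := hw x hx
    rwa [show succ x = y from ext_iff.2 fun z => by simp [hy' z] ]

/-- The set `ω`. -/
noncomputable def omega : V := Classical.choose (exists_omega (V := V))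

@[simp] theorem mem_omega {n : V} : n ∈ᵥ omega ↔ IsNat n :=
  Classical.choose_spec (exists_omega (V := V)) n

/-- Definability is essential, since the naturals of `V` are minimal only among the sets of `V`. -/
theorem IsNat.induction (P : V → Prop) [Dfn (fun v : Fin 1 → V => P (v 0))] (h0 : P emp)
    (hs : ∀ n, IsNat n → P n → P (Realizability.succ n)) {n : V} (hn : IsNat n) : P n := by
  obtain ⟨s, hs'⟩ := exists_sep P omega
  refine ((hs' n).1 (hn s ?_ ?_)).2
  · exact (hs' _).2 ⟨mem_omega.2 .zero, h0⟩
  · intro x hx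
    obtain ⟨h1, h2⟩ := (hs' x).1 hx
    exact (hs' _).2 ⟨mem_omega.2 (mem_omega.1 h1).succ, hs x (mem_omega.1 h1) h2⟩

theorem IsNat.of_mem {n m : V} (hn : IsNat n) : m ∈ᵥ n → IsNat m := by
  refine IsNat.induction (fun n => ∀ m, m ∈ᵥ n → IsNat m) (by simp) ?_ hn m
  rintro n hn ih m hm
  rcases mem_succ.1 hm with h | rfl
  exacts [ih m h, hn]

theorem IsNat.trans {n m k : V} (hn : IsNat n) : m ∈ᵥ n → k ∈ᵥ m → k ∈ᵥ n := by
  refine IsNat.induction (fun n => ∀ m k, m ∈ᵥ n → k ∈ᵥ m → k ∈ᵥ n) (by simp) ?_ hn m k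
  rintro n hn ih m k hm hk
  rcases mem_succ.1 hm with h | rfl
  exacts [mem_succ.2 (Or.inl (ih m k h hk)), mem_succ.2 (Or.inl hk)]

theorem IsNat.zero_or_succ {n : V} (hn : IsNat n) :
    n = emp ∨ ∃ m, IsNat m ∧ n = Realizability.succ m :=
  IsNat.induction (fun n => n = emp ∨ ∃ m, IsNat m ∧ n = Realizability.succ m) (Or.inl rfl)
    (fun m hm _ => Or.inr ⟨m, hm, rfl⟩) hn

theorem succ_ne_emp (x : V) : succ x ≠ emp := fun h => not_mem_emp x (h ▸ mem_succ.2 (Or.inr rfl))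

theorem succ_inj {x y : V} : succ x = succ y ↔ x = y := by
  refine ⟨fun h => ?_, fun h => h ▸ rfl⟩
  have h1 := (ext_iff.1 h x).1 (by simp)
  have h2 := (ext_iff.1 h y).2 (by simp)
  rcases mem_succ.1 h1 with h1 | h1
  · rcases mem_succ.1 h2 with h2 | h2
    · exact absurd h2 (not_mem_of_mem h1)
    · exact h2.symm
  · exact h1

theorem IsNat.emp_mem_succ {n : V} (hn : IsNat n) : emp ∈ᵥ Realizability.succ n :=
  IsNat.induction (fun n => emp ∈ᵥ Realizability.succ n) (by simp)
    (fun _ _ ih => mem_succ.2 (Or.inl ih)) hn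

theorem IsNat.succ_mem_succ {n m : V} (hn : IsNat n) :
    Realizability.succ m ∈ᵥ Realizability.succ n ↔ m ∈ᵥ n := by
  constructor
  · intro h
    rcases mem_succ.1 h with h | h
    · exact hn.trans h (by simp)
    · rw [← h]; simp
  · refine IsNat.induction (fun n => ∀ m, m ∈ᵥ n → Realizability.succ m ∈ᵥ Realizability.succ n)
      (by simp) ?_ hn m
    intro n hn ih m hm
    rcases mem_succ.1 hm with h | rfl
    · exact mem_succ.2 (Or.inl (ih m h))
    · simp

theorem IsNat.trichotomy {n m : V} (hn : IsNat n) (hm : IsNat m) : m ∈ᵥ n ∨ m = n ∨ n ∈ᵥ m := by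
  refine IsNat.induction (fun n => ∀ m, IsNat m → m ∈ᵥ n ∨ m = n ∨ n ∈ᵥ m) ?_ ?_ hn m hm
  · intro m hm
    rcases mem_succ.1 hm.emp_mem_succ with h | h
    exacts [Or.inr (Or.inr h), Or.inr (Or.inl h.symm)]
  · intro n hn ih m hm
    rcases hm.zero_or_succ with rfl | ⟨k, hk, rfl⟩
    · exact Or.inl hn.emp_mem_succ
    · rcases ih k hk with h | rfl | h
      exacts [Or.inl (hn.succ_mem_succ.2 h), Or.inr (Or.inl rfl),
        Or.inr (Or.inr (hk.succ_mem_succ.2 h))]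

theorem num_mem {i k : ℕ} (h : i < k) : (num i : V) ∈ᵥ num k := by
  induction k with
  | zero => omega
  | succ k ih =>
    rcases Nat.lt_succ_iff_lt_or_eq.1 h with h | rfl
    exacts [mem_succ.2 (Or.inl (ih h)), mem_succ.2 (Or.inr rfl)]

/-! ### Recursion on `ω` -/

/-- `f` contains exactly the pairs `(k, F^k x)` with first component `k ≤ n`, as far as first
components `≤ n` are concerned. -/
def IterUpTo (F : V → V) (x n f : V) : Prop :=
  (∀ u, opair emp u ∈ᵥ f ↔ u = x) ∧
  ∀ k, k ∈ᵥ n → ∀ u, opair (succ k) u ∈ᵥ f ↔ ∃ u', opair k u' ∈ᵥ f ∧ u = F u'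

/-- `u` is the `n`-th iterate of `F` at `x`. -/
def IsIter (F : V → V) (x n u : V) : Prop := ∃ f, IterUpTo F x n f ∧ opair n u ∈ᵥ f

variable {F : V → V} {x : V}

theorem dfn_isIter [Dfn (fun v : Fin 2 → V => v 1 = F (v 0))] {n : ℕ} {f g : (Fin n → V) → V}
    [DfnFun f] [DfnFun g] : Dfn (fun v => IsIter F x (f v) (g v)) := by
  have : ∀ {m : ℕ} (i : Fin m), DfnFun (fun w : Fin m → V => F (w i)) := fun i =>
    DfnFun.of1 (Dfn.of2 (R := fun a b => b = F a) inferInstance)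
  refine Dfn.of2 (R := fun n u => IsIter F x n u) ?_
  unfold IsIter IterUpTo
  infer_instance

theorem IsIter.zero : IsIter F x emp x := by
  refine ⟨upair (opair emp x) (opair emp x), ⟨fun u => ?_, fun k hk => ?_⟩, by simp⟩
  · simp
  · exact absurd hk (not_mem_emp k)

theorem IsIter.succ {n u : V} (hn : IsNat n) (h : IsIter F x n u) :
    IsIter F x (succ n) (F u) := by
  obtain ⟨f, ⟨hf0, hfs⟩, hu⟩ := h
  -- Nothing is known about `f` beyond the first component n, so it is cut down to the components ≤
  -- n before the new pair is added.
  obtain ⟨f', hf'⟩ := exists_sep (fun p => ∃ k u, k ∈ᵥ Realizability.succ n ∧ p = opair k u) f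
  have key : ∀ k u, opair k u ∈ᵥ f' ↔ opair k u ∈ᵥ f ∧ k ∈ᵥ Realizability.succ n := by
    intro k u
    rw [hf']
    simp only [opair_inj]
    refine and_congr_right fun _ => ⟨?_, fun h => ⟨k, u, h, rfl, rfl⟩⟩
    rintro ⟨_, _, h, rfl, rfl⟩
    exact h
  have uniq : ∀ {k}, IsNat k → k ∈ᵥ Realizability.succ n → ∀ a b, opair k a ∈ᵥ f →
      opair k b ∈ᵥ f → a = b := by
    intro k hk
    refine IsNat.induction (fun k => k ∈ᵥ Realizability.succ n → ∀ a b, opair k a ∈ᵥ f →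
      opair k b ∈ᵥ f → a = b) ?_ ?_ hk
    · intro _ a b ha hb
      rw [(hf0 a).1 ha, (hf0 b).1 hb]
    · intro k hk ih hkn a b ha hb
      have hkn' := hn.succ_mem_succ.1 hkn
      obtain ⟨a', ha', rfl⟩ := (hfs k hkn' a).1 ha
      obtain ⟨b', hb', rfl⟩ := (hfs k hkn' b).1 hb
      rw [ih (mem_succ.2 (Or.inl hkn')) a' b' ha' hb']
  let p : V := opair (Realizability.succ n) (F u)
  refine ⟨cup f' (upair p p), ⟨fun v => ?_, fun k hk v => ?_⟩, by simp [p]⟩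
  · simp only [mem_cup, key, mem_upair, or_self, p, opair_inj, (succ_ne_emp n).symm, false_and,
      or_false, hn.emp_mem_succ, and_true, hf0]
  · simp only [mem_cup, key, mem_upair, or_self, p, opair_inj, hn.succ_mem_succ, succ_inj]
    have hk' : k ≠ Realizability.succ n := by
      rintro rfl; exact not_mem_self _ hk
    simp only [hk', hk, and_true, false_and, or_false]
    rcases mem_succ.1 hk with h | rfl
    · rw [hfs k h]
      simp [h, show k ≠ n by rintro rfl; exact not_mem_self _ h]
    · simp only [not_mem_self, and_false, false_or, true_and]
      constructor
      · rintro rfl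
        exact ⟨u, hu, rfl⟩
      · rintro ⟨u', hu', rfl⟩
        rw [uniq hn (by simp) u' u hu' hu]

theorem exists_isIter [Dfn (fun v : Fin 2 → V => v 1 = F (v 0))] {n : V} (hn : IsNat n) :
    ∃ u, IsIter F x n u := by
  have := @dfn_isIter V _ F x
  exact IsNat.induction (fun n => ∃ u, IsIter F x n u) ⟨x, .zero⟩
    (fun n hn ⟨u, hu⟩ => ⟨F u, hu.succ hn⟩) hn

theorem IsIter.unique [Dfn (fun v : Fin 2 → V => v 1 = F (v 0))] {n u u' : V} (hn : IsNat n)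
    (h : IsIter F x n u) (h' : IsIter F x n u') : u = u' := by
  have := @dfn_isIter V _ F x
  refine IsNat.induction (fun n => ∀ u u', IsIter F x n u → IsIter F x n u' → u = u') ?_ ?_ hn
    u u' h h'
  · rintro u u' ⟨f, hf, hu⟩ ⟨f', hf', hu'⟩
    rw [(hf.1 u).1 hu, (hf'.1 u').1 hu']
  · rintro n hn ih u u' ⟨f, hf, hu⟩ ⟨f', hf', hu'⟩
    obtain ⟨w, hw, rfl⟩ := (hf.2 n (by simp) u).1 hu
    obtain ⟨w', hw', rfl⟩ := (hf'.2 n (by simp) u').1 hu'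
    rw [ih w w' ⟨f, ⟨hf.1, fun k hk => hf.2 k (mem_succ.2 (Or.inl hk))⟩, hw⟩
      ⟨f', ⟨hf'.1, fun k hk => hf'.2 k (mem_succ.2 (Or.inl hk))⟩, hw'⟩]

/-- The set of all iterates of a definable function. -/
theorem exists_iterates (F : V → V) [Dfn (fun v : Fin 2 → V => v 1 = F (v 0))] (x : V) :
    ∃ s : V, ∀ u, u ∈ᵥ s ↔ ∃ n, IsNat n ∧ IsIter F x n u := by
  have := @dfn_isIter V _ F x
  obtain ⟨s, hs⟩ := ZFModel.replacement (fun n u => IsIter F x n u)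
    (Dfn.out (P := fun v : Fin 2 → V => IsIter F x (v 0) (v 1))) omega
    (fun n hn y z hy hz => hy.unique (mem_omega.1 hn) hz)
  exact ⟨s, fun u => by simpa using hs u⟩

/-- Every set is contained in a set that is closed under ordered pairs. -/
theorem exists_opair_closed (x : V) :
    ∃ U : V, (∀ z, z ∈ᵥ x → z ∈ᵥ U) ∧ ∀ a b, a ∈ᵥ U → b ∈ᵥ U → opair a b ∈ᵥ U := by
  -- The Kuratowski pair of two elements of `u` lies in the double power set of `u`, and the
  -- iterates of `F` increase, so their union is closed under pairs.
  let F : V → V := fun u => cup u (pow (pow u))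
  have : Dfn (fun v : Fin 2 → V => v 1 = F (v 0)) := by
    show Dfn (fun v : Fin 2 → V => v 1 = cup (v 0) (pow (pow (v 0))))
    infer_instance
  have := @dfn_isIter V _ F x
  obtain ⟨s, hs⟩ := exists_iterates F x
  have mono : ∀ {n}, IsNat n → ∀ m u w, m ∈ᵥ n → IsIter F x m u → IsIter F x n w →
      ∀ z, z ∈ᵥ u → z ∈ᵥ w := by
    intro n hn
    refine IsNat.induction (fun n => ∀ m u w, m ∈ᵥ n → IsIter F x m u → IsIter F x n w →
      ∀ z, z ∈ᵥ u → z ∈ᵥ w) (by simp) ?_ hn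
    intro n hn ih m u w hm hu hw z hz
    obtain ⟨w', hw'⟩ := exists_isIter (F := F) (x := x) hn
    rw [hw.unique hn.succ (hw'.succ hn)]
    refine mem_cup.2 (Or.inl ?_)
    rcases mem_succ.1 hm with h | rfl
    · exact ih m u w' h hu hw' z hz
    · rwa [hw'.unique hn hu]
  refine ⟨sUnion s, fun z hz => mem_sUnion.2 ⟨x, (hs x).2 ⟨emp, .zero, .zero⟩, hz⟩, ?_⟩
  intro a b ha hb
  obtain ⟨u, hu, hau⟩ := mem_sUnion.1 ha
  obtain ⟨w, hw, hbw⟩ := mem_sUnion.1 hb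
  obtain ⟨n, hn, hu⟩ := (hs u).1 hu
  obtain ⟨m, hm, hw⟩ := (hs w).1 hw
  have main : ∀ k y, IsNat k → IsIter F x k y → a ∈ᵥ y → b ∈ᵥ y → opair a b ∈ᵥ sUnion s := by
    intro k y hk hy ha hb
    refine mem_sUnion.2 ⟨F y, (hs _).2 ⟨_, hk.succ, hy.succ hk⟩, mem_cup.2 (Or.inr ?_)⟩
    simp only [opair, mem_pow, mem_upair]
    rintro z (rfl | rfl) y hy
    · rcases mem_upair.1 hy with rfl | rfl <;> assumption
    · rcases mem_upair.1 hy with rfl | rfl <;> assumption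
  rcases hm.trichotomy hn with h | rfl | h
  · exact main m w hm hw (mono hm _ _ _ h hu hw a hau) hbw
  · exact main n u hn hu hau (hw.unique hn hu ▸ hbw)
  · exact main n u hn hu hau (mono hn _ _ _ h hw hu b hbw)

end Naturals

section Grammar

variable {V : Type u} [ZFModel V] {A B : V}

/-! ### Terms and stacks -/

/-- Terms and stacks are given as classes, by quantifying over all closed sets. Their constructors
are pairs tagged by numerals, so a pair-closed set containing `ω`, `A` and `B` bounds them.
Separation can then be applied to sets of terms, stacks and tuples of them. -/
theorem exists_universe (A B x : V) : ∃ U : V, (∀ z, z ∈ᵥ x → z ∈ᵥ U) ∧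
    (∀ a b, a ∈ᵥ U → b ∈ᵥ U → opair a b ∈ᵥ U) ∧ (∀ n t, IsTermAt A B n t → n ∈ᵥ U ∧ t ∈ᵥ U) ∧
    (∀ π, IsStack A B π → π ∈ᵥ U) ∧ (∀ n, IsNat n → n ∈ᵥ U) ∧
    ∀ n t, IsTermAt A B n t → IsNat n := by
  obtain ⟨U, hU, hp⟩ := exists_opair_closed (cup x (cup omega (cup A B)))
  have hx : ∀ z, z ∈ᵥ x → z ∈ᵥ U := fun z hz => hU z (by simp [hz])
  have hω : ∀ n, IsNat n → n ∈ᵥ U := fun z hz => hU z (by simp [hz])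
  have hA : ∀ z, z ∈ᵥ A → z ∈ᵥ U := fun z hz => hU z (by simp [hz])
  have hB : ∀ z, z ∈ᵥ B → z ∈ᵥ U := fun z hz => hU z (by simp [hz])
  have hn : ∀ k, (num k : V) ∈ᵥ U := fun k => hω _ (isNat_num k)
  obtain ⟨T, hT⟩ := exists_sep (fun p => ∃ n t, IsNat n ∧ t ∈ᵥ U ∧ p = opair n t) U
  have key : ∀ n t, opair n t ∈ᵥ T ↔ IsNat n ∧ t ∈ᵥ U := by
    intro n t
    rw [hT]
    constructor
    · rintro ⟨-, n', t', h1, h2, h3⟩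
      obtain ⟨rfl, rfl⟩ := opair_inj.1 h3
      exact ⟨h1, h2⟩
    · exact fun h => ⟨hp _ _ (hω n h.1) h.2, n, t, h.1, h.2, rfl⟩
  have G : GrammarClosed A B T U := by
    constructor
    · constructor
      · exact fun n i h hi => (key _ _).2 ⟨h, hp _ _ (hn 0) (hω i (h.of_mem hi))⟩
      · exact fun n t s h h' => (key _ _).2 ⟨((key _ _).1 h).1,
          hp _ _ (hn 1) (hp _ _ ((key _ _).1 h).2 ((key _ _).1 h').2)⟩
      · exact fun n t h => (key _ _).2 ⟨((key _ _).1 h).1.of_mem (mem_succ.2 (Or.inr rfl)),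
          hp _ _ (hn 2) ((key _ _).1 h).2⟩
      · exact fun n h => (key _ _).2 ⟨h, hp _ _ (hn 3) (hn 0)⟩
      · exact fun n α h hα => (key _ _).2 ⟨h, hp _ _ (hn 5) (hA _ hα)⟩
    · exact fun n π h hπ => (key _ _).2 ⟨h, hp _ _ (hn 4) hπ⟩
    · exact fun β hβ => hp _ _ (hn 0) (hB _ hβ)
    · exact fun t π h hπ => hp _ _ (hn 1) (hp _ _ ((key _ _).1 h).2 hπ)
  refine ⟨U, hx, hp, fun n t ht => ?_, fun π hπ => hπ T U G, hω, fun n t ht => ?_⟩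
  · exact ⟨hω n ((key n t).1 (ht T U G)).1, ((key n t).1 (ht T U G)).2⟩
  · exact ((key n t).1 (ht T U G)).1

theorem IsTermAt.isNat {n t : V} (h : IsTermAt A B n t) : IsNat n := by
  obtain ⟨-, -, -, -, -, -, h'⟩ := exists_universe A B emp
  exact h' n t h

theorem IsTermAt.var {n i : V} (hn : IsNat n) (hi : i ∈ᵥ n) : IsTermAt A B n (tVar i) :=
  fun _ _ h => h.var n i hn hi

theorem IsTermAt.app {n t s : V} (ht : IsTermAt A B n t) (hs : IsTermAt A B n s) :
    IsTermAt A B n (tApp t s) := fun T P h => h.app n t s (ht T P h) (hs T P h)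

theorem IsTermAt.lam {n t : V} (ht : IsTermAt A B (succ n) t) : IsTermAt A B n (tLam t) :=
  fun T P h => h.lam n t (ht T P h)

theorem IsTermAt.cc {n : V} (hn : IsNat n) : IsTermAt A B n tCC := fun _ _ h => h.cc n hn

theorem IsTermAt.instr {n α : V} (hn : IsNat n) (hα : α ∈ᵥ A) : IsTermAt A B n (tInstr α) :=
  fun _ _ h => h.instr n α hn hα

theorem IsTermAt.kont {n π : V} (hn : IsNat n) (hπ : IsStack A B π) : IsTermAt A B n (tKont π) :=
  fun T P h => h.kont n π hn (hπ T P h)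

theorem IsStack.bot {β : V} (hβ : β ∈ᵥ B) : IsStack A B (sBot β) := fun _ _ h => h.bot β hβ

theorem IsStack.cons {t π : V} (ht : IsTerm A B t) (hπ : IsStack A B π) :
    IsStack A B (sCons t π) := fun T P h => h.cons t π (ht T P h) (hπ T P h)

/-- Simultaneous induction on terms and stacks. -/
theorem grammar_induction (Q : V → V → Prop) (R : V → Prop)
    [Dfn (fun v : Fin 2 → V => Q (v 0) (v 1))] [Dfn (fun v : Fin 1 → V => R (v 0))]
    (var : ∀ n i, IsNat n → i ∈ᵥ n → Q n (tVar i))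
    (app : ∀ n t s, IsNat n → Q n t → Q n s → Q n (tApp t s))
    (lam : ∀ n t, IsNat n → Q (succ n) t → Q n (tLam t))
    (cc : ∀ n, IsNat n → Q n tCC) (instr : ∀ n α, IsNat n → α ∈ᵥ A → Q n (tInstr α))
    (kont : ∀ n π, IsNat n → IsStack A B π → Q n (tKont π))
    (bot : ∀ β, β ∈ᵥ B → R (sBot β))
    (cons : ∀ t π, IsTerm A B t → IsStack A B π → R (sCons t π)) :
    (∀ n t, IsTermAt A B n t → Q n t) ∧ ∀ π, IsStack A B π → R π := by
  obtain ⟨U, -, hp, hT, hS, -, -⟩ := exists_universe A B emp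
  have : ∀ {m : ℕ} (i j : Fin m), Dfn (fun w : Fin m → V => Q (w i) (w j)) := fun i j =>
    Dfn.of2 (R := Q) inferInstance
  obtain ⟨T, hT'⟩ := exists_sep (fun p => ∃ n t, IsTermAt A B n t ∧ Q n t ∧ p = opair n t) U
  obtain ⟨P, hP⟩ := exists_sep (fun π => IsStack A B π ∧ R π) U
  have key : ∀ n t, opair n t ∈ᵥ T ↔ IsTermAt A B n t ∧ Q n t := by
    intro n t
    rw [hT']
    constructor
    · rintro ⟨-, n', t', h1, h2, h3⟩
      obtain ⟨rfl, rfl⟩ := opair_inj.1 h3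
      exact ⟨h1, h2⟩
    · exact fun h => ⟨hp _ _ (hT _ _ h.1).1 (hT _ _ h.1).2, n, t, h.1, h.2, rfl⟩
  have G : GrammarClosed A B T P := by
    constructor
    · constructor
      · exact fun n i hn hi => (key _ _).2 ⟨.var hn hi, var n i hn hi⟩
      · intro n t s ht hs
        have ht := (key _ _).1 ht
        have hs := (key _ _).1 hs
        exact (key _ _).2 ⟨ht.1.app hs.1, app n t s ht.1.isNat ht.2 hs.2⟩
      · intro n t ht
        have ht := (key _ _).1 ht
        exact (key _ _).2 ⟨ht.1.lam, lam n t ht.1.lam.isNat ht.2⟩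
      · exact fun n hn => (key _ _).2 ⟨.cc hn, cc n hn⟩
      · exact fun n α hn hα => (key _ _).2 ⟨.instr hn hα, instr n α hn hα⟩
    · exact fun n π hn hπ => (key _ _).2 ⟨.kont hn ((hP π).1 hπ).2.1, kont n π hn ((hP π).1 hπ).2.1⟩
    · exact fun β hβ => (hP _).2 ⟨hS _ (.bot hβ), .bot hβ, bot β hβ⟩
    · intro t π ht hπ
      have ht := (key _ _).1 ht
      have hπ := (hP π).1 hπ
      exact (hP _).2 ⟨hS _ (.cons ht.1 hπ.2.1), .cons ht.1 hπ.2.1, cons t π ht.1 hπ.2.1⟩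
  exact ⟨fun n t h => ((key n t).1 (h T P G)).2, fun π h => ((hP π).1 (h T P G)).2.2⟩

/-- Here `n ∈ᵥ succ m` expresses n ≤ m. -/
theorem IsTermAt.weaken {n m t : V} (h : IsTermAt A B n t) (hm : IsNat m)
    (hnm : n ∈ᵥ succ m) : IsTermAt A B m t := by
  refine (grammar_induction (A := A) (B := B)
    (fun n t => ∀ m, IsNat m → n ∈ᵥ succ m → IsTermAt A B m t)
    (fun _ => True) ?_ ?_ ?_ ?_ ?_ ?_ ?_ ?_).1 n t h m hm hnm
  · intro n i hn hi m hm hnm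
    refine .var hm ?_
    rcases mem_succ.1 hnm with h | rfl
    exacts [hm.trans h hi, hi]
  · exact fun n t s _ ht hs m hm hnm => (ht m hm hnm).app (hs m hm hnm)
  · exact fun n t _ ht m hm hnm => (ht _ hm.succ (hm.succ.succ_mem_succ.2 hnm)).lam
  · exact fun n _ m hm _ => .cc hm
  · exact fun n α _ hα m hm _ => .instr hm hα
  · exact fun n π _ hπ m hm _ => .kont hm hπ
  · simp
  · simp

theorem IsTerm.termAt {n t : V} (h : IsTerm A B t) (hn : IsNat n) : IsTermAt A B n t :=
  IsTermAt.weaken h hn hn.emp_mem_succ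

/-- All free variables have index below n ≤ k, so only the `miss` rule is ever needed for variables.
-/
theorem IsTermAt.isSubst_self {n k s t : V} (h : IsTermAt A B n t) (hk : IsNat k)
    (hnk : n ∈ᵥ succ k) : IsSubst A B s k t t := by
  refine (grammar_induction (A := A) (B := B)
    (fun n t => ∀ k, IsNat k → n ∈ᵥ succ k → IsSubst A B s k t t)
    (fun _ => True) ?_ ?_ ?_ ?_ ?_ ?_ ?_ ?_).1 n t h k hk hnk
  · intro n i hn hi m hm hnm S hS
    refine hS.miss _ _ hm ?_
    rcases mem_succ.1 hnm with h | rfl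
    exacts [hm.trans h hi, hi]
  · exact fun n t r _ ht hr m hm hnm S hS => hS.app _ _ _ _ _ (ht m hm hnm S hS) (hr m hm hnm S hS)
  · exact fun n t _ ht m hm hnm S hS =>
      hS.lam _ _ _ (ht _ hm.succ (hm.succ.succ_mem_succ.2 hnm) S hS)
  · exact fun n _ m hm _ S hS => hS.cc m hm
  · exact fun n α _ hα m hm _ S hS => hS.instr m α hm hα
  · exact fun n π _ hπ m hm _ S hS => hS.kont m π hm hπ
  · simp
  · simp

theorem IsTerm.isSubst_self {k s t : V} (h : IsTerm A B t) (hk : IsNat k) : IsSubst A B s k t t :=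
  IsTermAt.isSubst_self h hk hk.emp_mem_succ

theorem sCons_inj {t π s ρ : V} : sCons t π = sCons s ρ ↔ t = s ∧ π = ρ := by simp [sCons]

theorem isStack_cons_iff {t π : V} : IsStack A B (sCons t π) ↔ IsTerm A B t ∧ IsStack A B π := by
  refine ⟨fun h => ?_, fun h => .cons h.1 h.2⟩
  refine (grammar_induction (A := A) (B := B) (fun _ _ => True)
    (fun ρ => ∀ t π, ρ = sCons t π → IsTerm A B t ∧ IsStack A B π)
    ?_ ?_ ?_ ?_ ?_ ?_ ?_ ?_).2 _ h t π rfl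
  iterate 6 simp
  · intro β _ t π h
    simp only [sBot, sCons, opair_inj] at h
    exact absurd h.1.symm (succ_ne_emp _)
  · intro t π ht hπ s ρ h
    obtain ⟨rfl, rfl⟩ := sCons_inj.1 h
    exact ⟨ht, hπ⟩

end Grammar

/-! ### Meta-level terms -/

/-- Pure λ-terms of the metatheory, with de Bruijn indices. -/
inductive Tm : Type
  | var (i : ℕ)
  | app (t s : Tm)
  | lam (t : Tm)

section Inst

variable {V : Type u} [ZFModel V] {A B : V}

/-- Extend a sequence by a first element. -/
def scons (s : V) (σ : ℕ → V) : ℕ → V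
  | 0 => s
  | i + 1 => σ i

/-- The term of `V` obtained from `t` by substituting `σ i` for the variable `k + i`. -/
noncomputable def Tm.inst : Tm → ℕ → (ℕ → V) → V
  | .var i, k, σ => if i < k then tVar (num i) else σ (i - k)
  | .app t s, k, σ => tApp (t.inst k σ) (s.inst k σ)
  | .lam t, k, σ => tLam (t.inst (k + 1) σ)

theorem Tm.isTermAt_inst {σ : ℕ → V} (hσ : ∀ i, IsTerm A B (σ i)) (t : Tm) (k : ℕ) :
    IsTermAt A B (num k) (t.inst k σ) := by
  induction t generalizing k with
  | var i =>
    rw [Tm.inst]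
    split_ifs with h
    · exact .var (isNat_num k) (num_mem h)
    · exact (hσ _).termAt (isNat_num k)
  | app t s iht ihs => exact (iht k).app (ihs k)
  | lam t ih => exact IsTermAt.lam (ih (k + 1))

/-- The substituted terms are closed, so no lifting is needed under binders. This links the
substitution relation of `V` to instantiation in the metatheory. -/
theorem Tm.isSubst_inst {σ : ℕ → V} {s : V} (hσ : ∀ i, IsTerm A B (σ i)) (t : Tm) (k : ℕ) :
    IsSubst A B s (num k) (t.inst (k + 1) σ) (t.inst k (scons s σ)) := by
  induction t generalizing k with
  | var i =>
    rw [Tm.inst, Tm.inst]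
    rcases lt_trichotomy i k with h | rfl | h
    · rw [if_pos h, if_pos (by omega)]
      exact fun S hS => hS.miss _ _ (isNat_num k) (num_mem h)
    · rw [if_pos (by omega), if_neg (by omega), Nat.sub_self]
      exact fun S hS => hS.hit _ (isNat_num i)
    · rw [if_neg (by omega), if_neg (by omega), show i - k = (i - (k + 1)) + 1 by omega]
      exact (hσ _).isSubst_self (isNat_num k)
  | app t s iht ihs => exact fun S hS => hS.app _ _ _ _ _ (iht k S hS) (ihs k S hS)
  | lam t ih => exact fun S hS => hS.lam _ _ _ (ih (k + 1) S hS)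

theorem Tm.isRealizerOver_inst (t : Tm) : IsRealizerOver A (t.inst 0 (fun _ => tCC)) := by
  intro T hT
  suffices h : ∀ k, opair (num k) (t.inst k (fun _ => tCC)) ∈ᵥ T from h 0
  induction t with
  | var i =>
    intro k
    rw [Tm.inst]
    split_ifs with h
    · exact hT.var _ _ (isNat_num k) (num_mem h)
    · exact hT.cc _ (isNat_num k)
  | app t s iht ihs => exact fun k => hT.app _ _ _ (iht k) (ihs k)
  | lam t ih => exact fun k => hT.lam _ _ (ih (k + 1))

end Inst

/-! ### Fixed points of monotone operators on sets of `V` -/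

section FixedPoint

variable {V : Type u} [ZFModel V]

/-- A definable monotone operator on the subsets of a set has a fixed point. -/
theorem exists_fixedPoint (U : V) (Φ : V → V → Prop)
    [Dfn (fun v : Fin 2 → V => Φ (v 0) (v 1))]
    (mono : ∀ Z Z', (∀ x, x ∈ᵥ Z → x ∈ᵥ Z') → ∀ x, Φ Z x → Φ Z' x) :
    ∃ Z, ∀ x, x ∈ᵥ Z ↔ x ∈ᵥ U ∧ Φ Z x := by
  have : ∀ {m : ℕ} (i j : Fin m), Dfn (fun w : Fin m → V => Φ (w i) (w j)) := fun i j =>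
    Dfn.of2 (R := Φ) inferInstance
  -- As in Knaster–Tarski, `Z` is the union of all sets `Y` contained in their own image.
  obtain ⟨Z, hZ⟩ := exists_sep (fun x => ∃ Y, x ∈ᵥ Y ∧ ∀ y, y ∈ᵥ Y → y ∈ᵥ U ∧ Φ Y y) U
  have post : ∀ x, x ∈ᵥ Z → x ∈ᵥ U ∧ Φ Z x := by
    intro x hx
    obtain ⟨hxU, Y, hxY, hY⟩ := (hZ x).1 hx
    exact ⟨hxU, mono Y Z (fun y hy => (hZ y).2 ⟨(hY y hy).1, Y, hy, hY⟩) x (hY x hxY).2⟩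
  refine ⟨Z, fun x => ⟨post x, fun ⟨hxU, hx⟩ => ?_⟩⟩
  -- Adding to `Z` a point of its image gives again a set contained in its image, hence a part of
  -- `Z`.
  have sub : ∀ y, y ∈ᵥ Z → y ∈ᵥ cup Z (upair x x) := fun y hy => mem_cup.2 (Or.inl hy)
  refine (hZ x).2 ⟨hxU, cup Z (upair x x), by simp, fun y hy => ?_⟩
  rcases mem_cup.1 hy with hy | hy
  · exact ⟨(post y hy).1, mono _ _ sub y (post y hy).2⟩
  · obtain rfl : y = x := by simpa using hy
    exact ⟨hxU, mono _ _ sub y hx⟩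

end FixedPoint

namespace RealizabilityAlgebra

variable {V : Type u} [ZFModel V] {𝒜 : RealizabilityAlgebra V} {n : ℕ}

instance dfn_stack {f : (Fin n → V) → V} [DfnFun f] : Dfn (fun v => 𝒜.Stack (f v)) := by
  unfold Stack; infer_instance

instance dfn_term {f : (Fin n → V) → V} [DfnFun f] : Dfn (fun v => 𝒜.Term (f v)) := by
  unfold Term; infer_instance

instance dfn_nameSet {f : (Fin n → V) → V} [DfnFun f] : Dfn (fun v => 𝒜.NameSet (f v)) :=
  Dfn.of1 (by unfold NameSet; infer_instance)

instance dfn_isName {f : (Fin n → V) → V} [DfnFun f] : Dfn (fun v => 𝒜.IsName (f v)) :=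
  Dfn.of1 (by unfold IsName; infer_instance)

instance dfn_inDom {f g : (Fin n → V) → V} [DfnFun f] [DfnFun g] :
    Dfn (fun v => 𝒜.InDom (f v) (g v)) :=
  Dfn.of2 (by unfold InDom; infer_instance)

instance dfn_orth {f : (Fin n → V) → V} {P : (Fin n → V) → V → Prop} [hf : DfnFun f]
    [Dfn (fun w : Fin (n + 1) → V => P (fun i => w i.succ) (w 0))] :
    Dfn (fun v => f v ∈ 𝒜.orth {ρ | P v ρ}) := by
  have : DfnFun (fun w : Fin (n + 1) → V => f (fun i => w i.succ)) :=
    hf.subst (fun i w => w i.succ) (fun i => inferInstance)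
  exact Dfn.congr (Q := fun v => 𝒜.Term (f v) ∧ ∀ π, P v π → opair (f v) π ∈ᵥ 𝒜.pole)
    inferInstance fun v => Iff.rfl

/-! ### Names -/

theorem NameSet.cup {X Y : V} (hX : 𝒜.NameSet X) (hY : 𝒜.NameSet Y) :
    𝒜.NameSet (cup X Y) := by
  intro x hx p hp
  rcases mem_cup.1 hx with h | h
  · obtain ⟨b, π, hb, h⟩ := hX x h p hp
    exact ⟨b, π, mem_cup.2 (Or.inl hb), h⟩
  · obtain ⟨b, π, hb, h⟩ := hY x h p hp
    exact ⟨b, π, mem_cup.2 (Or.inr hb), h⟩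

theorem NameSet.mem {X a c σ : V} (hX : 𝒜.NameSet X) (ha : a ∈ᵥ X) (h : opair c σ ∈ᵥ a) :
    c ∈ᵥ X ∧ 𝒜.Stack σ := by
  obtain ⟨b, π, hb, hπ, e⟩ := hX a ha _ h
  obtain ⟨rfl, rfl⟩ := opair_inj.1 e
  exact ⟨hb, hπ⟩

theorem IsName.mem {a c σ : V} (ha : 𝒜.IsName a) (h : opair c σ ∈ᵥ a) :
    𝒜.IsName c ∧ 𝒜.Stack σ := by
  obtain ⟨X, hX, haX⟩ := ha
  exact ⟨⟨X, hX, (hX.mem haX h).1⟩, (hX.mem haX h).2⟩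

/-- A domain element c is reached from a through the chain c ∈ {c} ∈ (c, π) ∈ a. Foundation is
applied to the counterexamples together with these intermediate sets, which makes a transitive
closure unnecessary. -/
theorem IsName.induction (P : V → Prop) [Dfn (fun v : Fin 1 → V => P (v 0))]
    (step : ∀ a, 𝒜.IsName a → (∀ c, 𝒜.InDom a c → P c) → P a) {a : V} (ha : 𝒜.IsName a) :
    P a := by
  by_contra hPa
  obtain ⟨X, hX, haX⟩ := ha
  obtain ⟨Y, hY⟩ := exists_sep (fun a => ¬ P a) X
  -- The bound X ∪ ⋃X ∪ ⋃⋃X contains the names, the pairs (c, π) and the singletons {c}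
  -- respectively.
  obtain ⟨Z, hZ⟩ := exists_sep (fun z => z ∈ᵥ Y ∨
    (z ∈ᵥ sUnion X ∧ ∃ c π, c ∈ᵥ Y ∧ z = opair c π) ∨ ∃ c, c ∈ᵥ Y ∧ z = upair c c)
    (Realizability.cup X (Realizability.cup (sUnion X) (sUnion (sUnion X))))
  have hYZ : ∀ y, y ∈ᵥ Y → y ∈ᵥ Z := fun y hy =>
    (hZ y).2 ⟨mem_cup.2 (Or.inl ((hY y).1 hy).1), Or.inl hy⟩
  obtain ⟨z, hz, hmin⟩ := ZFModel.foundation Z ⟨a, hYZ a ((hY a).2 ⟨haX, hPa⟩)⟩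
  rcases ((hZ z).1 hz).2 with hzY | ⟨hzX, c, π, hc, rfl⟩ | ⟨c, hc, rfl⟩
  · obtain ⟨hzX, hPz⟩ := (hY z).1 hzY
    refine hPz (step z ⟨X, hX, hzX⟩ fun c ⟨π, _, hcz⟩ => ?_)
    by_contra hPc
    have hU : opair c π ∈ᵥ sUnion X := mem_sUnion.2 ⟨z, hzX, hcz⟩
    exact hmin _ ((hZ _).2 ⟨by simp only [mem_cup, hU, true_or, or_true], Or.inr (Or.inl
      ⟨hU, c, π, (hY c).2 ⟨(hX.mem hzX hcz).1, hPc⟩, rfl⟩)⟩) hcz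
  · have h : upair c c ∈ᵥ opair c π := by simp [opair]
    refine hmin _ ((hZ _).2 ⟨?_, Or.inr (Or.inr ⟨c, hc, rfl⟩)⟩) h
    exact mem_cup.2 (Or.inr (mem_cup.2 (Or.inr (mem_sUnion.2 ⟨_, hzX, h⟩))))
  · exact hmin c (hYZ c hc) (by simp)

/-! ### Falsity values of `⊆` and `∉` -/

variable (𝒜) in
/-- The falsity value of `a ∉ b`, given those of `⊆`, which are encoded by `Z`. -/
def NotMemOf (Z a b π : V) : Prop :=
  ∃ c t t' σ, opair c σ ∈ᵥ b ∧ t ∈ 𝒜.orth {ρ | opair (opair a c) ρ ∈ᵥ Z} ∧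
    t' ∈ 𝒜.orth {ρ | opair (opair c a) ρ ∈ᵥ Z} ∧ π = sCons t (sCons t' σ)

variable (𝒜) in
/-- The falsity value of `a ⊆ b`, given those of the inclusions between the elements. -/
def SubOf (Z a b π : V) : Prop :=
  ∃ c t σ, opair c σ ∈ᵥ a ∧ t ∈ 𝒜.orth {ρ | 𝒜.NotMemOf Z c b ρ} ∧ π = sCons t σ

instance dfn_notMemOf {f g k l : (Fin n → V) → V} [DfnFun f] [DfnFun g] [DfnFun k] [DfnFun l] :
    Dfn (fun v => 𝒜.NotMemOf (f v) (g v) (k v) (l v)) :=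
  Dfn.of4 (by unfold NotMemOf; infer_instance)

instance dfn_subOf {f g k l : (Fin n → V) → V} [DfnFun f] [DfnFun g] [DfnFun k] [DfnFun l] :
    Dfn (fun v => 𝒜.SubOf (f v) (g v) (k v) (l v)) :=
  Dfn.of4 (by unfold SubOf; infer_instance)

theorem orth_anti {F G : Set V} (h : F ⊆ G) : 𝒜.orth G ⊆ 𝒜.orth F :=
  fun _ ht => ⟨ht.1, fun π hπ => ht.2 π (h hπ)⟩

theorem NotMemOf.anti {Z Z' a b π : V} (h : ∀ c, 𝒜.InDom b c → ∀ ρ,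
      (opair (opair a c) ρ ∈ᵥ Z → opair (opair a c) ρ ∈ᵥ Z') ∧
      (opair (opair c a) ρ ∈ᵥ Z → opair (opair c a) ρ ∈ᵥ Z'))
    (hb : 𝒜.IsName b) (hn : 𝒜.NotMemOf Z' a b π) : 𝒜.NotMemOf Z a b π := by
  obtain ⟨c, t, t', σ, hc, ht, ht', rfl⟩ := hn
  have hd : 𝒜.InDom b c := ⟨σ, (hb.mem hc).2, hc⟩
  exact ⟨c, t, t', σ, hc, orth_anti (fun ρ hρ => (h c hd ρ).1 hρ) ht,
    orth_anti (fun ρ hρ => (h c hd ρ).2 hρ) ht', rfl⟩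

/-- Passing from ⊆ to ∉ and back to ⊆ applies `orth` twice, so the two reversals cancel. Only pairs
of domain elements matter, which serves both the fixed-point construction and the inductive proof of
uniqueness. -/
theorem SubOf.mono {Z Z' a b π : V} (h : ∀ c d, 𝒜.InDom a c → 𝒜.InDom b d → ∀ ρ,
      (opair (opair c d) ρ ∈ᵥ Z → opair (opair c d) ρ ∈ᵥ Z') ∧
      (opair (opair d c) ρ ∈ᵥ Z → opair (opair d c) ρ ∈ᵥ Z'))
    (ha : 𝒜.IsName a) (hb : 𝒜.IsName b) (hs : 𝒜.SubOf Z a b π) : 𝒜.SubOf Z' a b π := by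
  obtain ⟨c, t, σ, hc, ht, rfl⟩ := hs
  have hd : 𝒜.InDom a c := ⟨σ, (ha.mem hc).2, hc⟩
  exact ⟨c, t, σ, hc, orth_anti (fun ρ hρ => NotMemOf.anti (fun d hd' => h c d hd hd') hb hρ) ht,
    rfl⟩

/-- Eliminating ∉ turns the recursion into a monotone operator for ⊆ alone, and a fixed point of it
satisfies the equations. Which fixed point is chosen is immaterial by `FalsityOn.sub_unique`. -/
theorem NameSet.exists_falsityOn {X : V} (hX : 𝒜.NameSet X) : ∃ Fs Fn, 𝒜.FalsityOn X Fs Fn := by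
  obtain ⟨U, hUX, hp, hT, hS, hN, -⟩ := exists_universe 𝒜.A 𝒜.B X
  have hName : ∀ a, a ∈ᵥ X → 𝒜.IsName a := fun a ha => ⟨X, hX, ha⟩
  have hcons : ∀ t π, 𝒜.Term t → 𝒜.Stack π → sCons t π ∈ᵥ U := fun t π ht hπ => hS _ (.cons ht hπ)
  obtain ⟨Z, hZ⟩ := exists_fixedPoint U
    (fun Z x => ∃ a b π, a ∈ᵥ X ∧ b ∈ᵥ X ∧ x = opair (opair a b) π ∧ 𝒜.SubOf Z a b π) (by
      rintro Z Z' h x ⟨a, b, π, ha, hb, rfl, hs⟩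
      exact ⟨a, b, π, ha, hb, rfl, hs.mono (fun c d _ _ ρ => ⟨h _, h _⟩) (hName a ha)
        (hName b hb)⟩)
  have hZ' : ∀ a b π, a ∈ᵥ X → b ∈ᵥ X → (opair (opair a b) π ∈ᵥ Z ↔ 𝒜.SubOf Z a b π) := by
    intro a b π ha hb
    rw [hZ]
    constructor
    · rintro ⟨-, a', b', π', -, -, e, h⟩
      simp only [opair_inj] at e
      obtain ⟨⟨rfl, rfl⟩, rfl⟩ := e
      exact h
    · intro h
      refine ⟨?_, a, b, π, ha, hb, rfl, h⟩
      obtain ⟨c, t, σ, hc, ht, rfl⟩ := h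
      exact hp _ _ (hp _ _ (hUX a ha) (hUX b hb)) (hcons t σ ht.1 (hX.mem ha hc).2)
  obtain ⟨N, hN⟩ := exists_sep
    (fun x => ∃ a b π, a ∈ᵥ X ∧ b ∈ᵥ X ∧ x = opair (opair a b) π ∧ 𝒜.NotMemOf Z a b π) U
  have hN' : ∀ a b π, a ∈ᵥ X → b ∈ᵥ X → (opair (opair a b) π ∈ᵥ N ↔ 𝒜.NotMemOf Z a b π) := by
    intro a b π ha hb
    rw [hN]
    constructor
    · rintro ⟨-, a', b', π', -, -, e, h⟩
      simp only [opair_inj] at e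
      obtain ⟨⟨rfl, rfl⟩, rfl⟩ := e
      exact h
    · intro h
      refine ⟨?_, a, b, π, ha, hb, rfl, h⟩
      obtain ⟨c, t, t', σ, hc, ht, ht', rfl⟩ := h
      exact hp _ _ (hp _ _ (hUX a ha) (hUX b hb))
        (hcons t _ ht.1 (IsStack.cons ht'.1 (hX.mem hb hc).2))
  refine ⟨Z, N, hX, fun a b π ha hb => ?_, fun a b π ha hb => hN' a b π ha hb⟩
  rw [hZ' a b π ha hb]
  refine exists_congr fun c => exists_congr fun t => exists_congr fun σ =>
    and_congr_right fun hc => ?_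
  rw [show {ρ | opair (opair c b) ρ ∈ᵥ N} = {ρ | 𝒜.NotMemOf Z c b ρ} from
    Set.ext fun ρ => hN' c b ρ (hX.mem ha hc).1 hb]

theorem FalsityOn.notMem_iff' {X Fs Fn a b π : V} (h : 𝒜.FalsityOn X Fs Fn) (ha : a ∈ᵥ X)
    (hb : b ∈ᵥ X) : opair (opair a b) π ∈ᵥ Fn ↔ 𝒜.NotMemOf Fs a b π := h.notMem_iff a b π ha hb

theorem FalsityOn.sub_iff' {X Fs Fn a b π : V} (h : 𝒜.FalsityOn X Fs Fn) (ha : a ∈ᵥ X)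
    (hb : b ∈ᵥ X) : opair (opair a b) π ∈ᵥ Fs ↔ 𝒜.SubOf Fs a b π := by
  rw [h.sub_iff a b π ha hb]
  refine exists_congr fun c => exists_congr fun t => exists_congr fun σ =>
    and_congr_right fun hc => ?_
  rw [show {ρ | opair (opair c b) ρ ∈ᵥ Fn} = {ρ | 𝒜.NotMemOf Fs c b ρ} from
    Set.ext fun ρ => h.notMem_iff' (h.nameSet.mem ha hc).1 hb]

/-- The clause for ∉ uses both inclusions, so the order of the arguments alternates. The induction
on a therefore treats (a, b) and (b, a) at once, for all b. -/
theorem FalsityOn.sub_unique {X Fs Fn X' Fs' Fn' a b : V} (h : 𝒜.FalsityOn X Fs Fn)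
    (h' : 𝒜.FalsityOn X' Fs' Fn') (ha : a ∈ᵥ X) (ha' : a ∈ᵥ X') (hb : b ∈ᵥ X) (hb' : b ∈ᵥ X')
    (π : V) : opair (opair a b) π ∈ᵥ Fs ↔ opair (opair a b) π ∈ᵥ Fs' := by
  refine (IsName.induction (𝒜 := 𝒜) (fun a => a ∈ᵥ X → a ∈ᵥ X' → ∀ b, b ∈ᵥ X → b ∈ᵥ X' → ∀ π,
    (opair (opair a b) π ∈ᵥ Fs ↔ opair (opair a b) π ∈ᵥ Fs') ∧
    (opair (opair b a) π ∈ᵥ Fs ↔ opair (opair b a) π ∈ᵥ Fs')) ?_ ⟨X, h.nameSet, ha⟩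
    ha ha' b hb hb' π).1
  clear a b ha ha' hb hb' π
  intro a haN ih ha ha' b hb hb' π
  have hbN : 𝒜.IsName b := ⟨X, h.nameSet, hb⟩
  have key : ∀ c d, 𝒜.InDom a c → 𝒜.InDom b d → ∀ ρ,
      (opair (opair c d) ρ ∈ᵥ Fs ↔ opair (opair c d) ρ ∈ᵥ Fs') ∧
      (opair (opair d c) ρ ∈ᵥ Fs ↔ opair (opair d c) ρ ∈ᵥ Fs') := by
    rintro c d ⟨σ, hσ, hc⟩ ⟨τ, hτ, hd⟩ ρ
    exact ih c ⟨σ, hσ, hc⟩ (h.nameSet.mem ha hc).1 (h'.nameSet.mem ha' hc).1 d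
      (h.nameSet.mem hb hd).1 (h'.nameSet.mem hb' hd).1 ρ
  rw [h.sub_iff' ha hb, h'.sub_iff' ha' hb', h.sub_iff' hb ha, h'.sub_iff' hb' ha']
  exact ⟨⟨.mono (fun c d hc hd ρ => ⟨(key c d hc hd ρ).1.1, (key c d hc hd ρ).2.1⟩) haN hbN,
    .mono (fun c d hc hd ρ => ⟨(key c d hc hd ρ).1.2, (key c d hc hd ρ).2.2⟩) haN hbN⟩,
    ⟨.mono (fun d c hd hc ρ => ⟨(key c d hc hd ρ).2.1, (key c d hc hd ρ).1.1⟩) hbN haN,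
    .mono (fun d c hd hc ρ => ⟨(key c d hc hd ρ).2.2, (key c d hc hd ρ).1.2⟩) hbN haN⟩⟩

theorem FalsityOn.falsSub_eq {X Fs Fn a b : V} (h : 𝒜.FalsityOn X Fs Fn) (ha : a ∈ᵥ X)
    (hb : b ∈ᵥ X) : 𝒜.falsSub a b = {π | opair (opair a b) π ∈ᵥ Fs} := by
  ext π
  refine ⟨?_, fun hπ => ⟨X, Fs, Fn, h, ha, hb, hπ⟩⟩
  rintro ⟨X', Fs', Fn', h', ha', hb', hπ⟩
  exact (h.sub_unique h' ha ha' hb hb' π).2 hπ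

theorem FalsityOn.notMem_iff_falsSub {X Fs Fn a b π : V} (h : 𝒜.FalsityOn X Fs Fn) (ha : a ∈ᵥ X)
    (hb : b ∈ᵥ X) : opair (opair a b) π ∈ᵥ Fn ↔ ∃ c t t' σ, opair c σ ∈ᵥ b ∧
      t ∈ 𝒜.orth (𝒜.falsSub a c) ∧ t' ∈ 𝒜.orth (𝒜.falsSub c a) ∧ π = sCons t (sCons t' σ) := by
  rw [h.notMem_iff a b π ha hb]
  refine exists_congr fun c => exists_congr fun t => exists_congr fun t' =>
    exists_congr fun σ => and_congr_right fun hc => ?_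
  have hc' := (h.nameSet.mem hb hc).1
  rw [h.falsSub_eq ha hc', h.falsSub_eq hc' ha]

theorem exists_falsityOn {a b : V} (ha : 𝒜.IsName a) (hb : 𝒜.IsName b) :
    ∃ X Fs Fn, 𝒜.FalsityOn X Fs Fn ∧ a ∈ᵥ X ∧ b ∈ᵥ X := by
  obtain ⟨X, hX, haX⟩ := ha
  obtain ⟨Y, hY, hbY⟩ := hb
  obtain ⟨Fs, Fn, h⟩ := (hX.cup hY).exists_falsityOn
  exact ⟨_, Fs, Fn, h, mem_cup.2 (Or.inl haX), mem_cup.2 (Or.inr hbY)⟩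

/-- This and `mem_falsSub` recover the recursive equations of the definition, free of any auxiliary
set X. -/
theorem mem_falsNotMem {a b π : V} (ha : 𝒜.IsName a) (hb : 𝒜.IsName b) :
    π ∈ 𝒜.falsNotMem a b ↔ ∃ c t t' σ, opair c σ ∈ᵥ b ∧ t ∈ 𝒜.orth (𝒜.falsSub a c) ∧
      t' ∈ 𝒜.orth (𝒜.falsSub c a) ∧ π = sCons t (sCons t' σ) := by
  constructor
  · rintro ⟨X, Fs, Fn, h, haX, hbX, hπ⟩
    exact (h.notMem_iff_falsSub haX hbX).1 hπ
  · intro hπ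
    obtain ⟨X, Fs, Fn, h, haX, hbX⟩ := exists_falsityOn ha hb
    exact ⟨X, Fs, Fn, h, haX, hbX, (h.notMem_iff_falsSub haX hbX).2 hπ⟩

theorem mem_falsSub {a b π : V} (ha : 𝒜.IsName a) (hb : 𝒜.IsName b) :
    π ∈ 𝒜.falsSub a b ↔ ∃ c t σ, opair c σ ∈ᵥ a ∧ t ∈ 𝒜.orth (𝒜.falsNotMem c b) ∧
      π = sCons t σ := by
  obtain ⟨X, Fs, Fn, h, haX, hbX⟩ := exists_falsityOn ha hb
  rw [h.falsSub_eq haX hbX, Set.mem_ofPred_eq, h.sub_iff a b π haX hbX]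
  refine exists_congr fun c => exists_congr fun t => exists_congr fun σ =>
    and_congr_right fun hc => ?_
  have hcX := (h.nameSet.mem haX hc).1
  rw [show {ρ | opair (opair c b) ρ ∈ᵥ Fn} = 𝒜.falsNotMem c b from Set.ext fun ρ => by
    rw [mem_falsNotMem (ha.mem hc).1 hb]
    exact h.notMem_iff_falsSub hcX hbX]

theorem falsityOn_iff {X Fs Fn : V} : 𝒜.FalsityOn X Fs Fn ↔ 𝒜.NameSet X ∧
    (∀ a b π, a ∈ᵥ X → b ∈ᵥ X → (opair (opair a b) π ∈ᵥ Fs ↔ ∃ c t σ, opair c σ ∈ᵥ a ∧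
      t ∈ 𝒜.orth {ρ | opair (opair c b) ρ ∈ᵥ Fn} ∧ π = sCons t σ)) ∧
    ∀ a b π, a ∈ᵥ X → b ∈ᵥ X → (opair (opair a b) π ∈ᵥ Fn ↔ 𝒜.NotMemOf Fs a b π) :=
  ⟨fun ⟨a, b, c⟩ => ⟨a, b, c⟩, fun ⟨a, b, c⟩ => ⟨a, b, c⟩⟩

instance dfn_falsityOn {f g k : (Fin n → V) → V} [DfnFun f] [DfnFun g] [DfnFun k] :
    Dfn (fun v => 𝒜.FalsityOn (f v) (g v) (k v)) :=
  Dfn.of3 (by simp only [falsityOn_iff]; infer_instance)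

instance dfn_orth_falsSub {f g k : (Fin n → V) → V} [DfnFun f] [DfnFun g] [DfnFun k] :
    Dfn (fun v => f v ∈ 𝒜.orth (𝒜.falsSub (g v) (k v))) :=
  Dfn.of3 (R := fun t a b => t ∈ 𝒜.orth (𝒜.falsSub a b)) (by
    show Dfn fun v : Fin 3 → V => v 0 ∈ 𝒜.orth {π | ∃ X Fs Fn, 𝒜.FalsityOn X Fs Fn ∧ v 1 ∈ᵥ X ∧
      v 2 ∈ᵥ X ∧ opair (opair (v 1) (v 2)) π ∈ᵥ Fs}
    infer_instance)

instance dfn_orth_falsNotMem {f g k : (Fin n → V) → V} [DfnFun f] [DfnFun g] [DfnFun k] :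
    Dfn (fun v => f v ∈ 𝒜.orth (𝒜.falsNotMem (g v) (k v))) :=
  Dfn.of3 (R := fun t a b => t ∈ 𝒜.orth (𝒜.falsNotMem a b)) (by
    show Dfn fun v : Fin 3 → V => v 0 ∈ 𝒜.orth {π | ∃ X Fs Fn, 𝒜.FalsityOn X Fs Fn ∧ v 1 ∈ᵥ X ∧
      v 2 ∈ᵥ X ∧ opair (opair (v 1) (v 2)) π ∈ᵥ Fn}
    infer_instance)

end RealizabilityAlgebra

/-! ### Church numerals -/

section Church

variable {V : Type u} [ZFModel V] {A B : V}

theorem IsChurch.zero : IsChurch (emp : V) churchZero := fun _ h _ => h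

theorem IsChurch.succ {n t : V} (hn : IsNat n) (h : IsChurch n t) :
    IsChurch (succ n) (churchSucc t) := fun S h0 hs => hs n t hn (h S h0 hs)

theorem IsChurch.induction (P : V → V → Prop) [Dfn (fun v : Fin 2 → V => P (v 0) (v 1))]
    (h0 : P emp churchZero)
    (hs : ∀ m s, IsNat m → IsChurch m s → P m s → P (Realizability.succ m) (churchSucc s))
    {n t : V} (h : IsChurch n t) : P n t := by
  have : ∀ {m : ℕ} (i j : Fin m), Dfn (fun w : Fin m → V => P (w i) (w j)) := fun i j =>
    Dfn.of2 (R := P) inferInstance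
  obtain ⟨U, hω, hp⟩ := exists_opair_closed (omega : V)
  have hω : ∀ n, IsNat n → n ∈ᵥ U := fun n hn => hω n (mem_omega.2 hn)
  have hn : ∀ k, (num k : V) ∈ᵥ U := fun k => hω _ (isNat_num k)
  have hv : ∀ k, (tVar (num k) : V) ∈ᵥ U := fun k => hp _ _ (hn 0) (hn k)
  have ha : ∀ a b : V, a ∈ᵥ U → b ∈ᵥ U → tApp a b ∈ᵥ U := fun a b ha hb =>
    hp _ _ (hn 1) (hp _ _ ha hb)
  have hl : ∀ a : V, a ∈ᵥ U → tLam a ∈ᵥ U := fun a ha => hp _ _ (hn 2) ha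
  obtain ⟨S, hS⟩ := exists_sep (fun p => ∃ n t, IsChurch n t ∧ t ∈ᵥ U ∧ P n t ∧ p = opair n t) U
  have key : ∀ n t, IsNat n → (opair n t ∈ᵥ S ↔ IsChurch n t ∧ t ∈ᵥ U ∧ P n t) := by
    intro n t hn
    rw [hS]
    constructor
    · rintro ⟨-, n', t', h1, h2, h3, h4⟩
      obtain ⟨rfl, rfl⟩ := opair_inj.1 h4
      exact ⟨h1, h2, h3⟩
    · exact fun h => ⟨hp _ _ (hω n hn) h.2.1, n, t, h.1, h.2.1, h.2.2, rfl⟩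
  obtain ⟨-, n', t', -, -, h3, h4⟩ := (hS _).1 <| h S
    ((key _ _ .zero).2 ⟨.zero, hl _ (hl _ (hv 0)), h0⟩) (fun m s hm hms => by
      obtain ⟨h1, h2, h3⟩ := (key m s hm).1 hms
      exact (key _ _ hm.succ).2 ⟨h1.succ hm,
        hl _ (hl _ (ha _ _ (ha _ _ h2 (hv 1)) (ha _ _ (hv 1) (hv 0)))), hs m s hm h1 h3⟩)
  obtain ⟨rfl, rfl⟩ := opair_inj.1 h4
  exact h3

theorem IsChurch.isNat {n t : V} (h : IsChurch n t) : IsNat n :=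
  IsChurch.induction (fun n _ => IsNat n) .zero (fun _ _ hm _ _ => hm.succ) h

theorem churchZero_eq_inst (σ : ℕ → V) :
    (Tm.lam (.lam (.var 0))).inst 0 σ = churchZero := rfl

/-- Presents the numerals of `V`, possibly nonstandard, one step at a time as instances of
metatheoretic terms, to which the evaluation lemmas apply. -/
theorem churchSucc_eq_inst (i : ℕ) (σ : ℕ → V) :
    (Tm.lam (.lam (.app (.app (.var (i + 2)) (.var 1)) (.app (.var 1) (.var 0))))).inst 0 σ =
      churchSucc (σ i) := by
  simp [Tm.inst, churchSucc]

theorem IsChurch.isTerm {n t : V} (h : IsChurch n t) : IsTerm A B t := by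
  refine IsChurch.induction (fun _ t => IsTerm A B t) ?_ ?_ h
  · rw [← churchZero_eq_inst fun _ => tCC]
    exact Tm.isTermAt_inst (fun _ => .cc .zero) _ 0
  · intro m s _ _ hs
    rw [← churchSucc_eq_inst 0 fun _ => s]
    exact Tm.isTermAt_inst (fun _ => hs) _ 0

theorem exists_isChurch {n : V} (hn : IsNat n) : ∃ t, IsChurch n t :=
  IsNat.induction (fun n => ∃ t, IsChurch n t) ⟨_, .zero⟩
    (fun _ hn ⟨_, ht⟩ => ⟨_, ht.succ hn⟩) hn

end Church

namespace RealizabilityAlgebra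

variable {V : Type u} [ZFModel V] {𝒜 : RealizabilityAlgebra V} {n : ℕ}

/-! ### The hat function -/

variable (𝒜) in
theorem exists_hatLayer (n h : V) : ∃ s : V, ∀ p, p ∈ᵥ s ↔
    ∃ t π, IsChurch n t ∧ 𝒜.Stack π ∧ p = opair h (sCons t π) := by
  obtain ⟨U, hh, hp, -, hS, -, -⟩ := exists_universe 𝒜.A 𝒜.B (upair h h)
  obtain ⟨s, hs⟩ := exists_sep
    (fun p => ∃ t π, IsChurch n t ∧ 𝒜.Stack π ∧ p = opair h (sCons t π)) U
  refine ⟨s, fun p => ⟨fun h => ((hs p).1 h).2, fun h' => (hs p).2 ⟨?_, h'⟩⟩⟩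
  obtain ⟨t, π, ht, hπ, rfl⟩ := h'
  exact hp _ _ (hh h (by simp)) (hS _ (.cons ht.isTerm hπ))

variable (𝒜) in
/-- The set `{(h, ν_n · π) | π ∈ Π}`. -/
noncomputable def hatLayer (n h : V) : V := Classical.choose (𝒜.exists_hatLayer n h)

@[simp] theorem mem_hatLayer {n h p : V} : p ∈ᵥ 𝒜.hatLayer n h ↔
    ∃ t π, IsChurch n t ∧ 𝒜.Stack π ∧ p = opair h (sCons t π) :=
  Classical.choose_spec (𝒜.exists_hatLayer n h) p

instance dfnFun_hatLayer {f g : (Fin n → V) → V} [DfnFun f] [DfnFun g] :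
    DfnFun (fun v => 𝒜.hatLayer (f v) (g v)) :=
  DfnFun.of2 (Dfn.congr (Q := fun v => ∀ z, z ∈ᵥ v 0 ↔
    ∃ t π, IsChurch (v 1) t ∧ 𝒜.Stack π ∧ z = opair (v 2) (sCons t π)) inferInstance
    fun v => by simp only [ext_iff, mem_hatLayer])

open Classical in
variable (𝒜) in
/-- The function `(n, n̂) ↦ (n + 1, (n + 1)^)`. -/
noncomputable def hatStep (p : V) : V :=
  if h : ∃ n a, p = opair n a then
    opair (succ h.choose) (cup h.choose_spec.choose (𝒜.hatLayer h.choose h.choose_spec.choose))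
  else emp

theorem hatStep_opair (n a : V) :
    𝒜.hatStep (opair n a) = opair (succ n) (cup a (𝒜.hatLayer n a)) := by
  have h : ∃ n' a', opair n a = opair n' a' := ⟨n, a, rfl⟩
  obtain ⟨e1, e2⟩ := opair_inj.1 h.choose_spec.choose_spec
  rw [hatStep, dif_pos h, ← e2, ← e1]

instance dfn_hatStep : Dfn (fun v : Fin 2 → V => v 1 = 𝒜.hatStep (v 0)) := by
  refine Dfn.congr (Q := fun v => (∃ n a, v 0 = opair n a ∧
    v 1 = opair (succ n) (cup a (𝒜.hatLayer n a))) ∨ (¬ (∃ n a, v 0 = opair n a) ∧ v 1 = emp))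
    inferInstance fun v => ?_
  by_cases h : ∃ n a, v 0 = opair n a
  · obtain ⟨n, a, e⟩ := h
    rw [e, hatStep_opair]
    constructor
    · exact fun h => Or.inl ⟨n, a, rfl, h⟩
    · rintro (⟨n', a', e', h⟩ | ⟨h, -⟩)
      · obtain ⟨rfl, rfl⟩ := opair_inj.1 e'
        exact h
      · exact absurd ⟨n, a, rfl⟩ h
  · rw [hatStep, dif_neg h]
    constructor
    · exact fun h' => Or.inr ⟨h, h'⟩
    · rintro (⟨n, a, e, -⟩ | ⟨-, h'⟩)
      exacts [absurd ⟨n, a, e⟩ h, h']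

variable (𝒜) in
-- The recursion for n̂ refers to all smaller values, but the (n + 1)-st name is n̂ together with
-- one new layer. Plain iteration of `hatStep` on the pairs (n, n̂) thus suffices.
theorem exists_isHatFunction : ∃ g, 𝒜.IsHatFunction g := by
  have := @dfn_isIter V _ 𝒜.hatStep (opair emp emp)
  obtain ⟨g, hg⟩ := exists_iterates 𝒜.hatStep (opair emp emp)
  have pair : ∀ {n}, IsNat n → ∃ h, IsIter 𝒜.hatStep (opair emp emp) n (opair n h) := by
    intro n hn
    refine IsNat.induction (fun n => ∃ h, IsIter 𝒜.hatStep (opair emp emp) n (opair n h))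
      ⟨emp, .zero⟩ ?_ hn
    rintro n hn ⟨h, hh⟩
    exact ⟨_, hatStep_opair (𝒜 := 𝒜) n h ▸ hh.succ hn⟩
  have mem_g : ∀ n h, opair n h ∈ᵥ g ↔
      IsNat n ∧ IsIter 𝒜.hatStep (opair emp emp) n (opair n h) := by
    intro n h
    rw [hg]
    refine ⟨?_, fun h => ⟨n, h⟩⟩
    rintro ⟨m, hm, h'⟩
    obtain ⟨k, hk⟩ := pair hm
    obtain ⟨rfl, rfl⟩ := opair_inj.1 (h'.unique hm hk)
    exact ⟨hm, h'⟩
  have uniq : ∀ {n h h'}, opair n h ∈ᵥ g → opair n h' ∈ᵥ g → h = h' := by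
    intro n h h' hh hh'
    rw [mem_g] at hh hh'
    exact (opair_inj.1 (hh.2.unique hh.1 hh'.2)).2
  have step : ∀ {n h}, opair n h ∈ᵥ g → opair (succ n) (cup h (𝒜.hatLayer n h)) ∈ᵥ g := by
    intro n h hh
    rw [mem_g] at hh ⊢
    exact ⟨hh.1.succ, hatStep_opair (𝒜 := 𝒜) n h ▸ hh.2.succ hh.1⟩
  refine ⟨g, fun x hx => ?_, fun n hn => ?_, fun n h hh => ?_⟩
  · obtain ⟨n, hn, hx⟩ := (hg x).1 hx
    obtain ⟨h, hh⟩ := pair hn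
    exact ⟨n, h, hn, hx.unique hn hh⟩
  · obtain ⟨h, hh⟩ := pair hn
    have hh := (mem_g n h).2 ⟨hn, hh⟩
    exact ⟨h, hh, fun h' hh' => uniq hh' hh⟩
  · have hn := ((mem_g n h).1 hh).1
    revert h
    have : Dfn fun v : Fin 1 → V => ∀ h, opair (v 0) h ∈ᵥ g →
        ∀ p, p ∈ᵥ h ↔ ∃ m, m ∈ᵥ v 0 ∧ 𝒜.IsHatElement g m p := by
      unfold IsHatElement; infer_instance
    refine IsNat.induction (fun n => ∀ h, opair n h ∈ᵥ g →
        ∀ p, p ∈ᵥ h ↔ ∃ m, m ∈ᵥ n ∧ 𝒜.IsHatElement g m p) ?_ ?_ hn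
    · intro h hh p
      obtain rfl : h = emp := uniq hh ((mem_g _ _).2 ⟨.zero, .zero⟩)
      simp
    · intro n hn ih h' hh' p
      obtain ⟨h, hh⟩ := pair hn
      have hh := (mem_g n h).2 ⟨hn, hh⟩
      obtain rfl := uniq hh' (step hh)
      rw [mem_cup, mem_hatLayer, ih h hh p]
      constructor
      · rintro (⟨m, hm, h'⟩ | ⟨t, π, ht, hπ, rfl⟩)
        · exact ⟨m, mem_succ.2 (Or.inl hm), h'⟩
        · exact ⟨n, mem_succ.2 (Or.inr rfl), h, t, π, hh, ht, hπ, rfl⟩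
      · rintro ⟨m, hm, h'⟩
        rcases mem_succ.1 hm with hm | rfl
        · exact Or.inl ⟨m, hm, h'⟩
        · obtain ⟨k, t, π, hk, ht, hπ, rfl⟩ := h'
          obtain rfl := uniq hk hh
          exact Or.inr ⟨t, π, ht, hπ, rfl⟩

theorem IsHatFunction.isNat {g n h : V} (hg : 𝒜.IsHatFunction g) (hh : opair n h ∈ᵥ g) :
    IsNat n := by
  obtain ⟨m, k, hm, e⟩ := hg.isPair _ hh
  obtain ⟨rfl, rfl⟩ := opair_inj.1 e
  exact hm

theorem IsHatFunction.unique {g g' n h h' : V} (hg : 𝒜.IsHatFunction g)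
    (hg' : 𝒜.IsHatFunction g') (hh : opair n h ∈ᵥ g) (hh' : opair n h' ∈ᵥ g') : h = h' := by
  -- Strong induction: the statement for n concerns all m < n, and is used at n + 1.
  refine IsNat.induction (fun n => ∀ m, m ∈ᵥ n → ∀ h h', opair m h ∈ᵥ g → opair m h' ∈ᵥ g' →
    h = h') (by simp) ?_ (hg.isNat hh).succ n (by simp) h h' hh hh'
  clear n h h' hh hh'
  intro n hn ih m hm h h' hh hh'
  rcases mem_succ.1 hm with hm | rfl
  · exact ih m hm h h' hh hh'
  · refine ext_iff.2 fun p => ?_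
    rw [hg.mem_iff _ _ hh, hg'.mem_iff _ _ hh']
    refine exists_congr fun k => and_congr_right fun hk => ?_
    constructor
    · rintro ⟨a, t, π, ha, ht, hπ, rfl⟩
      obtain ⟨b, hb, -⟩ := hg'.existsUnique k (hn.of_mem hk)
      exact ⟨b, t, π, hb, ht, hπ, by rw [ih k hk a b ha hb]⟩
    · rintro ⟨b, t, π, hb, ht, hπ, rfl⟩
      obtain ⟨a, ha, -⟩ := hg.existsUnique k (hn.of_mem hk)
      exact ⟨a, t, π, ha, ht, hπ, by rw [ih k hk a b ha hb]⟩

theorem NameSet.isName_of_subset {X a : V} (hX : 𝒜.NameSet X)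
    (ha : ∀ p, p ∈ᵥ a → ∃ b π, b ∈ᵥ X ∧ 𝒜.Stack π ∧ p = opair b π) : 𝒜.IsName a := by
  refine ⟨Realizability.cup X (upair a a), fun x hx p hp => ?_, by simp⟩
  have : ∃ b π, b ∈ᵥ X ∧ 𝒜.Stack π ∧ p = opair b π := by
    rcases mem_cup.1 hx with hx | hx
    · exact hX x hx p hp
    · obtain rfl : x = a := by simpa using hx
      exact ha p hp
  obtain ⟨b, π, hb, h⟩ := this
  exact ⟨b, π, mem_cup.2 (Or.inl hb), h⟩

theorem IsHatFunction.exists_nameSet {g : V} (hg : 𝒜.IsHatFunction g) :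
    ∃ X, 𝒜.NameSet X ∧ ∀ h, h ∈ᵥ X ↔ ∃ n, opair n h ∈ᵥ g := by
  obtain ⟨X, hX⟩ := exists_sep (fun h => ∃ n, opair n h ∈ᵥ g) (sUnion (sUnion g))
  have hX : ∀ h, h ∈ᵥ X ↔ ∃ n, opair n h ∈ᵥ g := by
    refine fun h => ⟨fun hh => ((hX h).1 hh).2, fun hh => (hX h).2 ⟨?_, hh⟩⟩
    obtain ⟨n, hn⟩ := hh
    exact mem_sUnion.2 ⟨upair n h, mem_sUnion.2 ⟨_, hn, by simp [opair]⟩, by simp⟩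
  refine ⟨X, fun h hh p hp => ?_, hX⟩
  obtain ⟨n, hn⟩ := (hX h).1 hh
  obtain ⟨m, hm, a, t, π, ha, ht, hπ, rfl⟩ := (hg.mem_iff n h hn p).1 hp
  exact ⟨a, _, (hX a).2 ⟨m, ha⟩, .cons ht.isTerm hπ, rfl⟩

variable (𝒜) in
theorem existsUnique_isOmegaHat : ∃! W : 𝒜.Name, 𝒜.IsOmegaHat W.1 := by
  obtain ⟨g, hg⟩ := 𝒜.exists_isHatFunction
  obtain ⟨X, hX, hXg⟩ := hg.exists_nameSet
  obtain ⟨U, hUX, hp, -, hS, -, -⟩ := exists_universe 𝒜.A 𝒜.B X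
  have : Dfn fun v : Fin 1 → V => ∃ m, IsNat m ∧ 𝒜.IsHatElement g m (v 0) := by
    unfold IsHatElement; infer_instance
  obtain ⟨W, hW⟩ := exists_sep (fun p => ∃ m, IsNat m ∧ 𝒜.IsHatElement g m p) U
  have hW : ∀ p, p ∈ᵥ W ↔ ∃ m, IsNat m ∧ 𝒜.IsHatElement g m p := by
    refine fun p => ⟨fun h => ((hW p).1 h).2, fun h => (hW p).2 ⟨?_, h⟩⟩
    obtain ⟨m, hm, a, t, π, ha, ht, hπ, rfl⟩ := h
    exact hp _ _ (hUX a ((hXg a).2 ⟨m, ha⟩)) (hS _ (.cons ht.isTerm hπ))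
  have hN : 𝒜.IsName W := hX.isName_of_subset fun p hp => by
    obtain ⟨m, hm, a, t, π, ha, ht, hπ, rfl⟩ := (hW p).1 hp
    exact ⟨a, _, (hXg a).2 ⟨m, ha⟩, .cons ht.isTerm hπ, rfl⟩
  refine ⟨⟨W, hN⟩, ⟨g, hg, hW⟩, ?_⟩
  rintro ⟨W', hN'⟩ ⟨g', hg', hW'⟩
  refine Subtype.ext (ext_iff.2 fun p => ?_)
  rw [hW, hW']
  refine exists_congr fun m => and_congr_right fun hm => ?_
  obtain ⟨a, ha, -⟩ := hg.existsUnique m hm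
  obtain ⟨a', ha', -⟩ := hg'.existsUnique m hm
  obtain rfl := hg.unique hg' ha ha'
  constructor
  · rintro ⟨b, t, π, hb, h⟩
    obtain rfl := hg'.unique hg hb ha
    exact ⟨b, t, π, ha, h⟩
  · rintro ⟨b, t, π, hb, h⟩
    obtain rfl := hg.unique hg' hb ha'
    exact ⟨b, t, π, ha', h⟩

/-- The names `n̂`, with a description of their elements and of those of `ω̂`. -/
theorem IsOmegaHat.exists_hat {W : V} (h : 𝒜.IsOmegaHat W) : ∃ hat : V → 𝒜.Name,
    (∀ c π, opair c π ∈ᵥ W ↔ ∃ m, IsNat m ∧ c = (hat m).1 ∧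
      ∃ t ρ, IsChurch m t ∧ 𝒜.Stack ρ ∧ π = sCons t ρ) ∧
    ∀ n, IsNat n → ∀ c π, opair c π ∈ᵥ (hat n).1 ↔ ∃ m, m ∈ᵥ n ∧ c = (hat m).1 ∧
      ∃ t ρ, IsChurch m t ∧ 𝒜.Stack ρ ∧ π = sCons t ρ := by
  obtain ⟨g, hg, hW⟩ := h
  obtain ⟨X, hX, hXg⟩ := hg.exists_nameSet
  have : ∀ m, ∃ a : 𝒜.Name, IsNat m → opair m a.1 ∈ᵥ g := by
    intro m
    by_cases hm : IsNat m
    · obtain ⟨a, ha, -⟩ := hg.existsUnique m hm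
      exact ⟨⟨a, X, hX, (hXg a).2 ⟨m, ha⟩⟩, fun _ => ha⟩
    -- Outside `ω` the value is the empty name, a default that is never used.
    · exact ⟨⟨emp, hX.isName_of_subset (by simp)⟩, fun h => absurd h hm⟩
  choose hat hhat using this
  have key : ∀ m c π, IsNat m → (𝒜.IsHatElement g m (opair c π) ↔ c = (hat m).1 ∧
      ∃ t ρ, IsChurch m t ∧ 𝒜.Stack ρ ∧ π = sCons t ρ) := by
    intro m c π hm
    constructor
    · rintro ⟨a, t, ρ, ha, ht, hρ, e⟩
      obtain ⟨rfl, rfl⟩ := opair_inj.1 e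
      exact ⟨hg.unique hg ha (hhat m hm), t, ρ, ht, hρ, rfl⟩
    · rintro ⟨rfl, t, ρ, ht, hρ, rfl⟩
      exact ⟨_, t, ρ, hhat m hm, ht, hρ, rfl⟩
  refine ⟨hat, fun c π => ?_, fun n hn c π => ?_⟩
  · rw [hW]
    exact exists_congr fun m => and_congr_right fun hm => key m c π hm
  · rw [hg.mem_iff n _ (hhat n hn)]
    exact exists_congr fun m => and_congr_right fun hm => key m c π (hn.of_mem hm)

theorem exists_isGimel_inDom (W : 𝒜.Name) : ∃ G : 𝒜.Name, 𝒜.IsGimel (𝒜.InDom W.1) G.1 := by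
  obtain ⟨W, X, hX, hW⟩ := W
  obtain ⟨U, hUX, hp, -, hS, -, -⟩ := exists_universe 𝒜.A 𝒜.B X
  obtain ⟨G, hG⟩ := exists_sep (fun p => ∃ b π, 𝒜.InDom W b ∧ 𝒜.Stack π ∧ p = opair b π) U
  have hdom : ∀ b, 𝒜.InDom W b → b ∈ᵥ X := fun b ⟨_, _, h⟩ => (hX.mem hW h).1
  have hG : 𝒜.IsGimel (𝒜.InDom W) G := by
    refine fun p => ⟨fun h => ((hG p).1 h).2, fun h => (hG p).2 ⟨?_, h⟩⟩
    obtain ⟨b, π, hb, hπ, rfl⟩ := h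
    exact hp _ _ (hUX b (hdom b hb)) (hS _ hπ)
  refine ⟨⟨G, hX.isName_of_subset fun p hp => ?_⟩, hG⟩
  obtain ⟨b, π, hb, hπ, rfl⟩ := (hG p).1 hp
  exact ⟨b, π, hdom b hb, hπ, rfl⟩

end RealizabilityAlgebra

theorem scons_mem {V : Type u} {Γ : List (Set V)} {X : Set V} {σ : ℕ → V} {r : V} (hr : r ∈ X) (hΓ : ∀ i Y, Γ[i]? = some Y → σ i ∈ Y) :
    ∀ i Y, (X :: Γ)[i]? = some Y → scons r σ i ∈ Y := by
  rintro (_ | i) Y h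
  · obtain rfl : X = Y := by simpa using h
    exact hr
  · exact hΓ i Y (by simpa using h)

namespace RealizabilityAlgebra

variable {V : Type u} [ZFModel V] {𝒜 : RealizabilityAlgebra V}

/-! ### Realizability of sequents -/

/-- The falsity value of the implication from the truth value `X` to the falsity value `F`. -/
def arr (X F : Set V) : Set V := {ρ | ∃ t ∈ X, ∃ π ∈ F, ρ = sCons t π}

variable (𝒜) in
/-- The falsity value of `⊥`. -/
def botF : Set V := {π | 𝒜.Stack π}

/-- The Church numerals of `n`. -/
def Ch (n : V) : Set V := {t | IsChurch n t}

/-- The falsity value of `c ∉ε a`. -/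
def epsF (a c : V) : Set V := {π | opair c π ∈ᵥ a}

variable (𝒜) in
/-- Every substitution by elements of the sets in `Γ` turns `t` into an element of `T`. -/
def Judge (Γ : List (Set V)) (t : Tm) (T : Set V) : Prop :=
  ∀ σ : ℕ → V, (∀ i, 𝒜.Term (σ i)) → (∀ i X, Γ[i]? = some X → σ i ∈ X) → t.inst 0 σ ∈ T

theorem term_stack_of_pole {t π : V} (h : opair t π ∈ᵥ 𝒜.pole) : 𝒜.Term t ∧ 𝒜.Stack π := by
  obtain ⟨t', π', ht, hπ, e⟩ := 𝒜.pole_subset _ h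
  obtain ⟨rfl, rfl⟩ := opair_inj.1 e
  exact ⟨ht, hπ⟩

theorem pole_push {t s π : V} (h : opair t (sCons s π) ∈ᵥ 𝒜.pole) :
    opair (tApp t s) π ∈ᵥ 𝒜.pole := by
  obtain ⟨ht, hs⟩ := term_stack_of_pole h
  obtain ⟨hs, hπ⟩ := isStack_cons_iff.1 hs
  exact 𝒜.pole_up _ _ (𝒜.push t s π ht hs hπ) h

theorem term_inst {σ : ℕ → V} (hσ : ∀ i, 𝒜.Term (σ i)) (t : Tm) : 𝒜.Term (t.inst 0 σ) :=
  Tm.isTermAt_inst hσ t 0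

theorem term_scons {σ : ℕ → V} {s : V} (hs : 𝒜.Term s) (hσ : ∀ i, 𝒜.Term (σ i)) (i : ℕ) :
    𝒜.Term (scons s σ i) := by
  cases i
  exacts [hs, hσ _]

theorem pole_grab {t : Tm} {σ : ℕ → V} {s π : V} (hσ : ∀ i, 𝒜.Term (σ i)) (hs : 𝒜.Term s)
    (h : opair (t.inst 0 (scons s σ)) π ∈ᵥ 𝒜.pole) :
    opair ((Tm.lam t).inst 0 σ) (sCons s π) ∈ᵥ 𝒜.pole :=
  𝒜.pole_up _ _ (𝒜.grab _ s _ π (Tm.isTermAt_inst hσ t 1) hs (term_stack_of_pole h).2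
    (Tm.isSubst_inst hσ t 0)) h

section Rules

variable {Γ : List (Set V)} {t s : Tm} {X Y F G : Set V}

theorem Judge.var (i : ℕ) (h : Γ[i]? = some X) : 𝒜.Judge Γ (.var i) X := fun σ _ hΓ => by
  have := hΓ i X h
  simpa [Tm.inst] using this

theorem Judge.mono (h : 𝒜.Judge Γ t X) (hXY : X ⊆ Y) : 𝒜.Judge Γ t Y :=
  fun σ hσ hΓ => hXY (h σ hσ hΓ)

theorem Judge.anti (h : 𝒜.Judge Γ t (𝒜.orth G)) (hFG : F ⊆ G) : 𝒜.Judge Γ t (𝒜.orth F) :=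
  h.mono (orth_anti hFG)

theorem Judge.lam' (hX : ∀ r ∈ X, 𝒜.Term r) (h : 𝒜.Judge (X :: Γ) t (𝒜.orth F)) :
    𝒜.Judge Γ (.lam t) (𝒜.orth (arr X F)) := by
  intro σ hσ hΓ
  refine ⟨term_inst hσ _, ?_⟩
  rintro _ ⟨r, hr, π, hπ, rfl⟩
  exact pole_grab hσ (hX r hr) ((h _ (term_scons (hX r hr) hσ) (scons_mem hr hΓ)).2 π hπ)

theorem Judge.lam (h : 𝒜.Judge (𝒜.orth G :: Γ) t (𝒜.orth F)) :
    𝒜.Judge Γ (.lam t) (𝒜.orth (arr (𝒜.orth G) F)) := .lam' (fun _ hr => hr.1) h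

theorem Judge.lamCh {n : V} (h : 𝒜.Judge (Ch n :: Γ) t (𝒜.orth F)) :
    𝒜.Judge Γ (.lam t) (𝒜.orth (arr (Ch n) F)) := .lam' (fun _ hr => IsChurch.isTerm hr) h

theorem Judge.app (h : 𝒜.Judge Γ t (𝒜.orth (arr X F))) (h' : 𝒜.Judge Γ s X) :
    𝒜.Judge Γ (.app t s) (𝒜.orth F) := fun σ hσ hΓ =>
  ⟨term_inst hσ (t.app s), fun π hπ => pole_push ((h σ hσ hΓ).2 _ ⟨_, h' σ hσ hΓ, π, hπ, rfl⟩)⟩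

/-- The type `G` may depend on the stack while the term may not. This is the source of the
uniformity of realizers over names and naturals. -/
theorem Judge.orth_intro
    (h : ∀ ρ ∈ F, ∃ G : Set V, ρ ∈ G ∧ 𝒜.Judge Γ t (𝒜.orth G)) :
    𝒜.Judge Γ t (𝒜.orth F) := fun σ hσ hΓ =>
  ⟨term_inst hσ t, fun ρ hρ => let ⟨_, hG, hG'⟩ := h ρ hρ; (hG' σ hσ hΓ).2 ρ hG⟩

theorem Judge.all_intro {ι : Sort*} {F : ι → Set V} (h : ∀ i, 𝒜.Judge Γ t (𝒜.orth (F i))) :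
    𝒜.Judge Γ t (𝒜.orth (⋃ i, F i)) :=
  .orth_intro fun _ hρ => let ⟨i, hi⟩ := Set.mem_iUnion.1 hρ; ⟨F i, hi, h i⟩

theorem Judge.all_elim {ι : Sort*} {F : ι → Set V} (h : 𝒜.Judge Γ t (𝒜.orth (⋃ i, F i)))
    (i : ι) : 𝒜.Judge Γ t (𝒜.orth (F i)) := h.anti (Set.subset_iUnion F i)

theorem Judge.church_zero : 𝒜.Judge Γ (.lam (.lam (.var 0))) (Ch emp) :=
  fun _ _ _ => IsChurch.zero

theorem Judge.church_succ {i : ℕ} {n : V} (hn : IsNat n) (h : Γ[i]? = some (Ch n)) :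
    𝒜.Judge Γ (.lam (.lam (.app (.app (.var (i + 2)) (.var 1)) (.app (.var 1) (.var 0)))))
      (Ch (succ n)) := by
  intro σ _ hΓ
  rw [churchSucc_eq_inst]
  exact (hΓ i _ h : IsChurch n (σ i)).succ hn

end Rules

end RealizabilityAlgebra

/-! ### Fixed points -/

/-- One half of Turing's fixed point combinator. -/
def Tm.turing : Tm := .lam (.lam (.app (.var 0) (.app (.app (.var 1) (.var 1)) (.var 0))))

/-- The fixed point of `λ x. t`, where `x` is the variable `0` of `t`. -/
def Tm.fix (t : Tm) : Tm := .app (.app turing turing) (.lam t)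

namespace RealizabilityAlgebra

variable {V : Type u} [ZFModel V] {𝒜 : RealizabilityAlgebra V}

/-- With Θ = λx. λy. y (x x y), the term ΘΘF evaluates to F applied to ΘΘF itself, and then F = λx.
t is unfolded. -/
theorem pole_fix {t : Tm} {σ : ℕ → V} {π : V} (hσ : ∀ i, 𝒜.Term (σ i))
    (h : opair (t.inst 0 (scons (t.fix.inst 0 σ) σ)) π ∈ᵥ 𝒜.pole) :
    opair (t.fix.inst 0 σ) π ∈ᵥ 𝒜.pole := by
  have hA : 𝒜.Term (Tm.turing.inst 0 σ) := term_inst hσ _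
  have hF : 𝒜.Term ((Tm.lam t).inst 0 σ) := term_inst hσ _
  refine pole_push (pole_push (pole_grab hσ hA (pole_grab (term_scons hA hσ) hF ?_)))
  exact pole_push (pole_grab hσ (term_inst hσ t.fix) h)

/-- The recursive call has the type of all R-smaller indices. Well-foundedness enters only through
`ind`, an induction principle for a fixed term `c`, because R need be well-founded only for
properties definable in `V`. -/
theorem Judge.fix {ι : Type*} {G : ι → Set V} {R : ι → ι → Prop} {Γ : List (Set V)} {t : Tm}
    (ind : ∀ c, 𝒜.Term c → (∀ x, (∀ y, R y x → c ∈ 𝒜.orth (G y)) → c ∈ 𝒜.orth (G x)) →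
      ∀ x, c ∈ 𝒜.orth (G x))
    (h : ∀ x, 𝒜.Judge (𝒜.orth (⋃ y : {y // R y x}, G y.1) :: Γ) t (𝒜.orth (G x))) (x : ι) :
    𝒜.Judge Γ t.fix (𝒜.orth (G x)) := by
  intro σ hσ hΓ
  have hc := term_inst hσ t.fix
  refine ind _ hc (fun x hx => ⟨hc, fun π hπ => pole_fix hσ ?_⟩) x
  refine (h x _ (term_scons hc hσ) (scons_mem ⟨hc, fun ρ hρ => ?_⟩ hΓ)).2 π hπ
  obtain ⟨y, hy⟩ := Set.mem_iUnion.1 hρ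
  exact (hx y.1 y.2).2 ρ hy

/-! ### Case analysis on Church numerals -/

/-- The set `S` codes a sequence of falsity values indexed by `ω`: if f leads from the m-th truth
value to the next, the numeral of n leads from the 0-th to the n-th. Coding the sequence by a set
keeps the statement first-order. -/
theorem pole_iterate {f n t : V} (hf : 𝒜.Term f) (ht : IsChurch n t) (S : V)
    (hS : ∀ m ρ, opair m ρ ∈ᵥ S → 𝒜.Stack ρ)
    (hfS : ∀ m, IsNat m → ∀ y, y ∈ 𝒜.orth {ρ | opair m ρ ∈ᵥ S} → ∀ ρ,
      opair (succ m) ρ ∈ᵥ S → opair f (sCons y ρ) ∈ᵥ 𝒜.pole) (y : V)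
    (hy : y ∈ 𝒜.orth {ρ | opair emp ρ ∈ᵥ S}) (ρ : V) (hρ : opair n ρ ∈ᵥ S) :
    opair t (sCons f (sCons y ρ)) ∈ᵥ 𝒜.pole := by
  refine IsChurch.induction (fun n t => ∀ S, (∀ m ρ, opair m ρ ∈ᵥ S → 𝒜.Stack ρ) →
    (∀ m, IsNat m → ∀ y, y ∈ 𝒜.orth {ρ | opair m ρ ∈ᵥ S} → ∀ ρ,
      opair (succ m) ρ ∈ᵥ S → opair f (sCons y ρ) ∈ᵥ 𝒜.pole) →
    ∀ y, y ∈ 𝒜.orth {ρ | opair emp ρ ∈ᵥ S} → ∀ ρ, opair n ρ ∈ᵥ S →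
    opair t (sCons f (sCons y ρ)) ∈ᵥ 𝒜.pole) ?_ ?_ ht S hS hfS y hy ρ hρ
  · intro S hS hfS y hy ρ hρ
    have hσ : ∀ i : ℕ, 𝒜.Term ((fun _ => f : ℕ → V) i) := fun _ => hf
    rw [← churchZero_eq_inst fun _ => f]
    exact pole_grab hσ hf (pole_grab (term_scons hf hσ) hy.1 (hy.2 ρ hρ))
  · intro m s hm hs ih S hS hfS y hy ρ hρ
    have hsT : 𝒜.Term s := hs.isTerm
    have hσ : ∀ i : ℕ, 𝒜.Term ((fun _ => s : ℕ → V) i) := fun _ => hsT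
    rw [← churchSucc_eq_inst 0 fun _ => s]
    refine pole_grab hσ hf (pole_grab (term_scons hf hσ) hy.1 (pole_push (pole_push ?_)))
    obtain ⟨U, -, hp, -, hSU, hN, -⟩ := exists_universe 𝒜.A 𝒜.B emp
    -- The numeral of m + 1 maps f and y to (m f)(f y). The induction hypothesis is thus applied to
    -- the start f y and to the sequence shifted by one, which is why `S` and `y` vary in the
    -- induction.
    obtain ⟨S', hS'⟩ := exists_sep
      (fun p => ∃ k ρ, IsNat k ∧ p = opair k ρ ∧ opair (succ k) ρ ∈ᵥ S) U
    have key : ∀ k ρ, opair k ρ ∈ᵥ S' ↔ IsNat k ∧ opair (succ k) ρ ∈ᵥ S := by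
      intro k ρ
      rw [hS']
      constructor
      · rintro ⟨-, k', ρ', h1, h2, h3⟩
        obtain ⟨rfl, rfl⟩ := opair_inj.1 h2
        exact ⟨h1, h3⟩
      · exact fun h => ⟨hp _ _ (hN k h.1) (hSU ρ (hS _ _ h.2)), k, ρ, h.1, rfl, h.2⟩
    refine ih S' (fun k ρ h => hS _ _ ((key k ρ).1 h).2) ?_ (tApp f y) ?_ ρ
      ((key m ρ).2 ⟨hm, hρ⟩)
    · intro k hk z hz ρ hρ
      refine hfS (succ k) hk.succ z ⟨hz.1, fun ρ hρ => hz.2 ρ ((key k ρ).2 ⟨hk, hρ⟩)⟩ ρ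
        ((key _ _).1 hρ).2
    · refine ⟨IsTermAt.app hf hy.1, fun ρ hρ => pole_push ?_⟩
      exact hfS emp .zero y hy ρ ((key _ _).1 hρ).2

end RealizabilityAlgebra

/-- The step of the iteration computing a case analysis:
`λ y. λ a. λ b. y (b 0) (λ n. b (n + 1))`. -/
def Tm.caseStep : Tm :=
  .lam (.lam (.lam (.app (.app (.var 2) (.app (.var 0) (.lam (.lam (.var 0)))))
    (.lam (.app (.var 1)
      (.lam (.lam (.app (.app (.var 2) (.var 1)) (.app (.var 1) (.var 0))))))))))

/-- `λ n. n caseStep (λ a. λ b. a)`. -/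
def Tm.caseOp : Tm := .lam (.app (.app (.var 0) caseStep) (.lam (.lam (.var 1))))

/-- Case analysis: `t₀` if `n` is zero, and `t₁` with the predecessor for the variable `0`
otherwise. -/
def Tm.caseOf (n t₀ t₁ : Tm) : Tm := .app (.app (.app caseOp n) t₀) (.lam t₁)

namespace RealizabilityAlgebra

variable {V : Type u} [ZFModel V] {𝒜 : RealizabilityAlgebra V}

variable (𝒜) in
/-- The stacks `a · b · π` such that `a ⋆ π` is in the pole if `n = 0`, and `b ⋆ m · π` is if
`n = m + 1`. -/
def caseF (n π : V) : Set V :=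
  arr (𝒜.orth (⋃ _ : n = emp, {π}))
    (arr (𝒜.orth (⋃ m : {m // n = succ m}, arr (Ch m.1) {π})) {π})

theorem mem_caseF {n π ρ : V} : ρ ∈ 𝒜.caseF n π ↔ ∃ a b, 𝒜.Term a ∧ 𝒜.Term b ∧
    (n = emp → opair a π ∈ᵥ 𝒜.pole) ∧
    (∀ m t, n = succ m → IsChurch m t → opair b (sCons t π) ∈ᵥ 𝒜.pole) ∧
    ρ = sCons a (sCons b π) := by
  constructor
  · rintro ⟨a, ha, _, ⟨b, hb, _, rfl, rfl⟩, rfl⟩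
    exact ⟨a, b, ha.1, hb.1, fun h => ha.2 _ (Set.mem_iUnion.2 ⟨h, rfl⟩),
      fun m t h ht => hb.2 _ (Set.mem_iUnion.2 ⟨⟨m, h⟩, t, ht, _, rfl, rfl⟩), rfl⟩
  · rintro ⟨a, b, ha, hb, h0, hs, rfl⟩
    refine ⟨a, ⟨ha, fun ρ hρ => ?_⟩, _, ⟨b, ⟨hb, fun ρ hρ => ?_⟩, π, rfl, rfl⟩, rfl⟩
    · obtain ⟨h, rfl⟩ := Set.mem_iUnion.1 hρ
      exact h0 h
    · obtain ⟨⟨m, h⟩, t, ht, _, rfl, rfl⟩ := Set.mem_iUnion.1 hρ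
      exact hs m t h ht

/-- To decide m + 1 with branches a and b, the decision for m is called: its zero branch is b 0, and
its successor branch sends the predecessor k to b (k + 1). Branch a is discarded. -/
theorem judge_caseStep {m π : V} {Γ : List (Set V)} (hπ : 𝒜.Stack π) : 𝒜.Judge Γ Tm.caseStep
    (𝒜.orth (arr (𝒜.orth (⋃ π : {π // 𝒜.Stack π}, 𝒜.caseF m π)) (𝒜.caseF (succ m) π))) := by
  have hy : 𝒜.Judge (𝒜.orth (⋃ k : {k // succ m = succ k}, arr (Ch k.1) {π}) ::
      𝒜.orth (⋃ _ : succ m = emp, {π}) ::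
      𝒜.orth (⋃ π : {π // 𝒜.Stack π}, 𝒜.caseF m π.1) :: Γ) (.var 2) (𝒜.orth (𝒜.caseF m π)) :=
    .all_elim (F := fun π : {π // 𝒜.Stack π} => 𝒜.caseF m π.1) (.var 2 rfl) ⟨π, hπ⟩
  refine .lam (.lam (.lam (.app (.app hy (.all_intro fun h => ?_)) (.all_intro fun k => ?_))))
  · subst h
    exact .app (.all_elim (F := fun k : {k // succ emp = succ k} => arr (Ch k.1) {π}) (.var 0 rfl)
      ⟨emp, rfl⟩) .church_zero
  · obtain ⟨k, rfl⟩ := k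
    refine .lamCh ?_
    by_cases hk : IsNat k
    · exact .app (.all_elim (F := fun j : {j // succ (succ k) = succ j} => arr (Ch j.1) {π})
        (.var 1 rfl) ⟨succ k, rfl⟩) (.church_succ (i := 0) hk rfl)
    -- If k is not a natural number it has no numeral, and the case is void.
    · exact fun σ _ hΓ => absurd (IsChurch.isNat (hΓ 0 _ rfl)) hk

instance dfn_caseF {n : ℕ} {f g k : (Fin n → V) → V} [DfnFun f] [DfnFun g] [DfnFun k] :
    Dfn (fun v => f v ∈ 𝒜.caseF (g v) (k v)) :=
  Dfn.of3 (R := fun ρ n π => ρ ∈ 𝒜.caseF n π) (by simp only [mem_caseF]; infer_instance)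

theorem judge_caseOp {n π : V} {Γ : List (Set V)} (hπ : 𝒜.Stack π) :
    𝒜.Judge Γ Tm.caseOp (𝒜.orth (arr (Ch n) (𝒜.caseF n π))) := by
  refine .lamCh fun σ hσ hΓ => ⟨term_inst hσ _, fun ρ hρ => pole_push (pole_push ?_)⟩
  have ht : IsChurch n (σ 0) := hΓ 0 _ rfl
  have hstack : ∀ {n π ρ}, 𝒜.Stack π → ρ ∈ 𝒜.caseF n π → 𝒜.Stack ρ := by
    intro n π ρ hπ h
    obtain ⟨a, b, ha, hb, -, -, rfl⟩ := mem_caseF.1 h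
    exact .cons ha (.cons hb hπ)
  obtain ⟨U, -, hp, -, hSU, hN, -⟩ := exists_universe 𝒜.A 𝒜.B emp
  -- The sequence of falsity values for the iteration: at n, the union of `caseF n π` over all
  -- stacks π.
  obtain ⟨S, hS⟩ := exists_sep (fun p => ∃ n ρ π, IsNat n ∧ 𝒜.Stack π ∧ p = opair n ρ ∧
    ρ ∈ 𝒜.caseF n π) U
  have key : ∀ n ρ, opair n ρ ∈ᵥ S ↔ IsNat n ∧ ∃ π, 𝒜.Stack π ∧ ρ ∈ 𝒜.caseF n π := by
    intro n ρ
    rw [hS]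
    constructor
    · rintro ⟨-, n', ρ', π, h1, h2, h3, h4⟩
      obtain ⟨rfl, rfl⟩ := opair_inj.1 h3
      exact ⟨h1, π, h2, h4⟩
    · rintro ⟨h1, π, h2, h3⟩
      exact ⟨hp _ _ (hN n h1) (hSU _ (hstack h2 h3)), n, ρ, π, h1, h2, rfl, h3⟩
  have hall : ∀ m, IsNat m → {ρ | opair m ρ ∈ᵥ S} = ⋃ π : {π // 𝒜.Stack π}, 𝒜.caseF m π.1 := by
    intro m hm
    ext ρ
    simp [key, hm]
  refine pole_iterate (term_inst hσ _) ht S ?_ ?_ _ ?_ ρ ((key n ρ).2 ⟨ht.isNat, π, hπ, hρ⟩)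
  · intro m ρ h
    obtain ⟨-, π, hπ, h⟩ := (key m ρ).1 h
    exact hstack hπ h
  · intro m hm y hy ρ hρ
    obtain ⟨-, π, hπ, hρ⟩ := (key _ ρ).1 hρ
    rw [hall m hm] at hy
    exact (judge_caseStep (Γ := []) hπ σ hσ (by simp)).2 _ ⟨y, hy, ρ, hρ, rfl⟩
  · rw [hall emp .zero]
    have : 𝒜.Judge [] (.lam (.lam (.var 1)))
        (𝒜.orth (⋃ π : {π // 𝒜.Stack π}, 𝒜.caseF emp π.1)) :=
      .all_intro fun π => .lam (.lam (.all_elim (F := fun _ : (emp : V) = emp => {π.1})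
        (.var 1 rfl) rfl))
    exact this σ hσ (by simp)

/-- Each stack of `F` is treated separately, with its singleton as the common falsity value of the
two branches. Only the branch that applies has to be typed. -/
theorem Judge.caseOf {Γ : List (Set V)} {t t₀ t₁ : Tm} {n : V} {F : Set V}
    (hF : ∀ π ∈ F, 𝒜.Stack π) (h : 𝒜.Judge Γ t (Ch n))
    (h₀ : n = emp → 𝒜.Judge Γ t₀ (𝒜.orth F))
    (h₁ : ∀ m, n = succ m → 𝒜.Judge (Ch m :: Γ) t₁ (𝒜.orth F)) :
    𝒜.Judge Γ (.caseOf t t₀ t₁) (𝒜.orth F) := by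
  refine .orth_intro fun π hπ => ⟨{π}, rfl, ?_⟩
  have hπF : {π} ⊆ F := by simpa using hπ
  exact .app (.app (.app (judge_caseOp (hF π hπ)) h) (.all_intro fun e => (h₀ e).anti hπF))
    (.all_intro fun ⟨m, e⟩ => .lamCh ((h₁ m e).anti hπF))

end RealizabilityAlgebra

/-! ### Realizers for extensional inclusion and membership -/

namespace Tm

/-- A realizer of `a ⊆ a`. -/
def refl : Tm := fix (.lam (.app (.app (.var 0) (.var 1)) (.var 1)))

/-- A realizer of `a ⊆ b → b ⊆ c → a ⊆ c`. -/
def trans : Tm := fix (.lam (.lam (.lam (.app (.var 2) (.lam (.lam (.app (.var 3) (.lam (.lam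
  (.app (.app (.var 4) (.app (.app (.var 7) (.var 3)) (.var 1)))
    (.app (.app (.var 7) (.var 0)) (.var 2))))))))))))

/-- A realizer of `a ∉ a`. -/
def irrefl : Tm := fix (.lam (.lam (.app (.var 1) (.var 2))))

/-- A realizer of `a ⊆ b → x ∉ b → x ∉ a`. -/
def subNMem : Tm := .lam (.lam (.lam (.lam (.app (.var 3) (.lam (.lam
  (.app (.app (.var 4) (.app (.app trans (.var 3)) (.var 1)))
    (.app (.app trans (.var 0)) (.var 2)))))))))

end Tm

namespace RealizabilityAlgebra

variable {V : Type u} [ZFModel V] {𝒜 : RealizabilityAlgebra V}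

/-! ### Extensional set theory -/

variable (𝒜) in
/-- The truth value of `a ⊆ b`. -/
def Sub (a b : 𝒜.Name) : Set V := 𝒜.orth (𝒜.falsSub a.1 b.1)

variable (𝒜) in
/-- The truth value of `a ∉ b`. -/
def NMem (a b : 𝒜.Name) : Set V := 𝒜.orth (𝒜.falsNotMem a.1 b.1)

variable (𝒜) in
/-- The relation `c ∈ dom a` between names. -/
def Dom (a c : 𝒜.Name) : Prop := 𝒜.InDom a.1 c.1

instance dfn_falsSub {n : ℕ} {f g k : (Fin n → V) → V} [DfnFun f] [DfnFun g] [DfnFun k] :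
    Dfn (fun v => f v ∈ 𝒜.falsSub (g v) (k v)) :=
  Dfn.of3 (R := fun π a b => π ∈ 𝒜.falsSub a b) (by
    show Dfn fun v : Fin 3 → V => ∃ X Fs Fn, 𝒜.FalsityOn X Fs Fn ∧ v 1 ∈ᵥ X ∧ v 2 ∈ᵥ X ∧
      opair (opair (v 1) (v 2)) (v 0) ∈ᵥ Fs
    infer_instance)

section Rules

variable {Γ : List (Set V)} {t s r : Tm} {F : Set V} {a b c : 𝒜.Name}

theorem exists_arr_of_mem_falsSub {ρ : V} (h : ρ ∈ 𝒜.falsSub a.1 b.1) :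
    ∃ c : 𝒜.Name, 𝒜.Dom a c ∧ ρ ∈ arr (𝒜.NMem c b) (epsF a.1 c.1) := by
  obtain ⟨c, t, σ, hc, ht, rfl⟩ := (mem_falsSub a.2 b.2).1 h
  exact ⟨⟨c, (a.2.mem hc).1⟩, ⟨σ, (a.2.mem hc).2, hc⟩, t, ht, σ, hc, rfl⟩

theorem exists_arr_of_mem_falsNotMem {ρ : V} (h : ρ ∈ 𝒜.falsNotMem a.1 b.1) :
    ∃ c : 𝒜.Name, 𝒜.Dom b c ∧
      ρ ∈ arr (𝒜.Sub a c) (arr (𝒜.Sub c a) (epsF b.1 c.1)) := by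
  obtain ⟨c, t, t', σ, hc, ht, ht', rfl⟩ := (mem_falsNotMem a.2 b.2).1 h
  exact ⟨⟨c, (b.2.mem hc).1⟩, ⟨σ, (b.2.mem hc).2, hc⟩, t, ht, _, ⟨t', ht', σ, hc, rfl⟩, rfl⟩

theorem Judge.sub_intro
    (h : ∀ c, 𝒜.Dom a c → 𝒜.Judge (𝒜.NMem c b :: Γ) t (𝒜.orth (epsF a.1 c.1))) :
    𝒜.Judge Γ (.lam t) (𝒜.Sub a b) := .orth_intro fun _ hρ =>
  let ⟨c, hc, hρ⟩ := exists_arr_of_mem_falsSub hρ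
  ⟨_, hρ, .lam (h c hc)⟩

theorem Judge.sub_elim (h : 𝒜.Judge Γ t (𝒜.Sub a b)) (h' : 𝒜.Judge Γ s (𝒜.NMem c b)) :
    𝒜.Judge Γ (.app t s) (𝒜.orth (epsF a.1 c.1)) := by
  refine .app (Judge.anti h ?_) h'
  rintro _ ⟨t, ht, π, hπ, rfl⟩
  exact (mem_falsSub a.2 b.2).2 ⟨c.1, t, π, hπ, ht, rfl⟩

theorem Judge.nmem_intro (h : ∀ c, 𝒜.Dom b c →
      𝒜.Judge (𝒜.Sub c a :: 𝒜.Sub a c :: Γ) t (𝒜.orth (epsF b.1 c.1))) :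
    𝒜.Judge Γ (.lam (.lam t)) (𝒜.NMem a b) := .orth_intro fun _ hρ =>
  let ⟨c, hc, hρ⟩ := exists_arr_of_mem_falsNotMem hρ
  ⟨_, hρ, .lam (.lam (h c hc))⟩

theorem Judge.nmem_elim (h : 𝒜.Judge Γ t (𝒜.NMem a b)) (h₁ : 𝒜.Judge Γ s (𝒜.Sub a c))
    (h₂ : 𝒜.Judge Γ r (𝒜.Sub c a)) :
    𝒜.Judge Γ (.app (.app t s) r) (𝒜.orth (epsF b.1 c.1)) := by
  refine .app (.app (X := 𝒜.Sub a c) (Judge.anti h ?_) h₁) h₂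
  rintro _ ⟨t, ht, _, ⟨t', ht', π, hπ, rfl⟩, rfl⟩
  exact (mem_falsNotMem a.2 b.2).2 ⟨c.1, t, t', π, hπ, ht, ht', rfl⟩

end Rules

/-- An element c of dom a belongs to a because c ⊆ c, which is available recursively and used in
both directions. -/
theorem judge_refl {Γ : List (Set V)} (a : 𝒜.Name) : 𝒜.Judge Γ .refl (𝒜.Sub a a) := by
  refine .fix (G := fun a : 𝒜.Name => 𝒜.falsSub a.1 a.1) (R := fun c a => 𝒜.Dom a c)
    (fun t ht ih a => ?_) (fun a => ?_) a
  · obtain ⟨a, ha⟩ := a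
    refine IsName.induction (𝒜 := 𝒜) (fun a => t ∈ 𝒜.orth (𝒜.falsSub a a)) ?_ ha
    exact fun a ha ih' => ih ⟨a, ha⟩ fun c hc => ih' c.1 hc
  · refine .sub_intro fun c hc => ?_
    have ih : 𝒜.Judge (𝒜.NMem c a :: 𝒜.orth (⋃ y : {y // 𝒜.Dom a y}, 𝒜.falsSub y.1.1 y.1.1) :: Γ)
        (.var 1) (𝒜.Sub c c) :=
      .all_elim (F := fun y : {y // 𝒜.Dom a y} => 𝒜.falsSub y.1.1 y.1.1) (.var 1 rfl) ⟨c, hc⟩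
    exact .nmem_elim (.var 0 rfl) ih ih

variable (𝒜) in
/-- The falsity value of `a ⊆ b → b ⊆ c → a ⊆ c`. -/
def transF (a b c : V) : Set V :=
  arr (𝒜.orth (𝒜.falsSub a b)) (arr (𝒜.orth (𝒜.falsSub b c)) (𝒜.falsSub a c))

instance dfn_transF {n : ℕ} {f g k l : (Fin n → V) → V} [DfnFun f] [DfnFun g] [DfnFun k]
    [DfnFun l] : Dfn (fun v => f v ∈ 𝒜.orth (𝒜.transF (g v) (k v) (l v))) :=
  Dfn.of4 (R := fun t a b c => t ∈ 𝒜.orth (𝒜.transF a b c)) (by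
    show Dfn fun v : Fin 4 → V => v 0 ∈ 𝒜.orth {ρ | ∃ s, s ∈ 𝒜.orth (𝒜.falsSub (v 1) (v 2)) ∧
      ∃ ρ', (∃ r, r ∈ 𝒜.orth (𝒜.falsSub (v 2) (v 3)) ∧
        ∃ π, π ∈ 𝒜.falsSub (v 1) (v 3) ∧ ρ' = sCons r π) ∧ ρ = sCons s ρ'}
    infer_instance)

theorem judge_trans {Γ : List (Set V)} (a b c : 𝒜.Name) :
    𝒜.Judge Γ .trans (𝒜.orth (𝒜.transF a.1 b.1 c.1)) := by
  let G : 𝒜.Name × 𝒜.Name × 𝒜.Name → Set V := fun p => 𝒜.transF p.1.1 p.2.1.1 p.2.2.1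
  let R : 𝒜.Name × 𝒜.Name × 𝒜.Name → 𝒜.Name × 𝒜.Name × 𝒜.Name → Prop := fun p q =>
    𝒜.Dom q.2.1 p.2.1 ∧
      (𝒜.Dom q.1 p.1 ∧ 𝒜.Dom q.2.2 p.2.2 ∨ 𝒜.Dom q.1 p.2.2 ∧ 𝒜.Dom q.2.2 p.1)
  refine .fix (G := G) (R := R) (fun t ht ih p => ?_) (fun p => ?_) (a, b, c)
  · obtain ⟨⟨a, ha⟩, ⟨b, hb⟩, ⟨c, hc⟩⟩ := p
    refine (IsName.induction (𝒜 := 𝒜) (fun a => ∀ b, 𝒜.IsName b → ∀ c, 𝒜.IsName c →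
        t ∈ 𝒜.orth (𝒜.transF a b c) ∧ t ∈ 𝒜.orth (𝒜.transF c b a)) ?_ ha b hb c hc).1
    intro a ha ih' b hb c hc
    constructor
    · refine ih (⟨a, ha⟩, ⟨b, hb⟩, ⟨c, hc⟩) ?_
      rintro ⟨x, d, e⟩ ⟨-, ⟨hx, -⟩ | ⟨he, -⟩⟩
      · exact (ih' x.1 hx d.1 d.2 e.1 e.2).1
      · exact (ih' e.1 he d.1 d.2 x.1 x.2).2
    · refine ih (⟨c, hc⟩, ⟨b, hb⟩, ⟨a, ha⟩) ?_
      rintro ⟨x, d, e⟩ ⟨-, ⟨-, he⟩ | ⟨-, hx⟩⟩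
      · exact (ih' e.1 he d.1 d.2 x.1 x.2).2
      · exact (ih' x.1 hx d.1 d.2 e.1 e.2).1
  · obtain ⟨a, b, c⟩ := p
    refine .lam (.lam (.sub_intro fun x hx => .sub_elim (b := b) (.var 2 rfl)
      (.nmem_intro fun d hd => .sub_elim (b := c) (.var 3 rfl) (.nmem_intro fun e he => ?_))))
    refine .nmem_elim (a := x) (.var 4 rfl)
      (.app (.app (.all_elim (F := fun p : {p // R p (a, b, c)} => G p.1) (.var 7 rfl)
        ⟨(x, d, e), hd, Or.inl ⟨hx, he⟩⟩) (.var 3 rfl)) (.var 1 rfl))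
      (.app (.app (.all_elim (F := fun p : {p // R p (a, b, c)} => G p.1) (.var 7 rfl)
        ⟨(e, d, x), hd, Or.inr ⟨hx, he⟩⟩) (.var 0 rfl)) (.var 2 rfl))

/-- If a ≃ c with c in dom a, then a ⊆ c would turn this c into an element of c, which the recursive
call refutes. -/
theorem judge_irrefl {Γ : List (Set V)} (a : 𝒜.Name) : 𝒜.Judge Γ .irrefl (𝒜.NMem a a) := by
  refine .fix (G := fun a : 𝒜.Name => 𝒜.falsNotMem a.1 a.1) (R := fun c a => 𝒜.Dom a c)
    (fun t ht ih a => ?_) (fun a => ?_) a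
  · obtain ⟨a, ha⟩ := a
    refine IsName.induction (𝒜 := 𝒜) (fun a => t ∈ 𝒜.orth (𝒜.falsNotMem a a)) ?_ ha
    exact fun a ha ih' => ih ⟨a, ha⟩ fun c hc => ih' c.1 hc
  · refine .nmem_intro fun c hc => .sub_elim (b := c) (.var 1 rfl) ?_
    exact .all_elim (F := fun y : {y // 𝒜.Dom a y} => 𝒜.falsNotMem y.1.1 y.1.1)
      (.var 2 rfl) ⟨c, hc⟩

section

variable {Γ : List (Set V)} {t s : Tm} {a b c x : 𝒜.Name}

theorem Judge.trans (h : 𝒜.Judge Γ t (𝒜.Sub a b)) (h' : 𝒜.Judge Γ s (𝒜.Sub b c)) :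
    𝒜.Judge Γ (.app (.app .trans t) s) (𝒜.Sub a c) := .app (.app (judge_trans a b c) h) h'

/-- `a ⊆ b → x ∉ b → x ∉ a` -/
theorem judge_subNMem : 𝒜.Judge Γ .subNMem
    (𝒜.orth (arr (𝒜.Sub a b) (arr (𝒜.NMem x b) (𝒜.falsNotMem x.1 a.1)))) :=
  .lam (.lam (.nmem_intro fun _ _ => .sub_elim (b := b) (.var 3 rfl) (.nmem_intro fun _ _ =>
    .nmem_elim (a := x) (.var 4 rfl) (.trans (.var 3 rfl) (.var 1 rfl))
      (.trans (.var 0 rfl) (.var 2 rfl)))))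

theorem Judge.subNMem (h : 𝒜.Judge Γ t (𝒜.Sub a b)) (h' : 𝒜.Judge Γ s (𝒜.NMem x b)) :
    𝒜.Judge Γ (.app (.app .subNMem t) s) (𝒜.NMem x a) := .app (.app judge_subNMem h) h'

end

end RealizabilityAlgebra

/-! ### Realizers for numerals, hat names and the search -/

namespace Tm

/-- The Church numeral `0`. -/
def zero : Tm := .lam (.lam (.var 0))

/-- The successor of the Church numeral given by the variable `i`. -/
def succVar (i : ℕ) : Tm :=
  .lam (.lam (.app (.app (.var (i + 2)) (.var 1)) (.app (.var 1) (.var 0))))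

/-- A realizer of `m̂ ∈ n̂ ⊆ ω̂` for `m ∈ n`, and of the inclusions between these names. -/
def incl : Tm := .lam (.lam (.app (.app (.app (.var 1) refl) refl) (.var 0)))

/-- `λ j. λ k. λ a. λ b. if j < k then a else b`, for Church numerals `j` and `k`. -/
def less : Tm := fix (.lam (.lam (.lam (.lam (.caseOf (.var 2) (.var 0) (.caseOf (.var 4) (.var 2)
  (.app (.app (.app (.app (.var 6) (.var 0)) (.var 1)) (.var 3)) (.var 2))))))))

/-- For `m ∈ ω`, a realizer of `m̂ ∉ ω̂ → ⊥` from a Church numeral that is at most `m`: it searches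
for `m` from there on. -/
def searchFrom : Tm := fix (.lam (.lam (.app (.app (.app (.var 1)
  (.lam (.lam (.app (.app (.app (.app less (.var 0)) (.var 2))
    (.app (.app (.app (.var 1) refl) refl) (.var 0)))
    (.app (.app (.var 4) (.var 3)) (succVar 2)))))) incl) (.var 0))))

end Tm

namespace RealizabilityAlgebra

variable {V : Type u} [ZFModel V] {𝒜 : RealizabilityAlgebra V}

/-! ### Comparison of Church numerals -/

variable (𝒜) in
/-- The stacks `j · k · a · b · π` such that `a ⋆ π` is in the pole if `j < k`, and `b ⋆ π` is
otherwise. -/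
def lessF (j k π : V) : Set V :=
  arr (Ch j) (arr (Ch k) (arr (𝒜.orth (⋃ _ : j ∈ᵥ k, {π}))
    (arr (𝒜.orth (⋃ _ : ¬ j ∈ᵥ k, {π})) {π})))

theorem mem_lessF {j k π ρ : V} : ρ ∈ 𝒜.lessF j k π ↔ ∃ t s a b, IsChurch j t ∧ IsChurch k s ∧
    𝒜.Term a ∧ 𝒜.Term b ∧ (j ∈ᵥ k → opair a π ∈ᵥ 𝒜.pole) ∧ (¬ j ∈ᵥ k → opair b π ∈ᵥ 𝒜.pole) ∧
    ρ = sCons t (sCons s (sCons a (sCons b π))) := by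
  constructor
  · rintro ⟨t, ht, _, ⟨s, hs, _, ⟨a, ha, _, ⟨b, hb, _, rfl, rfl⟩, rfl⟩, rfl⟩, rfl⟩
    exact ⟨t, s, a, b, ht, hs, ha.1, hb.1, fun h => ha.2 _ (Set.mem_iUnion.2 ⟨h, rfl⟩),
      fun h => hb.2 _ (Set.mem_iUnion.2 ⟨h, rfl⟩), rfl⟩
  · rintro ⟨t, s, a, b, ht, hs, ha, hb, h1, h2, rfl⟩
    refine ⟨t, ht, _, ⟨s, hs, _, ⟨a, ⟨ha, fun ρ hρ => ?_⟩, _, ⟨b, ⟨hb, fun ρ hρ => ?_⟩, π, rfl,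
      rfl⟩, rfl⟩, rfl⟩, rfl⟩
    · obtain ⟨h, rfl⟩ := Set.mem_iUnion.1 hρ
      exact h1 h
    · obtain ⟨h, rfl⟩ := Set.mem_iUnion.1 hρ
      exact h2 h

instance dfn_lessF {n : ℕ} {f g k l : (Fin n → V) → V} [DfnFun f] [DfnFun g] [DfnFun k]
    [DfnFun l] : Dfn (fun v => f v ∈ 𝒜.lessF (g v) (k v) (l v)) :=
  Dfn.of4 (R := fun ρ j k π => ρ ∈ 𝒜.lessF j k π) (by simp only [mem_lessF]; infer_instance)

instance dfn_orth_lessF {n : ℕ} {f g k l : (Fin n → V) → V} [DfnFun f] [DfnFun g] [DfnFun k]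
    [DfnFun l] : Dfn (fun v => f v ∈ 𝒜.orth (𝒜.lessF (g v) (k v) (l v))) :=
  Dfn.of4 (R := fun ρ j k π => ρ ∈ 𝒜.orth (𝒜.lessF j k π)) (by
    show Dfn fun v : Fin 4 → V => v 0 ∈ 𝒜.orth {ρ | ρ ∈ 𝒜.lessF (v 1) (v 2) (v 3)}
    infer_instance)

/-- Both arguments are decreased together. The induction is on k for all j, and k is tested first so
that k = 0 answers negatively whatever j is. -/
theorem judge_less {Γ : List (Set V)} {j k π : V} (hj : IsNat j) (hk : IsNat k)
    (hπ : 𝒜.Stack π) : 𝒜.Judge Γ .less (𝒜.orth (𝒜.lessF j k π)) := by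
  let N := {n : V // IsNat n}
  let G : N × N → Set V := fun p => 𝒜.lessF p.1.1 p.2.1 π
  let R : N × N → N × N → Prop := fun p q => q.2.1 = succ p.2.1
  have hS : ∀ ρ ∈ ({π} : Set V), 𝒜.Stack ρ := by rintro _ rfl; exact hπ
  refine .fix (G := G) (R := R) (fun t ht ih p => ?_) (fun p => ?_) (⟨j, hj⟩, ⟨k, hk⟩)
  · obtain ⟨⟨j, hj⟩, ⟨k, hk⟩⟩ := p
    refine IsNat.induction (fun k => ∀ j, IsNat j → t ∈ 𝒜.orth (𝒜.lessF j k π)) ?_ ?_ hk j hj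
    · exact fun j hj => ih (⟨j, hj⟩, ⟨emp, .zero⟩) fun q hq => absurd hq.symm (succ_ne_emp _)
    · intro k hk ih' j hj
      refine ih (⟨j, hj⟩, ⟨succ k, hk.succ⟩) fun q hq => ?_
      have : q.2.1 = k := (succ_inj.1 hq).symm
      show t ∈ 𝒜.orth (𝒜.lessF q.1.1 q.2.1 π)
      rw [this]
      exact ih' _ q.1.2
  · obtain ⟨⟨j, hj⟩, ⟨k, hk⟩⟩ := p
    refine .lamCh (.lamCh (.lam (.lam (.caseOf hS (.var 2 rfl) (fun h => ?_) fun k' h => ?_))))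
    · exact .all_elim (F := fun _ : ¬ j ∈ᵥ k => {π}) (.var 0 rfl) (by simp [show k = emp from h])
    · obtain rfl : k = succ k' := h
      have hk' : IsNat k' := hk.of_mem (by simp)
      refine .caseOf hS (.var 4 rfl) (fun h => ?_) fun j' h => ?_
      · refine .all_elim (F := fun _ : j ∈ᵥ succ k' => {π}) (.var 2 rfl) ?_
        rw [show j = emp from h]
        exact hk'.emp_mem_succ
      · obtain rfl : j = succ j' := h
        -- The two comparisons are equivalent, so the branches are passed unchanged to the recursive
        -- call.
        have e : (succ j' ∈ᵥ succ k') = (j' ∈ᵥ k') := propext hk'.succ_mem_succ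
        have hj' : IsNat j' := hj.of_mem (by simp)
        refine .app (.app (.app (.app (.all_elim (F := fun p : {p // R p (⟨_, hj⟩, ⟨_, hk⟩)} =>
          G p.1) (.var 6 rfl) ⟨(⟨j', hj'⟩, ⟨k', hk'⟩), rfl⟩) (.var 0 rfl)) (.var 1 rfl))
          (.var 3 ?_)) (.var 2 ?_)
        · simp only [e]; rfl
        · simp only [e]; rfl

theorem Judge.less {Γ : List (Set V)} {r s t₁ t₂ : Tm} {j k : V} (hj : IsNat j) (hk : IsNat k)
    (hr : 𝒜.Judge Γ r (Ch j)) (hs : 𝒜.Judge Γ s (Ch k))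
    (h₁ : j ∈ᵥ k → 𝒜.Judge Γ t₁ (𝒜.orth 𝒜.botF)) (h₂ : ¬ j ∈ᵥ k → 𝒜.Judge Γ t₂ (𝒜.orth 𝒜.botF)) :
    𝒜.Judge Γ (.app (.app (.app (.app .less r) s) t₁) t₂) (𝒜.orth 𝒜.botF) := by
  refine .orth_intro fun π hπ => ⟨{π}, rfl, ?_⟩
  have hπF : {π} ⊆ 𝒜.botF := by simpa using hπ
  exact .app (.app (.app (.app (judge_less hj hk hπ) hr) hs)
    (.all_intro fun e => (h₁ e).anti hπF)) (.all_intro fun e => (h₂ e).anti hπF)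

/-! ### The names `n̂` and `ω̂` -/

/-- The elements of the name `a` are the pairs `(m̂, ν_m · π)` for the `m` with property `D`. -/
structure HatLike (hat : V → 𝒜.Name) (a : 𝒜.Name) (D : V → Prop) : Prop where
  mem_iff : ∀ c π, opair c π ∈ᵥ a.1 ↔ ∃ m, D m ∧ c = (hat m).1 ∧
    ∃ t ρ, IsChurch m t ∧ 𝒜.Stack ρ ∧ π = sCons t ρ

section HatLike

variable {hat : V → 𝒜.Name} {a b x : 𝒜.Name} {D D' : V → Prop} {Γ : List (Set V)}
  {t s r p : Tm} {m : V}

theorem HatLike.exists_of_mem_epsF (H : HatLike hat a D) {c ρ : V} (h : ρ ∈ epsF a.1 c) :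
    ∃ m, D m ∧ c = (hat m).1 ∧ ρ ∈ arr (Ch m) 𝒜.botF := by
  obtain ⟨m, hm, hc, t, ρ, ht, hρ, rfl⟩ := (H.mem_iff c _).1 h
  exact ⟨m, hm, hc, t, ht, ρ, hρ, rfl⟩

theorem HatLike.subset_epsF (H : HatLike hat a D) (hm : D m) :
    arr (Ch m) 𝒜.botF ⊆ epsF a.1 (hat m).1 := by
  rintro _ ⟨t, ht, ρ, hρ, rfl⟩
  exact (H.mem_iff _ _).2 ⟨m, hm, rfl, t, ρ, ht, hρ, rfl⟩

theorem HatLike.sub_intro (H : HatLike hat a D) (h : ∀ m, D m →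
      𝒜.Judge (Ch m :: 𝒜.NMem (hat m) b :: Γ) t (𝒜.orth 𝒜.botF)) :
    𝒜.Judge Γ (.lam (.lam t)) (𝒜.Sub a b) := by
  refine .sub_intro fun c hc => .orth_intro fun ρ hρ => ?_
  obtain ⟨m, hm, hc, hρ'⟩ := H.exists_of_mem_epsF hρ
  obtain rfl : c = hat m := Subtype.ext hc
  exact ⟨_, hρ', .lamCh (h m hm)⟩

theorem HatLike.sub_elim (H : HatLike hat a D) (hm : D m) (h : 𝒜.Judge Γ t (𝒜.Sub a b))
    (h₁ : 𝒜.Judge Γ s (𝒜.NMem (hat m) b)) (h₂ : 𝒜.Judge Γ r (Ch m)) :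
    𝒜.Judge Γ (.app (.app t s) r) (𝒜.orth 𝒜.botF) :=
  .app ((h.sub_elim h₁).anti (H.subset_epsF hm)) h₂

theorem HatLike.nmem_intro (H : HatLike hat a D) (h : ∀ m, D m →
      𝒜.Judge (Ch m :: 𝒜.Sub (hat m) x :: 𝒜.Sub x (hat m) :: Γ) t (𝒜.orth 𝒜.botF)) :
    𝒜.Judge Γ (.lam (.lam (.lam t))) (𝒜.NMem x a) := by
  refine .nmem_intro fun c hc => .orth_intro fun ρ hρ => ?_
  obtain ⟨m, hm, hc, hρ'⟩ := H.exists_of_mem_epsF hρ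
  obtain rfl : c = hat m := Subtype.ext hc
  exact ⟨_, hρ', .lamCh (h m hm)⟩

theorem HatLike.nmem_elim (H : HatLike hat a D) (hm : D m) (h : 𝒜.Judge Γ t (𝒜.NMem x a))
    (h₁ : 𝒜.Judge Γ s (𝒜.Sub x (hat m))) (h₂ : 𝒜.Judge Γ r (𝒜.Sub (hat m) x))
    (h₃ : 𝒜.Judge Γ p (Ch m)) :
    𝒜.Judge Γ (.app (.app (.app t s) r) p) (𝒜.orth 𝒜.botF) :=
  .app ((h.nmem_elim h₁ h₂).anti (H.subset_epsF hm)) h₃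

theorem HatLike.judge_incl (H : HatLike hat a D) (H' : HatLike hat b D')
    (hD : ∀ m, D m → D' m) : 𝒜.Judge Γ .incl (𝒜.Sub a b) :=
  H.sub_intro fun m hm => H'.nmem_elim (hD m hm) (.var 1 rfl) (judge_refl _) (judge_refl _)
    (.var 0 rfl)

/-! ### Unbounded search -/

/-- Ordinary induction on n proves that P n implies P k for all k ≤ n, as long as n ≤ m. At n = m
the premise P m comes from `step`, whose hypothesis is void there. -/
theorem nat_downward_induction {m : V} (hm : IsNat m) (P : V → Prop)
    [Dfn (fun v : Fin 1 → V => P (v 0))]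
    (step : ∀ k, k ∈ᵥ succ m → (k ∈ᵥ m → P (succ k)) → P k) {k : V} (hk : k ∈ᵥ succ m) : P k := by
  have : ∀ {n : ℕ} (i : Fin n), Dfn (fun w : Fin n → V => P (w i)) := fun i =>
    Dfn.of1 (R := P) inferInstance
  refine IsNat.induction (fun n => n ∈ᵥ succ m → P n → ∀ k, k ∈ᵥ succ n → P k) ?_ ?_ hm
    (by simp) (step m (by simp) fun h => absurd h (not_mem_self m)) k hk
  · intro _ h0 k hk
    obtain rfl : k = emp := by simpa using hk
    exact h0
  · intro n hn ih hnm hPn k hk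
    have hnm' := hm.succ_mem_succ.1 hnm
    rcases mem_succ.1 hk with hk | rfl
    · exact ih (mem_succ.2 (Or.inl hnm')) (step n (mem_succ.2 (Or.inl hnm')) fun _ => hPn) k hk
    · exact hPn

/-- The element offered to the realizer of m̂ ∉ ω̂ is k̂, with an inclusion m̂ ⊆ k̂ that may be
false but is defended interactively. The numeral of m is never needed. The bound k ≤ m keeps the
other inclusion true, and at k = m no challenge can cause a restart. -/
theorem judge_searchFrom {W : 𝒜.Name} (HW : HatLike hat W IsNat)
    (H : ∀ n, IsNat n → HatLike hat (hat n) (fun m => m ∈ᵥ n)) {m k : V} (hm : IsNat m)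
    (hk : k ∈ᵥ succ m) :
    𝒜.Judge Γ .searchFrom (𝒜.orth (arr (𝒜.NMem (hat m) W) (arr (Ch k) 𝒜.botF))) := by
  let G : {k // k ∈ᵥ succ m} → Set V := fun k => arr (𝒜.NMem (hat m) W) (arr (Ch k.1) 𝒜.botF)
  let R : {k // k ∈ᵥ succ m} → {k // k ∈ᵥ succ m} → Prop := fun j k => j.1 = succ k.1
  refine .fix (G := G) (R := R) (fun t ht ih k => ?_) (fun k => ?_) ⟨k, hk⟩
  · have : Dfn fun v : Fin 1 → V =>
        t ∈ 𝒜.orth (arr (𝒜.NMem (hat m) W) (arr (Ch (v 0)) 𝒜.botF)) := by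
      show Dfn fun v : Fin 1 → V => t ∈ 𝒜.orth {ρ | ∃ s, s ∈ 𝒜.orth (𝒜.falsNotMem (hat m).1 W.1) ∧
        ∃ ρ', (∃ r, IsChurch (v 0) r ∧ ∃ π, 𝒜.Stack π ∧ ρ' = sCons r π) ∧ ρ = sCons s ρ'}
      infer_instance
    refine nat_downward_induction hm
      (fun k => t ∈ 𝒜.orth (arr (𝒜.NMem (hat m) W) (arr (Ch k) 𝒜.botF))) ?_ k.2
    intro k hk ih'
    refine ih ⟨k, hk⟩ ?_
    rintro ⟨_, hj⟩ rfl
    exact ih' (hm.succ_mem_succ.1 hj)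
  · obtain ⟨k, hk⟩ := k
    have hk' : IsNat k := hm.succ.of_mem hk
    have hkm : ∀ j, j ∈ᵥ k → j ∈ᵥ m := fun j hj => by
      rcases mem_succ.1 hk with h | rfl
      exacts [hm.trans h hj, hj]
    refine .lam (.lamCh (HW.nmem_elim hk' (.var 1 rfl) ((H m hm).sub_intro fun j hj => ?_)
      ((H k hk').judge_incl (H m hm) hkm) (.var 0 rfl)))
    have hj' : IsNat j := hm.of_mem hj
    refine .less hj' hk' (.var 0 rfl) (.var 2 rfl) (fun hjk => ?_) fun hjk => ?_
    · exact (H k hk').nmem_elim hjk (.var 1 rfl) (judge_refl _) (judge_refl _) (.var 0 rfl)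
    -- A challenge j with j < m and not j < k gives k ≤ j < m, so k + 1 is still at most m and the
    -- search can restart there.
    · have hkm : k ∈ᵥ m := by
        rcases hk'.trichotomy hj' with h | rfl | h
        exacts [absurd h hjk, hj, hm.trans hj h]
      exact .app (.app (.all_elim (F := fun j : {j // R j ⟨k, hk⟩} => G j.1) (.var 4 rfl)
        ⟨⟨succ k, hm.succ_mem_succ.2 hkm⟩, rfl⟩) (.var 3 rfl)) (.church_succ (i := 2) hk' rfl)

end HatLike

end RealizabilityAlgebra

/-! ### Realizers for the defining properties of the first infinite ordinal -/

namespace Tm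

/-- A realizer of `φ → ψ → φ ∧ ψ`. -/
def pair : Tm := .lam (.lam (.lam (.app (.app (.var 0) (.var 2)) (.var 1))))

/-- A realizer of `φ a → ∃ x, φ x`. -/
def witness : Tm := .lam (.lam (.app (.var 0) (.var 1)))

/-- A realizer of: `ω̂` is transitive. -/
def transHat : Tm := .lam (.lam (.lam (.app (.var 2) (.lam (.lam (.lam (.app (.var 4)
  (.app (.app subNMem (.var 2)) (.app (.app subNMem incl) (.var 3))))))))))

/-- A realizer of: the elements of `ω̂` are transitive. -/
def transElem : Tm := .lam (.lam (.lam (.lam (.app (.var 3) (.lam (.lam (.lam (.app (.var 5)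
  (.app (.app subNMem (.var 2)) (.lam (.lam (.lam (.app (.var 7)
    (.app (.app subNMem (.var 2)) (.app (.app subNMem incl)
      (.app (.app subNMem (.var 4)) (.var 6)))))))))))))))))

/-- A realizer of: `ω̂` is nonempty and has no greatest element. -/
def noMaxOmega : Tm := .app (.app pair
  (.app witness (.lam (.app (.app (.app (.var 0) refl) refl) zero))))
  (.lam (.lam (.app (.var 1) (.lam (.lam (.lam (.app (.var 3) (.app (.app pair
    (.lam (.app (.app (.app (.var 0) refl) refl) (succVar 1))))
    (.lam (.app (.app (.app (.var 0) (.var 3)) (.var 2)) (.var 1)))))))))))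

/-- A realizer of: the elements of `ω̂` are empty or have a greatest element. -/
def maxElem : Tm := .lam (.lam (.app (.var 0) (.lam (.lam (.app (.var 3) (.lam (.lam (.lam
  (.caseOf (.var 0)
    (.app (.var 4) (.lam (.app (.var 0) (.app (.app subNMem (.var 3))
      (.lam (.lam (.lam (.var 0))))))))
    (.app (.app (.var 4) (.lam (.app (.app (.var 3) (.var 0)) (.var 1))))
      (.lam (.app (.var 0) (.lam (.lam (.app (.var 1) (.app (.app subNMem (.var 6))
        (.lam (.lam (.lam (.app (.var 3) (.app (.app subNMem (.var 2))
          (.app (.app subNMem incl) irrefl))))))))))))))))))))))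

/-- A realizer of: `ω̂` is the first infinite ordinal. -/
def isOmega : Tm := .app (.app pair (.app (.app pair transHat) transElem))
  (.app (.app pair noMaxOmega) maxElem)

/-- A realizer of `ω̂ ≃ ω`. -/
def omegaHat : Tm := .app witness (.app (.app pair isOmega) (.app (.app pair refl) refl))

/-- A realizer of `ℷ(dom ω̂) ≃ ω`. -/
def gimelOmega : Tm := .app witness (.app (.app pair isOmega) (.app (.app pair
  (.lam (.app (.app searchFrom (.var 0)) zero)))
  (.lam (.lam (.app (.app (.var 1) refl) refl)))))

end Tm

namespace RealizabilityAlgebra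

variable {V : Type u} [ZFModel V] {𝒜 : RealizabilityAlgebra V}

/-! ### The first infinite ordinal -/

variable (𝒜) in
/-- The falsity value of `a ∈ b`. -/
def memF (a b : 𝒜.Name) : Set V := arr (𝒜.NMem a b) 𝒜.botF

variable (𝒜) in
/-- The falsity value of a conjunction. -/
def andF (F G : Set V) : Set V :=
  arr (𝒜.orth (arr (𝒜.orth F) (arr (𝒜.orth G) 𝒜.botF))) 𝒜.botF

variable (𝒜) in
/-- The falsity value of an existential statement. -/
def exF (F : 𝒜.Name → Set V) : Set V :=
  arr (𝒜.orth (⋃ a, arr (𝒜.orth (F a)) 𝒜.botF)) 𝒜.botF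

variable (𝒜) in
/-- The falsity value of a statement with a universal quantifier over the elements of `b`. -/
def allMemF (b : 𝒜.Name) (F : 𝒜.Name → Set V) : Set V := ⋃ a, arr (𝒜.orth (𝒜.memF a b)) (F a)

variable (𝒜) in
/-- The falsity value of the transitivity of `a`. -/
def transSetF (a : 𝒜.Name) : Set V := 𝒜.allMemF a fun y => 𝒜.allMemF y fun z => 𝒜.memF z a

variable (𝒜) in
/-- The falsity value of: `a` is nonempty and has no greatest element. -/
def noMaxF (a : 𝒜.Name) : Set V :=
  𝒜.andF (𝒜.exF fun x => 𝒜.memF x a)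
    (𝒜.allMemF a fun x => 𝒜.exF fun y => 𝒜.andF (𝒜.memF y a) (𝒜.memF x y))

variable (𝒜) in
/-- The falsity value of: `a` is the first infinite ordinal. -/
def isOmegaF (a : 𝒜.Name) : Set V :=
  𝒜.andF (𝒜.andF (𝒜.transSetF a) (𝒜.allMemF a 𝒜.transSetF))
    (𝒜.andF (𝒜.noMaxF a) (𝒜.allMemF a fun x => arr (𝒜.orth (𝒜.noMaxF x)) 𝒜.botF))

/-- The bound variables are concrete, so all updates of the assignment compute away and the formula
unfolds definitionally to combinators on falsity values. -/
theorem falsity_simeqOmega (a : 𝒜.Name) (v : ℕ → 𝒜.Name) :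
    𝒜.falsity (Fml.simeqOmega a) v = 𝒜.exF fun w =>
      𝒜.andF (𝒜.isOmegaF w) (𝒜.andF (𝒜.falsSub a.1 w.1) (𝒜.falsSub w.1 a.1)) := rfl

section

variable {Γ : List (Set V)} {t s : Tm} {F G : Set V} {E : 𝒜.Name → Set V} {a b : 𝒜.Name}

theorem Judge.and_intro (h : 𝒜.Judge Γ t (𝒜.orth F)) (h' : 𝒜.Judge Γ s (𝒜.orth G)) :
    𝒜.Judge Γ (.app (.app .pair t) s) (𝒜.orth (𝒜.andF F G)) :=
  .app (X := 𝒜.orth G) (.app (X := 𝒜.orth F) (.lam (.lam (.lam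
    (.app (X := 𝒜.orth G) (.app (X := 𝒜.orth F) (.var 0 rfl) (.var 2 rfl)) (.var 1 rfl))))) h) h'

theorem Judge.and_elim (h : 𝒜.Judge Γ t (𝒜.orth (𝒜.andF F G)))
    (h' : 𝒜.Judge (𝒜.orth G :: 𝒜.orth F :: Γ) s (𝒜.orth 𝒜.botF)) :
    𝒜.Judge Γ (.app t (.lam (.lam s))) (𝒜.orth 𝒜.botF) := .app h (.lam (.lam h'))

theorem Judge.ex_intro (a : 𝒜.Name) (h : 𝒜.Judge Γ t (𝒜.orth (E a))) :
    𝒜.Judge Γ (.app .witness t) (𝒜.orth (𝒜.exF E)) :=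
  .app (X := 𝒜.orth (E a)) (.lam (.lam (.app
    (.all_elim (F := fun a => arr (𝒜.orth (E a)) 𝒜.botF) (.var 0 rfl) a) (.var 1 rfl)))) h

theorem Judge.ex_elim (h : 𝒜.Judge Γ t (𝒜.orth (𝒜.exF E)))
    (h' : ∀ a, 𝒜.Judge (𝒜.orth (E a) :: Γ) s (𝒜.orth 𝒜.botF)) :
    𝒜.Judge Γ (.app t (.lam s)) (𝒜.orth 𝒜.botF) := .app h (.all_intro fun a => .lam (h' a))

theorem Judge.allMem_intro (h : ∀ a, 𝒜.Judge (𝒜.orth (𝒜.memF a b) :: Γ) t (𝒜.orth (E a))) :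
    𝒜.Judge Γ (.lam t) (𝒜.orth (𝒜.allMemF b E)) := .all_intro fun a => .lam (h a)

theorem Judge.allMem_elim (a : 𝒜.Name) (h : 𝒜.Judge Γ t (𝒜.orth (𝒜.allMemF b E)))
    (h' : 𝒜.Judge Γ s (𝒜.orth (𝒜.memF a b))) : 𝒜.Judge Γ (.app t s) (𝒜.orth (E a)) :=
  .app (.all_elim (F := fun a => arr (𝒜.orth (𝒜.memF a b)) (E a)) h a) h'

theorem Judge.mem_intro (h : 𝒜.Judge (𝒜.NMem a b :: Γ) t (𝒜.orth 𝒜.botF)) :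
    𝒜.Judge Γ (.lam t) (𝒜.orth (𝒜.memF a b)) := .lam h

theorem Judge.mem_elim (h : 𝒜.Judge Γ t (𝒜.orth (𝒜.memF a b)))
    (h' : 𝒜.Judge Γ s (𝒜.NMem a b)) : 𝒜.Judge Γ (.app t s) (𝒜.orth 𝒜.botF) := .app h h'

end

section OmegaHat

variable {hat : V → 𝒜.Name} {W : 𝒜.Name}

theorem judge_transHat (HW : HatLike hat W IsNat)
    (H : ∀ n, IsNat n → HatLike hat (hat n) (fun m => m ∈ᵥ n)) : 𝒜.Judge [] .transHat (𝒜.orth (𝒜.transSetF W)) := by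
  refine .allMem_intro fun y => .allMem_intro fun z => .mem_intro (.mem_elim (.var 2 rfl)
    (HW.nmem_intro fun m hm => .mem_elim (a := z) (.var 4 rfl) (.subNMem (b := hat m) (.var 2 rfl)
      (.subNMem (b := W) ?_ (.var 3 rfl)))))
  exact (H m hm).judge_incl HW fun k hk => hm.of_mem hk

theorem judge_transElem (HW : HatLike hat W IsNat)
    (H : ∀ n, IsNat n → HatLike hat (hat n) (fun m => m ∈ᵥ n)) : 𝒜.Judge [] .transElem (𝒜.orth (𝒜.allMemF W 𝒜.transSetF)) := by
  refine .allMem_intro fun y => .allMem_intro fun z => .allMem_intro fun w => .mem_intro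
    (.mem_elim (.var 3 rfl) (HW.nmem_intro fun m hm => .mem_elim (a := z) (.var 5 rfl)
      (.subNMem (b := hat m) (.var 2 rfl) ((H m hm).nmem_intro fun k hk =>
        .mem_elim (a := w) (.var 7 rfl) (.subNMem (b := hat k) (.var 2 rfl)
          (.subNMem (b := hat m) ?_ (.subNMem (b := y) (.var 4 rfl) (.var 6 rfl))))))))
  exact (H k (hm.of_mem hk)).judge_incl (H m hm) fun j hj => hm.trans hk hj

/-- An element x ≃ m̂ comes with the numeral of m. Adding one gives the numeral under which the next
hat name, which has m̂ as an element, belongs to ω̂. -/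
theorem judge_noMaxOmega (HW : HatLike hat W IsNat)
    (H : ∀ n, IsNat n → HatLike hat (hat n) (fun m => m ∈ᵥ n)) : 𝒜.Judge [] .noMaxOmega (𝒜.orth (𝒜.noMaxF W)) := by
  refine .and_intro (.ex_intro (hat emp) (.mem_intro (HW.nmem_elim .zero (.var 0 rfl)
    (judge_refl _) (judge_refl _) .church_zero))) (.allMem_intro fun x => .lam (.mem_elim
      (.var 1 rfl) (HW.nmem_intro fun m hm => .app (X := 𝒜.orth (𝒜.andF
        (𝒜.memF (hat (succ m)) W) (𝒜.memF x (hat (succ m))))) ?_ (.and_intro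
          (.mem_intro (HW.nmem_elim hm.succ (.var 0 rfl) (judge_refl _) (judge_refl _)
            (.church_succ (i := 1) hm rfl)))
          (.mem_intro ((H _ hm.succ).nmem_elim (m := m) (by simp) (.var 0 rfl) (.var 3 rfl)
            (.var 2 rfl) (.var 1 rfl)))))))
  exact .all_elim (F := fun y => arr (𝒜.orth (𝒜.andF (𝒜.memF y W) (𝒜.memF x y))) 𝒜.botF)
    (.var 3 rfl) (hat (succ m))

/-- Let x ≃ n̂ and split on the numeral of n. For n = 0 an element of x is absurd. For n = m + 1, a
y in x with m̂ ∈ y would be some k̂ with k ≤ m, whence m̂ ∈ k̂ ⊆ m̂, contrary to irreflexivity. -/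
theorem judge_maxElem (HW : HatLike hat W IsNat)
    (H : ∀ n, IsNat n → HatLike hat (hat n) (fun m => m ∈ᵥ n)) : 𝒜.Judge [] .maxElem
    (𝒜.orth (𝒜.allMemF W fun x => arr (𝒜.orth (𝒜.noMaxF x)) 𝒜.botF)) := by
  refine .allMem_intro fun x => .lam (.and_elim (.var 0 rfl) (.mem_elim (.var 3 rfl)
    (HW.nmem_intro fun n hn => .caseOf (n := n) (fun π hπ => hπ) (.var 0 rfl) (fun h => ?_)
      fun m h => ?_)))
  · subst h
    exact .ex_elim (.var 4 rfl) fun z => .mem_elim (.var 0 rfl) (.subNMem (b := hat emp)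
      (.var 3 rfl) ((H emp .zero).nmem_intro fun m hm => absurd hm (not_mem_emp m)))
  · subst h
    have hm : IsNat m := hn.of_mem (by simp)
    refine .ex_elim (.allMem_elim
      (E := fun z => 𝒜.exF fun y => 𝒜.andF (𝒜.memF y x) (𝒜.memF z y)) (hat m) (.var 4 rfl) (.mem_intro ((H _ hn).sub_elim (b := x)
      (m := m) (by simp) (.var 3 rfl) (.var 0 rfl) (.var 1 rfl)))) fun y => .and_elim (.var 0 rfl)
      (.mem_elim (a := y) (.var 1 rfl) (.subNMem (b := hat (succ m)) (.var 6 rfl)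
        ((H _ hn).nmem_intro fun k hk => .mem_elim (a := hat m) (.var 3 rfl)
          (.subNMem (b := hat k) (.var 2 rfl) (.subNMem (b := hat m) ?_ (judge_irrefl _))))))
    refine (H k (hn.of_mem hk)).judge_incl (H m hm) fun j hj => ?_
    rcases mem_succ.1 hk with h | rfl
    exacts [hm.trans h hj, hj]

theorem judge_isOmega (HW : HatLike hat W IsNat)
    (H : ∀ n, IsNat n → HatLike hat (hat n) (fun m => m ∈ᵥ n)) : 𝒜.Judge [] .isOmega (𝒜.orth (𝒜.isOmegaF W)) :=
  .and_intro (.and_intro (judge_transHat HW H) (judge_transElem HW H))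
    (.and_intro (judge_noMaxOmega HW H) (judge_maxElem HW H))

theorem judge_omegaHat (HW : HatLike hat W IsNat)
    (H : ∀ n, IsNat n → HatLike hat (hat n) (fun m => m ∈ᵥ n))
    (v : ℕ → 𝒜.Name) :
    𝒜.Judge [] .omegaHat (𝒜.orth (𝒜.falsity (Fml.simeqOmega W) v)) :=
  falsity_simeqOmega W v ▸
    .ex_intro W (.and_intro (judge_isOmega HW H) (.and_intro (judge_refl W) (judge_refl W)))

/-- ω̂ is again the witness, so only the two inclusions with the gimel name are new. -/
theorem judge_gimelOmega (HW : HatLike hat W IsNat)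
    (H : ∀ n, IsNat n → HatLike hat (hat n) (fun m => m ∈ᵥ n))
    {G : 𝒜.Name} (hG : 𝒜.IsGimel (𝒜.InDom W.1) G.1) (v : ℕ → 𝒜.Name) :
    𝒜.Judge [] .gimelOmega (𝒜.orth (𝒜.falsity (Fml.simeqOmega G) v)) := by
  have hdom : ∀ c, 𝒜.InDom W.1 c → ∃ m, IsNat m ∧ c = (hat m).1 := fun c ⟨π, _, hc⟩ =>
    let ⟨m, hm, e, _⟩ := (HW.mem_iff c π).1 hc
    ⟨m, hm, e⟩
  have heps : ∀ m, IsNat m → 𝒜.botF ⊆ epsF G.1 (hat m).1 := by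
    intro m hm π hπ
    -- The numeral of m is needed in `V` only to see that m̂ lies in the domain of ω̂. It does not
    -- enter the realizer.
    obtain ⟨t, ht⟩ := exists_isChurch hm
    exact (hG _).2 ⟨_, π, ⟨sCons t π, .cons ht.isTerm hπ,
      (HW.mem_iff _ _).2 ⟨m, hm, rfl, t, π, ht, hπ, rfl⟩⟩, hπ, rfl⟩
  rw [falsity_simeqOmega]
  refine .ex_intro W (.and_intro (judge_isOmega HW H) (.and_intro ?_ ?_))
  · refine .sub_intro fun c ⟨σ, hσ, hc⟩ => ?_
    obtain ⟨b, _, hb, -, e⟩ := (hG _).1 hc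
    obtain ⟨rfl, -⟩ := opair_inj.1 e
    obtain ⟨m, hm, e⟩ := hdom _ hb
    obtain rfl : c = hat m := Subtype.ext e
    -- An element of the gimel name comes with an arbitrary stack and no numeral, so the search
    -- starts at 0, which is at most any m.
    refine .anti (G := 𝒜.botF) (.app (.app (judge_searchFrom HW H hm hm.emp_mem_succ)
      (.var 0 rfl)) .church_zero) fun π hπ => ?_
    obtain ⟨_, _, _, hπ', e⟩ := (hG _).1 hπ
    obtain ⟨-, rfl⟩ := opair_inj.1 e
    exact hπ'
  · exact HW.sub_intro fun m hm => .anti (.nmem_elim (b := G) (.var 1 rfl) (judge_refl (hat m))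
      (judge_refl _)) (heps m hm)

end OmegaHat

theorem forcesWithoutInstructions_of_judge {φ : Fml 𝒜.Name} (t : Tm)
    (h : ∀ v, 𝒜.Judge [] t (𝒜.orth (𝒜.falsity φ v))) : 𝒜.ForcesWithoutInstructions φ :=
  -- With an empty context every substitution by closed terms is allowed. `tCC` is a default that
  -- involves neither continuation constants nor special instructions.
  ⟨t.inst 0 fun _ => tCC, t.isRealizerOver_inst, t.isRealizerOver_inst, fun v =>
    h v _ (fun _ => IsTermAt.cc .zero) (by simp)⟩

end RealizabilityAlgebra

end Realizability

theorem mainTheorem12 {V : Type*} [ZFModel V] (𝒜 : RealizabilityAlgebra V) :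
    (∃! W : 𝒜.Name, 𝒜.IsOmegaHat W.1) ∧
    ∀ W : 𝒜.Name, 𝒜.IsOmegaHat W.1 →
      𝒜.ForcesWithoutInstructions (Fml.simeqOmega W) ∧
      ∃ G : 𝒜.Name, 𝒜.IsGimel (𝒜.InDom W.1) G.1 ∧
        𝒜.ForcesWithoutInstructions (Fml.simeqOmega G) := by
  refine ⟨𝒜.existsUnique_isOmegaHat, fun W hW => ?_⟩
  obtain ⟨hat, hW, hhat⟩ := hW.exists_hat
  have HW : RealizabilityAlgebra.HatLike hat W IsNat := ⟨hW⟩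
  have H : ∀ n, IsNat n → RealizabilityAlgebra.HatLike hat (hat n) (fun m => m ∈ᵥ n) := fun n hn =>
    ⟨hhat n hn⟩
  obtain ⟨G, hG⟩ := RealizabilityAlgebra.exists_isGimel_inDom W
  exact ⟨RealizabilityAlgebra.forcesWithoutInstructions_of_judge _ fun v =>
    RealizabilityAlgebra.judge_omegaHat HW H v, G, hG,
    RealizabilityAlgebra.forcesWithoutInstructions_of_judge _ fun v =>
      RealizabilityAlgebra.judge_gimelOmega HW H hG v⟩
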